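/- **Asymptotics of zeroth-order stochastic optimization with strongly convex functions.** Let $d\ge 1$ and $\beta\ge 2$ be integers, $\mu>0$, $M_\beta>0$. A function $f:\mathbb R^d\to\mathbb R$ is called *$\beta$-smooth on $S$ with constant $M$* if it is $C^{\beta-1}$ and, for every unit vector $v$, the map $x\mapsto D^{\beta-1}f(x)[v,\dots,v]$ is $M^\beta$-Lipschitz on $S$. Let $k(r)=\sum_{m=0}^{\beta}p_m'(0)\,p_m(r)$, where $p_m=\sqrt{2m+1}\,L_m$ and $L_m$ is the $m$-th Legendre polynomial. At each round $n\ge1$, independently of the past, $r_n$ is drawn uniformly in $[-1,1]$ and $u_n$ uniformly on the unit sphere, independently of each other. Every noise variable below is square integrable and, conditionally on the past and on $(r_n,u_n)$, centred with variance at most $\sigma^2$. **(i) Unconstrained case.** For every $M_2>0$ there are positive parameters $\gamma_n=\gamma_n^{(N)}$, $\delta_n=\delta_n^{(N)}$, depending only on $(d,\beta,\mu,M_\beta,M_2)$ and on $n,N$, such that for all $\sigma\ge 0$ and $D$ there is $N_0$ with the following property. Let $N\ge N_0$, let $f$ be $\mu$-strongly convex on $\mathbb R^d$, $\beta$-smooth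 on $\mathbb R^d$ with constant $M_\beta$ and $2$-smooth on $\mathbb R^d$ with constant $M_2$, let $x^\star$ be its minimizer and let $\|x_0-x^\star\|\le D$. Then the two-point algorithm $$x_n=x_{n-1}-\gamma_n\frac{d}{2\delta_n}\Big[f(x_{n-1}+\delta_nr_nu_n)+\varepsilon_n^+-f(x_{n-1}-\delta_nr_nu_n)-\varepsilon_n^-\Big]k(r_n)\,u_n$$ satisfies $$\mathbb E\|x_N-x^\star\|^2\le \frac{16M_\beta^2}{\mu^2}(2\sigma^2+16)\Big(\frac{d^2\log(N+1)}{N}\Big)^{\frac{\beta-1}{\beta}}+\frac{48\beta^3M_2^4}{\mu^2M_\beta^2}\Big(\frac{d^2\log(N+1)}{N}\Big)^{\frac{\beta+1}{\beta}},$$ and $\mathbb E f(x_N)-f(x^\star)\le\frac{M_2^2}{2}\,\mathbb E\|x_N-x^\star\|^2$. **(ii) Constrained case.** There are positive parameters $\gamma_n=\gamma^{(N)}_n$ and $\delta=\delta^{(N)}$ (constant in $n$, with $\delta^{(N)}\to0$ as $N\to\infty$), depending only on $(d,\beta,\mu,M_\beta)$ and on $n,N$, such that for every $\sigma\ge0$,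 every compact convex $K\subset\mathbb R^d$ and every $f$ that is $\mu$-strongly convex on $\mathbb R^d$ and $\beta$-smooth on $\mathbb R^d$ with constant $M_\beta$, there is $N_0$ with the following property. For $N\ge N_0$, $x_0\in K$, $x^\star$ the minimizer of $f$ on $K$, and $C_\delta$ any bound of $|f|$ on the closed $\delta$-neighbourhood of $K$, the one-point algorithm $$x_n=\Pi_K\Big(x_{n-1}-\gamma_n\frac{d}{\delta}\big[f(x_{n-1}+\delta r_nu_n)+\varepsilon_n\big]k(r_n)\,u_n\Big),$$ with $\Pi_K$ the Euclidean projection on $K$, satisfies $$\mathbb E\|x_N-x^\star\|^2\le 16\beta\Big(\frac{d^2}{N}\Big)^{\frac{\beta-1}{\beta}}\Big(\frac{2eM_\beta}{\mu}\Big)^2\big(3C_\delta^2+3\sigma^2+1\big).$$ If moreover $x^\star$ minimizes $f$ over $\mathbb R^d$ and $f$ is $2$-smooth on $K$ with constant $M_2$, then $\mathbb E f(x_N)-f(x^\star)\le\frac{M_2^2}{2}\mathbb E\|x_N-x^\star\|^2$, and in particular $$\mathbb E f(x_N)-f(x^\star)\le 16\beta\Big(\frac{d^2}{N}\Big)^{\frac{\beta-1}{\beta}}\Big(\frac{2eM_\beta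 M_2}{\mu}\Big)^2\big(3C_\delta^2+3\sigma^2+1\big).$$ All the expectations above are of integrable variables. -/

import Mathlib

open MeasureTheory ProbabilityTheory Filter Topology

noncomputable section

/-- `f : ℝᵈ → ℝ` is `β`-th order smooth on `S` with constant `M`: it is `(β-1)`-times
continuously differentiable and, for every unit vector `v`, the `(β-1)`-th directional derivative
`x ↦ D^{β-1} f(x)[v, …, v]` is Lipschitz on `S` with constant `M ^ β`. -/
def SmoothOrderOn {d : ℕ} (S : Set (EuclideanSpace ℝ (Fin d))) (β : ℕ) (M : ℝ)
    (f : EuclideanSpace ℝ (Fin d) → ℝ) : Prop :=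
  ContDiff ℝ (((β - 1 : ℕ) : ℕ∞)) f ∧
    ∀ v : EuclideanSpace ℝ (Fin d), ‖v‖ = 1 → ∀ x ∈ S, ∀ y ∈ S,
      |iteratedFDeriv ℝ (β - 1) f x (fun _ => v) - iteratedFDeriv ℝ (β - 1) f y (fun _ => v)|
        ≤ M ^ β * ‖x - y‖

/-- The `m`-th Legendre polynomial, by Rodrigues' formula. -/
def legendrePoly (m : ℕ) : Polynomial ℝ :=
  Polynomial.C (1 / (2 ^ m * (m.factorial : ℝ))) *
    Polynomial.derivative^[m] ((Polynomial.X ^ 2 - 1) ^ m)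

/-- The `m`-th orthonormal polynomial for the uniform distribution on `[-1, 1]`. -/
def orthoPoly (m : ℕ) : Polynomial ℝ :=
  Polynomial.C (Real.sqrt (2 * m + 1)) * legendrePoly m

/-- The kernel `k(r) = ∑_{m = 0}^{β} p_m'(0) p_m(r)`. -/
def kernelFun (β : ℕ) (r : ℝ) : ℝ :=
  ∑ m ∈ Finset.range (β + 1),
    (Polynomial.derivative (orthoPoly m)).eval 0 * (orthoPoly m).eval r

/-- The uniform distribution on `[-1, 1]`. -/
def unifInterval : Measure ℝ :=
  (volume (Set.Icc (-1 : ℝ) 1))⁻¹ • volume.restrict (Set.Icc (-1 : ℝ) 1)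

/-- The uniform distribution on the unit sphere of `ℝᵈ`, as a measure on `ℝᵈ`. -/
def unifSphere (d : ℕ) : Measure (EuclideanSpace ℝ (Fin d)) :=
  Measure.map Subtype.val
    (((volume : Measure (EuclideanSpace ℝ (Fin d))).toSphere Set.univ)⁻¹ •
      (volume : Measure (EuclideanSpace ℝ (Fin d))).toSphere)

/-- `p` is a point of `K` nearest to `z`. -/
def IsNearest {d : ℕ} (K : Set (EuclideanSpace ℝ (Fin d))) (z p : EuclideanSpace ℝ (Fin d)) :
    Prop :=
  p ∈ K ∧ ∀ q ∈ K, ‖z - p‖ ≤ ‖z - q‖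

open Classical in
/-- The Euclidean projection on `K` (the nearest point exists and is unique when `K` is nonempty,
closed and convex). -/
def projOn {d : ℕ} (K : Set (EuclideanSpace ℝ (Fin d))) (z : EuclideanSpace ℝ (Fin d)) :
    EuclideanSpace ℝ (Fin d) :=
  if h : ∃ p, IsNearest K z p then h.choose else z

/-- The two-point algorithm, started at `x₀`, with step sizes `γ n`, smoothing radii `δ n`, radial
samples `r n`, directions `u n` and feedbacks `f (x + δ r u) + εp n` and `f (x - δ r u) + εm n`
at round `n ≥ 1`. -/
def twoPoint {d : ℕ} (f : EuclideanSpace ℝ (Fin d) → ℝ) (k : ℝ → ℝ) (γ δ : ℕ → ℝ)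
    (x₀ : EuclideanSpace ℝ (Fin d)) (r : ℕ → ℝ) (u : ℕ → EuclideanSpace ℝ (Fin d))
    (εp εm : ℕ → ℝ) : ℕ → EuclideanSpace ℝ (Fin d)
  | 0 => x₀
  | n + 1 =>
    let x := twoPoint f k γ δ x₀ r u εp εm n
    x - (γ (n + 1) * (d / (2 * δ (n + 1))) *
      ((f (x + (δ (n + 1) * r (n + 1)) • u (n + 1)) + εp (n + 1)) -
        (f (x - (δ (n + 1) * r (n + 1)) • u (n + 1)) + εm (n + 1))) *
      k (r (n + 1))) • u (n + 1)

/-- The projected one-point algorithm on `K`, with feedback `f (x + δ r u) + ε n` at round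
`n ≥ 1`. -/
def onePoint {d : ℕ} (K : Set (EuclideanSpace ℝ (Fin d))) (f : EuclideanSpace ℝ (Fin d) → ℝ)
    (k : ℝ → ℝ) (γ δ : ℕ → ℝ) (x₀ : EuclideanSpace ℝ (Fin d)) (r : ℕ → ℝ)
    (u : ℕ → EuclideanSpace ℝ (Fin d)) (ε : ℕ → ℝ) : ℕ → EuclideanSpace ℝ (Fin d)
  | 0 => x₀
  | n + 1 =>
    let x := onePoint K f k γ δ x₀ r u ε n
    projOn K (x - (γ (n + 1) * (d / δ (n + 1)) *
      (f (x + (δ (n + 1) * r (n + 1)) • u (n + 1)) + ε (n + 1)) *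
      k (r (n + 1))) • u (n + 1))

/-- The random queries: at each round `n + 1`, given the past `ℱ n`, the pair
`(r (n+1), u (n+1))` is drawn afresh, with `r` uniform on `[-1, 1]` and `u` uniform on the unit
sphere, independently of each other. -/
structure IsSampling {Ω : Type*} {mΩ : MeasurableSpace Ω} {d : ℕ} (P : Measure Ω)
    (ℱ : Filtration ℕ mΩ) (r : ℕ → Ω → ℝ) (u : ℕ → Ω → EuclideanSpace ℝ (Fin d)) : Prop where
  measurable_r : ∀ n, Measurable[ℱ (n + 1)] (r (n + 1))
  measurable_u : ∀ n, Measurable[ℱ (n + 1)] (u (n + 1))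
  law : ∀ n, P.map (fun ω => (r (n + 1) ω, u (n + 1) ω)) = unifInterval.prod (unifSphere d)
  indep : ∀ n,
    Indep (ℱ n) (MeasurableSpace.comap (fun ω => (r (n + 1) ω, u (n + 1) ω)) inferInstance) P

/-- The noise `ε`: conditionally on the past and on the current query, `ε (n+1)` is centred and
has variance at most `σ ^ 2`; its law may depend on the past and on the query. -/
structure IsNoise {Ω : Type*} {mΩ : MeasurableSpace Ω} {d : ℕ} (P : Measure Ω)
    (ℱ : Filtration ℕ mΩ) (r : ℕ → Ω → ℝ) (u : ℕ → Ω → EuclideanSpace ℝ (Fin d)) (σ : ℝ)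
    (ε : ℕ → Ω → ℝ) : Prop where
  measurable : ∀ n, Measurable[ℱ (n + 1)] (ε (n + 1))
  memLp : ∀ n, MemLp (ε (n + 1)) 2 P
  centred : ∀ n,
    P[ε (n + 1) | (ℱ n : MeasurableSpace Ω) ⊔
      MeasurableSpace.comap (fun ω => (r (n + 1) ω, u (n + 1) ω)) inferInstance] =ᵐ[P] 0
  variance : ∀ n, ∀ᵐ ω ∂P,
    (P[fun ω => ε (n + 1) ω ^ 2 | (ℱ n : MeasurableSpace Ω) ⊔
      MeasurableSpace.comap (fun ω => (r (n + 1) ω, u (n + 1) ω)) inferInstance]) ω ≤ σ ^ 2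

end

/-! ### Legendre polynomials and the kernel -/

/-! Both algorithms are stochastic gradient descent with a biased gradient estimate, so the theorem
reduces to a bias bound, a second-moment bound and a scalar recursion.

Kernel. Since the `p_m` are orthonormal, the kernel represents `q ↦ q'(0)` on polynomials of degree
at most `β` (`polyMean_kernelPoly_mul`). By Parseval its second moment is `∑ p_m'(0)²`, which is
cubic in `β` because `L_m'(0)² ≤ m` (`polyMean_kernelPoly_sq_le`). Against a function with Lipschitz
`(β-1)`-th derivative, the kernel extracts the derivative at `0` with an error of order `δ^β`.

Bias. The estimator carries a factor `d`, which a direct Taylor bound would leave in the error.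
Integration by parts on the sphere (`integral_inner_mul_unifSphere`) absorbs it: `d` times the mean
of `⟨u, w⟩ f(x + δ r u)` becomes a mean of three terms without `d`. One of them is the derivative
along `w` at a point displaced along `u`, while smoothness controls only pure directional
derivatives. A second copy of the kernel, along `w`, turns that derivative back into values of `f`,
and Fubini exchanges the two directions (`abs_integral_kernel_fderiv_sub_le`). The resulting bias
`ζ`, of order `δ^(β-1)`, has no dimension factor (`abs_integral_estimator_sub_le`).

Recursion. Strong convexity gives `μ ‖y - x⋆‖² ≤ Df(y)(y - x⋆)`, and half of this absorbs the bias
(`IsSampling.step`). With steps proportional to `1 / (μ n)`, multiplying by consecutive integers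
makes the recursion telescope (`recursion_bound`). What is left is `ζ² / μ²` plus the variance over
`N`, that is `δ^(2(β-1)) + 1 / (N δ²)` up to constants, and `δ² ∼ N^(-1/β)` balances the two.

Constrained case: values of `f` are bounded by `C` near `K`, projection is nonexpansive, and the
dimension-dependent radius gives the explicit constants already for `N ≥ 1`. Unconstrained case: the
symmetric difference of `f` grows with `‖x - x⋆‖`, so the second moment does too; an offset in the
step sizes absorbs that growth. The rate `N^(-(β-1)/β)` then holds with a large constant uniform in
`f`, and the logarithm in the claimed bound dominates this constant once `N` is large. -/

/-- The mean of a polynomial over `[-1, 1]`. -/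
noncomputable def polyMean : Polynomial ℝ →ₗ[ℝ] ℝ where
  toFun q := ∫ x in (-1 : ℝ)..1, q.eval x / 2
  map_add' p q := by
    simp only [Polynomial.eval_add, add_div]
    exact intervalIntegral.integral_add ((p.continuous.div_const _).intervalIntegrable _ _)
      ((q.continuous.div_const _).intervalIntegrable _ _)
  map_smul' c q := by
    simp only [Polynomial.eval_smul, smul_eq_mul, mul_div_assoc, RingHom.id_apply]
    exact intervalIntegral.integral_const_mul _ _

lemma polyMean_C_mul (c : ℝ) (q : Polynomial ℝ) :
    polyMean (Polynomial.C c * q) = c * polyMean q := by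
  rw [← Polynomial.smul_eq_C_mul, map_smul, smul_eq_mul]

lemma polyMean_derivative (q : Polynomial ℝ) :
    polyMean (Polynomial.derivative q) = (q.eval 1 - q.eval (-1)) / 2 := by
  simp only [polyMean, LinearMap.coe_mk, AddHom.coe_mk]
  rw [intervalIntegral.integral_eq_sub_of_hasDerivAt (f := fun x => q.eval x / 2)
    (fun x _ => (q.hasDerivAt x).div_const 2)
    ((q.derivative.continuous.div_const _).intervalIntegrable _ _)]
  ring

lemma polyMean_one : polyMean 1 = 1 := by
  have := polyMean_derivative Polynomial.X
  simpa using this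

lemma polyMean_derivative_mul (p q : Polynomial ℝ) (h1 : p.eval 1 = 0) (h2 : p.eval (-1) = 0) :
    polyMean (Polynomial.derivative p * q) = -polyMean (p * Polynomial.derivative q) := by
  have h := polyMean_derivative (p * q)
  rw [Polynomial.derivative_mul, map_add] at h
  simp [h1, h2] at h
  linarith

/-- `±1` are roots of multiplicity `m`, and fewer than `m` derivatives leave a root. This kills
every boundary term when Rodrigues' formula is integrated by parts. -/
lemma eval_iterate_derivative_weight {m i : ℕ} (hi : i < m) {a : ℝ} (ha : a ^ 2 = 1) :
    (Polynomial.derivative^[i] ((Polynomial.X ^ 2 - 1 : Polynomial ℝ) ^ m)).eval a = 0 := by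
  have h1 : (Polynomial.X - Polynomial.C a) ∣ (Polynomial.X ^ 2 - 1 : Polynomial ℝ) := by
    rw [Polynomial.dvd_iff_isRoot]; simp [ha]
  have h2 := Polynomial.pow_sub_dvd_iterate_derivative_of_pow_dvd i (pow_dvd_pow_of_dvd h1 m)
  have h3 := (dvd_pow_self _ (Nat.sub_ne_zero_of_lt hi)).trans h2
  exact Polynomial.dvd_iff_isRoot.1 h3

lemma polyMean_iterate_derivative_weight_mul (m : ℕ) {j : ℕ} (hj : j ≤ m) (q : Polynomial ℝ) :
    polyMean (Polynomial.derivative^[j] ((Polynomial.X ^ 2 - 1) ^ m) * q) =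
      (-1) ^ j * polyMean ((Polynomial.X ^ 2 - 1) ^ m * Polynomial.derivative^[j] q) := by
  induction j generalizing q with
  | zero => simp
  | succ j ih =>
    rw [Function.iterate_succ_apply', polyMean_derivative_mul, ih (by omega),
      Function.iterate_succ_apply, pow_succ]
    · ring
    · exact eval_iterate_derivative_weight hj (by norm_num)
    · exact eval_iterate_derivative_weight hj (by norm_num)

lemma polyMean_weight (m : ℕ) :
    polyMean ((Polynomial.X ^ 2 - 1) ^ m) * (2 * m).factorial * (2 * m + 1) =
      (-1) ^ m * (2 ^ m * m.factorial) ^ 2 := by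
  induction m with
  | zero => simp [polyMean_one]
  | succ m ih =>
    -- This polynomial vanishes at `±1`, so its derivative has mean zero; writing `X² = (X² - 1) +
    -- 1` in the derivative gives a two-term recursion in `m`.
    have h := polyMean_derivative (Polynomial.X * (Polynomial.X ^ 2 - 1) ^ (m + 1))
    have h2 : Polynomial.derivative (Polynomial.X * (Polynomial.X ^ 2 - 1 : Polynomial ℝ) ^ (m + 1))
        = Polynomial.C (2 * m + 3 : ℝ) * (Polynomial.X ^ 2 - 1) ^ (m + 1) +
          Polynomial.C (2 * m + 2 : ℝ) * (Polynomial.X ^ 2 - 1) ^ m := by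
      simp only [Polynomial.derivative_mul, Polynomial.derivative_X, Polynomial.derivative_pow,
        Polynomial.derivative_sub, Polynomial.derivative_one, map_add, map_mul, map_natCast,
        map_ofNat]
      simp
      ring
    rw [h2, map_add, polyMean_C_mul, polyMean_C_mul] at h
    simp at h
    have h3 : ((2 * (m + 1)).factorial : ℝ) = (2 * m + 2) * (2 * m + 1) * (2 * m).factorial := by
      rw [show 2 * (m + 1) = (2 * m + 1) + 1 by ring, Nat.factorial_succ, Nat.factorial_succ]
      push_cast; ring
    rw [h3, Nat.factorial_succ]
    push_cast
    have h4 : polyMean ((Polynomial.X ^ 2 - 1) ^ (m + 1)) * (2 * m + 3) =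
      -((2 * m + 2) * polyMean ((Polynomial.X ^ 2 - 1) ^ m)) := by linarith
    calc _ = polyMean ((Polynomial.X ^ 2 - 1) ^ (m + 1)) * (2 * m + 3) *
          ((2 * m + 2) * (2 * m + 1) * (2 * m).factorial) := by ring
      _ = -(2 * m + 2) ^ 2 *
          (polyMean ((Polynomial.X ^ 2 - 1) ^ m) * (2 * m).factorial * (2 * m + 1)) := by
        rw [h4]; ring
      _ = _ := by rw [ih]; ring

/-! ### Coefficients and orthogonality of the Legendre polynomials -/

lemma natDegree_weight (m : ℕ) :
    ((Polynomial.X ^ 2 - 1 : Polynomial ℝ) ^ m).natDegree = 2 * m := by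
  rw [Polynomial.natDegree_pow, show (1 : Polynomial ℝ) = Polynomial.C 1 from rfl,
    Polynomial.natDegree_X_pow_sub_C, mul_comm]

lemma coeff_weight (m i : ℕ) :
    ((Polynomial.X ^ 2 - 1 : Polynomial ℝ) ^ m).coeff i =
      if 2 ∣ i then (-1) ^ (m - i / 2) * (m.choose (i / 2) : ℝ) else 0 := by
  have h : ((Polynomial.X ^ 2 - 1 : Polynomial ℝ) ^ m) =
      Polynomial.expand ℝ 2 ((Polynomial.X - Polynomial.C 1) ^ m) := by
    simp [Polynomial.expand_X]
  rw [h, Polynomial.coeff_expand (by norm_num), sub_eq_add_neg, ← map_neg,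
    Polynomial.coeff_X_add_C_pow]

lemma coeff_legendrePoly (m i : ℕ) : (legendrePoly m).coeff i =
    1 / (2 ^ m * (m.factorial : ℝ)) *
      ((i + m).descFactorial m * ((Polynomial.X ^ 2 - 1 : Polynomial ℝ) ^ m).coeff (i + m)) := by
  rw [legendrePoly, Polynomial.coeff_C_mul, Polynomial.coeff_iterate_derivative, nsmul_eq_mul]

lemma coeff_legendrePoly_of_lt {m i : ℕ} (h : m < i) : (legendrePoly m).coeff i = 0 := by
  rw [coeff_legendrePoly, Polynomial.coeff_eq_zero_of_natDegree_lt (n := i + m)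
    (by rw [natDegree_weight]; omega)]
  simp

lemma coeff_legendrePoly_self (m : ℕ) : (legendrePoly m).coeff m =
    (2 * m).factorial / (2 ^ m * (m.factorial : ℝ) ^ 2) := by
  have h : ((2 * m).factorial : ℝ) = m.factorial * (2 * m).descFactorial m := by
    have := Nat.factorial_mul_descFactorial (n := 2 * m) (k := m) (by omega)
    rw [show 2 * m - m = m by omega] at this
    exact_mod_cast this.symm
  rw [coeff_legendrePoly, coeff_weight, ← two_mul, h]
  have := m.factorial_pos
  simp
  field_simp

lemma coeff_legendrePoly_self_ne_zero (m : ℕ) : (legendrePoly m).coeff m ≠ 0 := by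
  rw [coeff_legendrePoly_self]; positivity

lemma iterate_derivative_legendrePoly {m n : ℕ} (h : m < n) :
    Polynomial.derivative^[n] (legendrePoly m) = 0 := by
  apply Polynomial.iterate_derivative_eq_zero
  by_contra! h2
  have h3 : (legendrePoly m).natDegree ≤ m :=
    Polynomial.natDegree_le_iff_coeff_eq_zero.2 fun i hi => coeff_legendrePoly_of_lt hi
  omega

lemma iterate_derivative_legendrePoly_self (m : ℕ) :
    Polynomial.derivative^[m] (legendrePoly m) =
      Polynomial.C ((2 * m).factorial / (2 ^ m * (m.factorial : ℝ))) := by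
  ext i
  rw [Polynomial.coeff_iterate_derivative, Polynomial.coeff_C]
  split_ifs with hi
  · subst hi
    rw [zero_add, Nat.descFactorial_self, coeff_legendrePoly_self, nsmul_eq_mul]
    have := m.factorial_pos
    field_simp
  · rw [coeff_legendrePoly_of_lt (by omega), smul_zero]

lemma polyMean_legendrePoly_mul (m : ℕ) (q : Polynomial ℝ) :
    polyMean (legendrePoly m * q) = 1 / (2 ^ m * (m.factorial : ℝ)) *
      ((-1) ^ m * polyMean ((Polynomial.X ^ 2 - 1) ^ m * Polynomial.derivative^[m] q)) := by
  rw [legendrePoly, mul_assoc, polyMean_C_mul, polyMean_iterate_derivative_weight_mul m le_rfl]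

lemma polyMean_legendrePoly_mul_of_lt {m n : ℕ} (h : m < n) :
    polyMean (legendrePoly n * legendrePoly m) = 0 := by
  rw [polyMean_legendrePoly_mul, iterate_derivative_legendrePoly h]; simp

lemma polyMean_legendrePoly_sq (m : ℕ) :
    (2 * m + 1) * polyMean (legendrePoly m * legendrePoly m) = 1 := by
  rw [polyMean_legendrePoly_mul, iterate_derivative_legendrePoly_self, mul_comm _ (Polynomial.C _),
    polyMean_C_mul]
  have h := polyMean_weight m
  have := m.factorial_pos
  have h1 : ((-1 : ℝ) ^ m) * (-1) ^ m = 1 := by rw [← mul_pow]; norm_num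
  calc _ = (-1 : ℝ) ^ m * (polyMean ((Polynomial.X ^ 2 - 1) ^ m) * (2 * m).factorial * (2 * m + 1))
        / (2 ^ m * (m.factorial : ℝ)) ^ 2 := by field_simp
    _ = ((-1 : ℝ) ^ m * (-1) ^ m) := by rw [h]; field_simp
    _ = 1 := h1

lemma polyMean_orthoPoly_mul (m n : ℕ) :
    polyMean (orthoPoly m * orthoPoly n) = if m = n then 1 else 0 := by
  have h : orthoPoly m * orthoPoly n = Polynomial.C (Real.sqrt (2 * m + 1) * Real.sqrt (2 * n + 1))
      * (legendrePoly m * legendrePoly n) := by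
    rw [orthoPoly, orthoPoly, map_mul]; ring
  rw [h, polyMean_C_mul]
  split_ifs with hmn
  · subst hmn
    rw [Real.mul_self_sqrt (by positivity)]
    exact polyMean_legendrePoly_sq m
  · rcases lt_or_gt_of_ne hmn with h' | h'
    · rw [mul_comm (legendrePoly m), polyMean_legendrePoly_mul_of_lt h', mul_zero]
    · rw [polyMean_legendrePoly_mul_of_lt h', mul_zero]

/-- The kernel as a polynomial. -/
noncomputable def kernelPoly (β : ℕ) : Polynomial ℝ :=
  ∑ m ∈ Finset.range (β + 1),
    Polynomial.C ((Polynomial.derivative (orthoPoly m)).eval 0) * orthoPoly m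

lemma eval_kernelPoly (β : ℕ) (r : ℝ) : (kernelPoly β).eval r = kernelFun β r := by
  simp [kernelPoly, kernelFun, Polynomial.eval_finsetSum]

lemma polyMean_kernelPoly_mul_orthoPoly {β n : ℕ} (hn : n ≤ β) :
    polyMean (kernelPoly β * orthoPoly n) = (Polynomial.derivative (orthoPoly n)).eval 0 := by
  simp only [kernelPoly, Finset.sum_mul, map_sum, mul_assoc, polyMean_C_mul, polyMean_orthoPoly_mul]
  simp
  omega

/-- Both sides are linear in `q` and agree on each `orthoPoly n` with `n ≤ β`. As `orthoPoly n` has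
exact degree `n`, subtracting a multiple of it removes the top coefficient of `q`, and induction on
the degree applies. -/
lemma polyMean_kernelPoly_mul_of_degree_lt {β n : ℕ} (hn : n ≤ β + 1) {q : Polynomial ℝ}
    (hq : q.degree < n) :
    polyMean (kernelPoly β * q) = (Polynomial.derivative q).eval 0 := by
  induction n generalizing q with
  | zero =>
    have : q = 0 := by
      rw [← Polynomial.degree_eq_bot]; simpa using hq
    simp [this]
  | succ n ih =>
    have hne : (orthoPoly n).coeff n ≠ 0 := by
      rw [orthoPoly, Polynomial.coeff_C_mul]
      exact mul_ne_zero (by positivity) (coeff_legendrePoly_self_ne_zero n)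
    set c := q.coeff n / (orthoPoly n).coeff n with hc
    have h1 : (q - Polynomial.C c * orthoPoly n).degree < n := by
      rw [Polynomial.degree_lt_iff_coeff_zero]
      intro i hi
      rw [Polynomial.coeff_sub, Polynomial.coeff_C_mul]
      rcases eq_or_lt_of_le hi with rfl | hi
      · rw [hc]; field_simp; ring
      · rw [Polynomial.degree_lt_iff_coeff_zero] at hq
        rw [hq i hi, orthoPoly, Polynomial.coeff_C_mul, coeff_legendrePoly_of_lt hi]
        simp
    have h2 := ih (by omega) h1
    have h3 := polyMean_kernelPoly_mul_orthoPoly (β := β) (n := n) (by omega)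
    rw [mul_sub, map_sub, mul_left_comm, polyMean_C_mul, h3] at h2
    simp at h2
    linarith

/-- The kernel reproduces the derivative at `0` of polynomials of degree at most `β`. -/
lemma polyMean_kernelPoly_mul {β : ℕ} {q : Polynomial ℝ} (hq : q.natDegree ≤ β) :
    polyMean (kernelPoly β * q) = (Polynomial.derivative q).eval 0 :=
  polyMean_kernelPoly_mul_of_degree_lt le_rfl
    (Polynomial.degree_lt_iff_coeff_zero _ _ |>.2 fun i hi =>
      Polynomial.coeff_eq_zero_of_natDegree_lt (by omega))

/-! ### Second moment of the kernel -/

lemma sq_centralBinom_le (j : ℕ) : (2 * j + 1) * j.centralBinom ^ 2 ≤ 16 ^ j := by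
  induction j with
  | zero => simp
  | succ j ih =>
    have h := Nat.succ_mul_centralBinom_succ j
    have h2 : (j + 1) ^ 2 * ((2 * (j + 1) + 1) * (j + 1).centralBinom ^ 2) ≤
        (j + 1) ^ 2 * 16 ^ (j + 1) := by
      calc (j + 1) ^ 2 * ((2 * (j + 1) + 1) * (j + 1).centralBinom ^ 2)
          = (2 * j + 3) * ((j + 1) * (j + 1).centralBinom) ^ 2 := by ring
        _ = 4 * (2 * j + 3) * (2 * j + 1) * ((2 * j + 1) * j.centralBinom ^ 2) := by
            rw [h]; ring
        _ ≤ 4 * (2 * j + 3) * (2 * j + 1) * 16 ^ j := Nat.mul_le_mul_left _ ih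
        _ ≤ 16 * (j + 1) ^ 2 * 16 ^ j := Nat.mul_le_mul_right _ (by nlinarith)
        _ = (j + 1) ^ 2 * 16 ^ (j + 1) := by ring
    exact Nat.le_of_mul_le_mul_left h2 (by positivity)

/-- For even `m` the derivative at `0` vanishes by parity. For `m = 2j + 1` it is `±(2j + 1) C(2j,
j) / 4^j`, and `sq_centralBinom_le` bounds its square by `2j + 1`. -/
lemma derivative_legendrePoly_eval_zero_sq_le (m : ℕ) :
    (Polynomial.derivative (legendrePoly m)).eval 0 ^ 2 ≤ m := by
  rw [← Polynomial.coeff_zero_eq_eval_zero, Polynomial.coeff_derivative, zero_add,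
    coeff_legendrePoly, coeff_weight]
  split_ifs with h
  · obtain ⟨i, hi⟩ := h
    obtain ⟨j, rfl⟩ : ∃ j, i = j + 1 := ⟨i - 1, by omega⟩
    obtain rfl : m = 2 * j + 1 := by omega
    rw [hi, Nat.mul_div_cancel_left _ (by norm_num : 0 < 2), ← hi]
    have h1 : ((1 + (2 * j + 1)).descFactorial (2 * j + 1) : ℝ) =
        (2 * j + 2) * (2 * j + 1).factorial := by
      have := Nat.factorial_mul_descFactorial (n := 1 + (2 * j + 1)) (k := 2 * j + 1) (by omega)
      rw [show 1 + (2 * j + 1) - (2 * j + 1) = 1 by omega, Nat.factorial_one, one_mul,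
        add_comm 1, Nat.factorial_succ] at this
      rw [add_comm 1, this]; push_cast; ring
    have h2 : ((j : ℝ) + 1) * ((2 * j + 1).choose (j + 1) : ℝ) = (2 * j + 1) * j.centralBinom := by
      have := Nat.add_one_mul_choose_eq (2 * j) j
      rw [Nat.centralBinom]
      have h' : ((2 * j + 1 : ℕ) * (2 * j).choose j : ℝ) =
        ((2 * j + 1).choose (j + 1) * (j + 1 : ℕ) : ℝ) := by exact_mod_cast this
      push_cast at h'
      linarith
    have h3 : ((2 * j + 1 : ℝ) * (j.centralBinom : ℝ) ^ 2) ≤ 16 ^ j := by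
      exact_mod_cast sq_centralBinom_le j
    rw [h1]
    have hs : ((-1 : ℝ) ^ (2 * j + 1 - (j + 1))) ^ 2 = 1 := by
      rw [← pow_mul, mul_comm, pow_mul]; norm_num
    set s := (-1 : ℝ) ^ (2 * j + 1 - (j + 1))
    have h4 : (1 / (2 ^ (2 * j + 1) * ((2 * j + 1).factorial : ℝ)) *
        ((2 * j + 2) * (2 * j + 1).factorial * (s * ((2 * j + 1).choose (j + 1) : ℝ))) *
          (((0 : ℕ) : ℝ) + 1)) = s * ((2 * j + 1) * j.centralBinom) / 4 ^ j := by
      rw [← h2, pow_succ, pow_mul]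
      have := (2 * j + 1).factorial_pos
      norm_num
      field_simp
    rw [h4, div_pow, mul_pow, hs, one_mul, div_le_iff₀ (by positivity), ← pow_mul, mul_comm j 2,
      pow_mul]
    push_cast
    norm_num
    calc ((2 * j + 1 : ℝ) * (j.centralBinom : ℝ)) ^ 2
        = (2 * j + 1) * ((2 * j + 1 : ℝ) * (j.centralBinom : ℝ) ^ 2) := by ring
      _ ≤ _ := by gcongr
  · simp

/-- An upper bound for the second moment of the kernel. -/
noncomputable def kernelBound (β : ℕ) : ℝ := β * (β + 1) * (4 * β + 5) / 6

/-- Parseval: the second moment is `∑ p_m'(0)²`, each term is at most `(2m + 1) m`, and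
`kernelBound` is the closed form of the sum of these bounds. -/
lemma polyMean_kernelPoly_sq_le (β : ℕ) :
    polyMean (kernelPoly β * kernelPoly β) ≤ kernelBound β := by
  have h1 : polyMean (kernelPoly β * kernelPoly β) =
      ∑ m ∈ Finset.range (β + 1), ((Polynomial.derivative (orthoPoly m)).eval 0) ^ 2 := by
    conv_lhs => enter [2, 2]; rw [kernelPoly]
    rw [Finset.mul_sum, map_sum]
    refine Finset.sum_congr rfl fun m hm => ?_
    rw [mul_left_comm, polyMean_C_mul, polyMean_kernelPoly_mul_orthoPoly
      (by simpa [Nat.lt_succ_iff] using hm), sq]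
  have h2 : ∀ n : ℕ, ∑ m ∈ Finset.range (n + 1), ((2 * m + 1) * m : ℝ) = kernelBound n := by
    intro n
    induction n with
    | zero => simp [kernelBound]
    | succ n ih => rw [Finset.sum_range_succ, ih, kernelBound, kernelBound]; push_cast; ring
  rw [h1, ← h2]
  refine Finset.sum_le_sum fun m _ => ?_
  rw [orthoPoly, Polynomial.derivative_C_mul, Polynomial.eval_mul, Polynomial.eval_C, mul_pow,
    Real.sq_sqrt (by positivity)]
  gcongr
  exact derivative_legendrePoly_eval_zero_sq_le m

/-! ### The uniform distribution on `[-1, 1]` -/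

lemma unifInterval_eq : unifInterval =
    (2 : ENNReal)⁻¹ • (volume : Measure ℝ).restrict (Set.Icc (-1 : ℝ) 1) := by
  rw [unifInterval, Real.volume_Icc]; norm_num

instance isProbabilityMeasure_unifInterval : IsProbabilityMeasure unifInterval := by
  constructor
  rw [unifInterval_eq]
  simp
  norm_num
  exact ENNReal.inv_mul_cancel (by norm_num) (by norm_num)

lemma ae_unifInterval : ∀ᵐ r ∂unifInterval, |r| ≤ 1 := by
  rw [unifInterval_eq]
  refine Measure.ae_smul_measure ?_ _
  filter_upwards [ae_restrict_mem measurableSet_Icc] with r hr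
  exact abs_le.2 hr

lemma integral_unifInterval (g : ℝ → ℝ) :
    ∫ r, g r ∂unifInterval = ∫ r in (-1 : ℝ)..1, g r / 2 := by
  rw [unifInterval_eq, integral_smul_measure, intervalIntegral.integral_of_le (by norm_num),
    integral_Icc_eq_integral_Ioc]
  simp only [div_eq_inv_mul, integral_const_mul]
  simp

lemma integral_eval_unifInterval (q : Polynomial ℝ) :
    ∫ r, q.eval r ∂unifInterval = polyMean q := integral_unifInterval _

lemma continuous_kernelFun (β : ℕ) : Continuous (kernelFun β) := by
  simp only [funext fun r => (eval_kernelPoly β r).symm]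
  exact (kernelPoly β).continuous

lemma exists_kernelFun_bound (β : ℕ) : ∃ B : ℝ, 0 ≤ B ∧ ∀ r : ℝ, |r| ≤ 1 → |kernelFun β r| ≤ B := by
  obtain ⟨B, hB⟩ := (isCompact_Icc (a := (-1 : ℝ)) (b := 1)).exists_bound_of_continuousOn
    (continuous_kernelFun β).continuousOn
  refine ⟨B, (norm_nonneg _).trans (hB 0 (by norm_num)), fun r hr => hB r (abs_le.1 hr)⟩

/-- Continuous functions are integrable for the uniform distribution on `[-1, 1]`. -/
lemma integrable_unifInterval {g : ℝ → ℝ} (hg : Continuous g) : Integrable g unifInterval := by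
  obtain ⟨B, hB⟩ := (isCompact_Icc (a := (-1 : ℝ)) (b := 1)).exists_bound_of_continuousOn
    hg.continuousOn
  refine Integrable.of_bound hg.aestronglyMeasurable B ?_
  filter_upwards [ae_unifInterval] with r hr using hB r (abs_le.1 hr)

lemma integral_kernelFun_mul_eval {β : ℕ} {q : Polynomial ℝ} (hq : q.natDegree ≤ β) :
    ∫ r, kernelFun β r * q.eval r ∂unifInterval = (Polynomial.derivative q).eval 0 := by
  rw [← polyMean_kernelPoly_mul hq, ← integral_eval_unifInterval]
  simp [eval_kernelPoly]

lemma integral_kernelFun_sq_le (β : ℕ) :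
    ∫ r, kernelFun β r ^ 2 ∂unifInterval ≤ kernelBound β := by
  refine le_trans (le_of_eq ?_) (polyMean_kernelPoly_sq_le β)
  rw [← integral_eval_unifInterval]
  simp [eval_kernelPoly, sq]

lemma kernelBound_nonneg (β : ℕ) : 0 ≤ kernelBound β := by rw [kernelBound]; positivity

lemma integral_abs_kernelFun_le (β : ℕ) :
    ∫ r, |kernelFun β r| ∂unifInterval ≤ Real.sqrt (kernelBound β) := by
  have hc := continuous_kernelFun β
  set m := ∫ r, |kernelFun β r| ∂unifInterval with hm
  apply Real.le_sqrt_of_sq_le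
  -- The variance of `|k|` is nonnegative, so its squared mean is at most its second moment.
  have h0 : 0 ≤ ∫ r, (|kernelFun β r| - m) ^ 2 ∂unifInterval :=
    integral_nonneg fun r => sq_nonneg _
  have h1 : ∫ r, (|kernelFun β r| - m) ^ 2 ∂unifInterval =
      ∫ r, kernelFun β r ^ 2 ∂unifInterval - m ^ 2 := by
    have : ∀ r, (|kernelFun β r| - m) ^ 2 = kernelFun β r ^ 2 - (2 * m * |kernelFun β r| - m ^ 2) :=
      fun r => by rw [sub_sq, sq_abs]; ring
    simp only [this]
    rw [integral_sub (integrable_unifInterval (by fun_prop)) (integrable_unifInterval (by fun_prop)),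
      integral_sub (integrable_unifInterval (by fun_prop)) (integrable_const _),
      integral_const_mul, ← hm]
    simp
    ring
  linarith [integral_kernelFun_sq_le β]

/-- Integrals against the kernel of a uniformly small function are small. -/
lemma abs_integral_kernelFun_mul_le (β : ℕ) {g : ℝ → ℝ} {c : ℝ}
    (hg : ∀ r, |r| ≤ 1 → |g r| ≤ c) :
    |∫ r, kernelFun β r * g r ∂unifInterval| ≤ c * Real.sqrt (kernelBound β) := by
  have hc : 0 ≤ c := (abs_nonneg _).trans (hg 0 (by norm_num))
  calc |∫ r, kernelFun β r * g r ∂unifInterval|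
      ≤ ∫ r, c * |kernelFun β r| ∂unifInterval := by
        rw [← Real.norm_eq_abs]
        refine norm_integral_le_of_norm_le
          (integrable_unifInterval ((continuous_kernelFun β).abs.const_mul c)) ?_
        filter_upwards [ae_unifInterval] with r hr
        rw [Real.norm_eq_abs, abs_mul, mul_comm]
        gcongr
        exact hg r hr
    _ ≤ _ := by
        rw [integral_const_mul]
        gcongr
        exact integral_abs_kernelFun_le β

/-! ### One-dimensional Taylor expansions -/

/-- Taylor expansion, at the order `n` below the top, of a function whose `(n + 1)`-th derivative
is Lipschitz at `0`. -/
lemma exists_polynomial_approx {n : ℕ} {g : ℝ → ℝ} {L : ℝ} (hg : ContDiff ℝ (n + 1 : ℕ) g)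
    (hL : ∀ t, |iteratedDeriv (n + 1) g t - iteratedDeriv (n + 1) g 0| ≤ L * |t|) :
    ∃ q : Polynomial ℝ, q.natDegree ≤ n + 1 ∧ q.eval 0 = g 0 ∧
      (Polynomial.derivative q).eval 0 = deriv g 0 ∧
      ∀ t, |g t - q.eval t| ≤ L * |t| ^ (n + 2) / (n + 1).factorial := by
  refine ⟨∑ j ∈ Finset.range (n + 2),
    Polynomial.C (iteratedDeriv j g 0 / j.factorial) * Polynomial.X ^ j, ?_, ?_, ?_, ?_⟩
  · refine Polynomial.natDegree_sum_le_of_forall_le _ _ fun j hj => ?_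
    refine (Polynomial.natDegree_C_mul_X_pow_le _ _).trans ?_
    have := Finset.mem_range.1 hj; omega
  · rw [Polynomial.eval_finsetSum, Finset.sum_range_succ']
    simp
  · rw [Polynomial.derivative_sum, Polynomial.eval_finsetSum, Finset.sum_range_succ',
      Finset.sum_range_succ']
    simp
  · intro t
    rcases eq_or_ne t 0 with rfl | ht
    · rw [Polynomial.eval_finsetSum, Finset.sum_range_succ']
      simp
    have hgc : ContDiffOn ℝ (n + 1 : ℕ) g (Set.uIcc 0 t) := hg.contDiffOn
    obtain ⟨ξ, hξ, h⟩ := taylor_mean_remainder_lagrange_iteratedDeriv (f := g) (x := t) (x₀ := 0)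
      (n := n) ht.symm (by exact_mod_cast hgc)
    have h2 : taylorWithinEval g n (Set.uIcc 0 t) 0 t =
        ∑ j ∈ Finset.range (n + 1), iteratedDeriv j g 0 / j.factorial * t ^ j := by
      rw [taylor_within_apply]
      refine Finset.sum_congr rfl fun j hj => ?_
      rw [iteratedDerivWithin_eq_iteratedDeriv (uniqueDiffOn_uIcc ht.symm)
        ((hg.of_le (by have := Finset.mem_range.1 hj; exact_mod_cast this.le)).contDiffAt)
        Set.left_mem_uIcc, sub_zero, smul_eq_mul]
      ring
    rw [Polynomial.eval_finsetSum, Finset.sum_range_succ]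
    simp only [Polynomial.eval_mul, Polynomial.eval_C, Polynomial.eval_pow, Polynomial.eval_X]
    rw [h2] at h
    have hξt : |ξ| ≤ |t| := by
      simpa using Set.abs_sub_left_of_mem_uIcc (Set.uIoo_subset_uIcc_self hξ)
    -- Lagrange's remainder is of order `n + 1`, evaluated at `ξ`. Moving its value at `0` into the
    -- polynomial leaves a difference of top derivatives, which the Lipschitz bound controls.
    have h3 : g t - (∑ j ∈ Finset.range (n + 1), iteratedDeriv j g 0 / j.factorial * t ^ j +
        iteratedDeriv (n + 1) g 0 / (n + 1).factorial * t ^ (n + 1)) =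
        (iteratedDeriv (n + 1) g ξ - iteratedDeriv (n + 1) g 0) * t ^ (n + 1) /
          (n + 1).factorial := by
      rw [← sub_sub, h]; simp; ring
    have hL0 : 0 ≤ L := by
      have := (abs_nonneg _).trans (hL 1)
      simpa using this
    rw [h3, abs_div, abs_mul, abs_pow, Nat.abs_cast, pow_succ' |t| (n + 1), ← mul_assoc]
    refine div_le_div_of_nonneg_right (mul_le_mul_of_nonneg_right ?_ (pow_nonneg (abs_nonneg t) _))
      (Nat.cast_nonneg _)
    exact (hL ξ).trans (mul_le_mul_of_nonneg_left hξt hL0)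

/-- The kernel extracts the derivative at `0`, up to a Taylor remainder. -/
lemma abs_integral_kernelFun_mul_sub_le {β : ℕ} (hβ : 2 ≤ β) {g : ℝ → ℝ} {L : ℝ}
    (hg : ContDiff ℝ (β - 1 : ℕ) g)
    (hL : ∀ t, |iteratedDeriv (β - 1) g t - iteratedDeriv (β - 1) g 0| ≤ L * |t|) (δ : ℝ) :
    |∫ r, kernelFun β r * g (δ * r) ∂unifInterval - δ * deriv g 0| ≤
      L * |δ| ^ β / (β - 1).factorial * Real.sqrt (kernelBound β) := by
  obtain ⟨n, rfl⟩ : ∃ n, β = n + 2 := ⟨β - 2, by omega⟩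
  simp only [show n + 2 - 1 = n + 1 by omega] at *
  obtain ⟨q, hq, -, hq1, hqt⟩ := exists_polynomial_approx hg hL
  have hk := continuous_kernelFun (n + 2)
  have hgc := hg.continuous
  set q' := q.comp (Polynomial.C δ * Polynomial.X) with hq'
  have e1 : (Polynomial.derivative q').eval 0 = δ * deriv g 0 := by
    rw [hq', Polynomial.derivative_comp]; simp [hq1]
  have e2 : q'.natDegree ≤ n + 2 := by
    refine Polynomial.natDegree_comp_le.trans ?_
    refine (Nat.mul_le_mul hq (Polynomial.natDegree_C_mul_le δ Polynomial.X)).trans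
      (by rw [Polynomial.natDegree_X]; omega)
  have hL0 : 0 ≤ L := by
    have := (abs_nonneg _).trans (hL 1)
    simpa using this
  have e3 : ∀ r, q'.eval r = q.eval (δ * r) := fun r => by simp [hq']
  rw [← e1, ← integral_kernelFun_mul_eval e2, ← integral_sub (integrable_unifInterval (by fun_prop))
    (integrable_unifInterval (by have := q'.continuous; fun_prop))]
  simp only [← mul_sub]
  refine abs_integral_kernelFun_mul_le _ fun r hr => ?_
  rw [e3]
  refine (hqt _).trans ?_
  have hδr : |δ * r| ≤ |δ| := by
    rw [abs_mul]; exact mul_le_of_le_one_right (abs_nonneg _) hr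
  refine div_le_div_of_nonneg_right (mul_le_mul_of_nonneg_left ?_ hL0) (by positivity)
  exact pow_le_pow_left₀ (abs_nonneg _) hδr _

/-- The kernel times the identity extracts the value at `0`, up to a Taylor remainder. -/
lemma abs_integral_kernelFun_mul_mul_sub_le {β : ℕ} (hβ : 2 ≤ β) {g : ℝ → ℝ} {L : ℝ}
    (hg : ContDiff ℝ (β - 1 : ℕ) g)
    (hL : ∀ t, |iteratedDeriv (β - 1) g t - iteratedDeriv (β - 1) g 0| ≤ L * |t|) (δ : ℝ) :
    |∫ r, kernelFun β r * (r * g (δ * r)) ∂unifInterval - g 0| ≤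
      L * |δ| ^ β / (β - 1).factorial * Real.sqrt (kernelBound β) := by
  obtain ⟨n, rfl⟩ : ∃ n, β = n + 2 := ⟨β - 2, by omega⟩
  simp only [show n + 2 - 1 = n + 1 by omega] at *
  obtain ⟨q, hq, hq0, -, hqt⟩ := exists_polynomial_approx hg hL
  have hk := continuous_kernelFun (n + 2)
  have hgc := hg.continuous
  set q' := Polynomial.X * q.comp (Polynomial.C δ * Polynomial.X) with hq'
  have e1 : (Polynomial.derivative q').eval 0 = g 0 := by
    rw [hq', Polynomial.derivative_mul]; simp [hq0]
  -- The Taylor polynomial has degree at most `β - 1`; the extra factor `r` uses the last degree,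
  -- `β`, that the kernel reproduces.
  have e2 : q'.natDegree ≤ n + 2 := by
    refine Polynomial.natDegree_mul_le.trans ?_
    have := Polynomial.natDegree_comp_le.trans
      (Nat.mul_le_mul hq (Polynomial.natDegree_C_mul_le δ Polynomial.X))
    rw [Polynomial.natDegree_X] at *
    omega
  have hL0 : 0 ≤ L := by
    have := (abs_nonneg _).trans (hL 1)
    simpa using this
  have e3 : ∀ r, q'.eval r = r * q.eval (δ * r) := fun r => by simp [hq']
  rw [← e1, ← integral_kernelFun_mul_eval e2, ← integral_sub (integrable_unifInterval (by fun_prop))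
    (integrable_unifInterval (by have := q'.continuous; fun_prop))]
  simp only [← mul_sub]
  refine abs_integral_kernelFun_mul_le _ fun r hr => ?_
  rw [e3, ← mul_sub, abs_mul]
  refine (mul_le_of_le_one_left (abs_nonneg _) hr).trans ((hqt _).trans ?_)
  have hδr : |δ * r| ≤ |δ| := by
    rw [abs_mul]; exact mul_le_of_le_one_right (abs_nonneg _) hr
  refine div_le_div_of_nonneg_right (mul_le_mul_of_nonneg_left ?_ hL0) (by positivity)
  exact pow_le_pow_left₀ (abs_nonneg _) hδr _

/-! ### The uniform distribution on the sphere -/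

section Sphere

variable {d : ℕ}

lemma isProbabilityMeasure_unifSphere (hd : 1 ≤ d) : IsProbabilityMeasure (unifSphere d) := by
  have : Nonempty (Fin d) := ⟨⟨0, hd⟩⟩
  constructor
  rw [unifSphere, Measure.map_apply measurable_subtype_coe .univ, Set.preimage_univ,
    Measure.smul_apply, smul_eq_mul, ENNReal.inv_mul_cancel]
  · rw [Ne, Measure.measure_univ_eq_zero]
    exact Measure.toSphere_ne_zero _
  · exact measure_ne_top _ _

lemma ae_unifSphere : ∀ᵐ u ∂(unifSphere d), ‖u‖ = 1 := by
  rw [unifSphere, ae_map_iff measurable_subtype_coe.aemeasurable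
    (measurableSet_eq_fun measurable_norm measurable_const)]
  exact .of_forall fun x => by simp

-- The spherical measure of a set is defined through the volume of the cone over it, and Lebesgue
-- measure is invariant under linear isometries.
open scoped Pointwise in
lemma map_unifSphere (T : EuclideanSpace ℝ (Fin d) ≃ₗᵢ[ℝ] EuclideanSpace ℝ (Fin d)) :
    (unifSphere d).map T = unifSphere d := by
  ext A hA
  rw [Measure.map_apply T.continuous.measurable hA, unifSphere,
    Measure.map_apply measurable_subtype_coe hA,
    Measure.map_apply measurable_subtype_coe (T.continuous.measurable hA),
    Measure.smul_apply, Measure.smul_apply,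
    Measure.toSphere_apply' _ (measurable_subtype_coe hA),
    Measure.toSphere_apply' _ (measurable_subtype_coe (T.continuous.measurable hA))]
  have h : Set.Ioo (0 : ℝ) 1 • (Subtype.val '' (Subtype.val ⁻¹' (T ⁻¹' A) :
      Set (Metric.sphere (0 : EuclideanSpace ℝ (Fin d)) 1))) =
      T ⁻¹' (Set.Ioo (0 : ℝ) 1 • (Subtype.val '' (Subtype.val ⁻¹' A :
        Set (Metric.sphere (0 : EuclideanSpace ℝ (Fin d)) 1)))) := by
    ext x
    simp only [Set.mem_smul, Set.mem_image, Set.mem_preimage, Subtype.exists, mem_sphere_iff_norm,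
      sub_zero]
    constructor
    · rintro ⟨c, hc, y, ⟨z, hz, hzA, rfl⟩, rfl⟩
      exact ⟨c, hc, T z, ⟨T z, by simpa using hz, hzA, rfl⟩, by simp⟩
    · rintro ⟨c, hc, y, ⟨z, hz, hzA, rfl⟩, h⟩
      exact ⟨c, hc, T.symm z, ⟨T.symm z, by simpa using hz, by simpa using hzA, rfl⟩,
        by rw [← map_smul, h]; simp⟩
  rw [h]
  congr 2
  exact MeasurePreserving.measure_preimage_equiv (f := T.toMeasurableEquiv)
    (LinearIsometryEquiv.measurePreserving T) _

lemma integral_comp_unifSphere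
    (T : EuclideanSpace ℝ (Fin d) ≃ₗᵢ[ℝ] EuclideanSpace ℝ (Fin d))
    (ψ : EuclideanSpace ℝ (Fin d) → ℝ) :
    ∫ u, ψ (T u) ∂(unifSphere d) = ∫ u, ψ u ∂(unifSphere d) := by
  conv_rhs => rw [← map_unifSphere T]
  exact (integral_map_equiv T.toMeasurableEquiv ψ).symm

lemma integrable_unifSphere (hd : 1 ≤ d) {ψ : EuclideanSpace ℝ (Fin d) → ℝ} (hψ : Continuous ψ) :
    Integrable ψ (unifSphere d) := by
  have := isProbabilityMeasure_unifSphere hd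
  obtain ⟨B, hB⟩ := (isCompact_sphere (0 : EuclideanSpace ℝ (Fin d)) 1).exists_bound_of_continuousOn
    hψ.continuousOn
  refine Integrable.of_bound hψ.aestronglyMeasurable B ?_
  filter_upwards [ae_unifSphere] with u hu using hB u (by simpa using hu)

/-- The derivative of a function on the sphere along an infinitesimal rotation has mean zero. -/
lemma integral_fderiv_rotation_eq_zero (hd : 1 ≤ d) {ψ : EuclideanSpace ℝ (Fin d) → ℝ}
    (hψ : ContDiff ℝ 1 ψ) {e b : EuclideanSpace ℝ (Fin d)} (he : ‖e‖ = 1) (hb : ‖b‖ = 1)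
    (heb : inner ℝ e b = 0) :
    ∫ u, fderiv ℝ ψ u (inner ℝ e u • b - inner ℝ b u • e) ∂(unifSphere d) = 0 := by
  have := isProbabilityMeasure_unifSphere hd
  set v : ℝ → EuclideanSpace ℝ (Fin d) := fun t => Real.cos t • e + Real.sin t • b with hv
  set v' : ℝ → EuclideanSpace ℝ (Fin d) := fun t => (-Real.sin t) • e + Real.cos t • b with hv'
  have hvn : ∀ t, ‖v t‖ = 1 := by
    intro t
    have : ‖v t‖ ^ 2 = 1 := by
      rw [hv]
      simp only [norm_add_sq_real, norm_smul, inner_smul_left, inner_smul_right, heb, he, hb]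
      simp
    nlinarith [norm_nonneg (v t)]
  -- `H t` is the reflection in the line through `v t = cos t • e + sin t • b`. The product of `H t`
  -- and `H 0` is the rotation by the angle `2t` in the plane of `e` and `b`, so reflections supply
  -- the rotations as isometries with a simple formula.
  set H : ℝ → EuclideanSpace ℝ (Fin d) ≃ₗᵢ[ℝ] EuclideanSpace ℝ (Fin d) :=
    fun t => (Submodule.span ℝ {v t}).reflection with hH
  have hHa : ∀ t x, H t x = (2 * inner ℝ (v t) x) • v t - x := by
    intro t x
    rw [hH]
    simp only [Submodule.reflection_singleton_apply, hvn]
    simp [two_smul, two_mul, add_smul]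
  have hvd : ∀ t, HasDerivAt v (v' t) t := fun t =>
    ((Real.hasDerivAt_cos t).smul_const e).add ((Real.hasDerivAt_sin t).smul_const b)
  set H' : ℝ → EuclideanSpace ℝ (Fin d) → EuclideanSpace ℝ (Fin d) :=
    fun t x => (2 * inner ℝ (v t) x) • v' t + (2 * inner ℝ (v' t) x) • v t with hH'
  have hHd : ∀ t x, HasDerivAt (fun t => H t x) (H' t x) t := by
    intro t x
    simp only [hHa]
    have h1 : HasDerivAt (fun t => 2 * inner ℝ (v t) x) (2 * inner ℝ (v' t) x) t := by
      simpa using ((hvd t).inner ℝ (hasDerivAt_const t x)).const_mul 2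
    exact (h1.smul (hvd t)).sub_const x
  have hv'n : ∀ t, ‖v' t‖ ≤ 2 := by
    intro t
    refine (norm_add_le _ _).trans ?_
    rw [norm_smul, norm_smul, he, hb, norm_neg]
    have := Real.abs_sin_le_one t
    have := Real.abs_cos_le_one t
    simp only [Real.norm_eq_abs]
    linarith
  obtain ⟨B, hB⟩ := (isCompact_sphere (0 : EuclideanSpace ℝ (Fin d)) 1).exists_bound_of_continuousOn
    (hψ.continuous_fderiv (by norm_num)).continuousOn
  have hd0 := hasDerivAt_integral_of_dominated_loc_of_deriv_le (μ := unifSphere d) (s := Set.univ)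
    (F := fun t u => ψ (H t u)) (F' := fun t u => fderiv ℝ ψ (H t u) (H' t u)) (x₀ := (0 : ℝ))
    (bound := fun _ => B * 8) univ_mem
    (.of_forall fun t => (hψ.continuous.comp (H t).continuous).aestronglyMeasurable)
    (integrable_unifSphere hd (hψ.continuous.comp (H 0).continuous))
    (((hψ.continuous_fderiv (by norm_num)).comp (H 0).continuous).clm_apply
      (by fun_prop)).aestronglyMeasurable
    (by
      filter_upwards [ae_unifSphere] with u hu t _
      have hn : ‖H' t u‖ ≤ 8 := by
        have h1 := abs_real_inner_le_norm (v t) u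
        have h2 := abs_real_inner_le_norm (v' t) u
        have h3 := hv'n t
        rw [hu, mul_one, hvn] at h1
        rw [hu, mul_one] at h2
        refine (norm_add_le _ _).trans ?_
        rw [norm_smul, norm_smul, norm_mul, norm_mul, hvn, Real.norm_two, Real.norm_eq_abs,
          Real.norm_eq_abs]
        nlinarith [norm_nonneg (v' t)]
      refine (ContinuousLinearMap.le_opNorm _ _).trans ?_
      have hB' := hB (H t u) (by simpa using hu)
      have := (norm_nonneg _).trans hB'
      gcongr)
    (integrable_const _)
    (.of_forall fun u t _ => ((hψ.differentiable (by norm_num) _).hasFDerivAt.comp_hasDerivAt t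
      (hHd t u)))
  -- By invariance, `t ↦ ∫ ψ (H t u)` is constant. Substituting the involution `H 0` below then
  -- brings the base point back to `u`.
  have h1 : ∫ u, fderiv ℝ ψ (H 0 u) (H' 0 u) ∂(unifSphere d) = 0 := by
    refine hd0.2.unique ?_
    simp only [integral_comp_unifSphere]
    exact hasDerivAt_const _ _
  have h2 : ∀ u, H 0 (H 0 u) = u := fun u => Submodule.reflection_reflection _ _
  rw [← integral_comp_unifSphere (H 0)] at h1
  simp only [h2] at h1
  have h3 : ∀ u, H' 0 (H 0 u) = (2 : ℝ) • (inner ℝ e u • b - inner ℝ b u • e) := by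
    intro u
    have hv0 : v 0 = e := by simp [hv]
    have hv'0 : v' 0 = b := by simp [hv']
    have hbe : inner ℝ b e = 0 := by rw [real_inner_comm]; exact heb
    simp only [hH', hHa, hv0, hv'0, inner_sub_right, inner_smul_right, hbe,
      real_inner_self_eq_norm_sq, he]
    module
  simp only [h3, map_smul, smul_eq_mul, integral_const_mul] at h1
  linarith

/-- Integration by parts on the sphere. -/
lemma integral_inner_mul_unifSphere (hd : 1 ≤ d) {φ : EuclideanSpace ℝ (Fin d) → ℝ}
    (hφ : ContDiff ℝ 1 φ) {w : EuclideanSpace ℝ (Fin d)} (hw : ‖w‖ = 1) :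
    d * ∫ u, inner ℝ u w * φ u ∂(unifSphere d) = ∫ u, (inner ℝ u w * φ u +
      (fderiv ℝ φ u w - inner ℝ u w * fderiv ℝ φ u u)) ∂(unifSphere d) := by
  obtain ⟨b, hb⟩ := Orthonormal.exists_orthonormalBasis_extension_of_card_eq
    (𝕜 := ℝ) (E := EuclideanSpace ℝ (Fin d)) (ι := Fin d) (by simp) (v := fun _ => w)
    (s := {⟨0, hd⟩}) (by
      refine ⟨fun i => by simpa using hw, fun i j hij => ?_⟩
      exact absurd (Subsingleton.elim i j) hij)
  have hb0 : b ⟨0, hd⟩ = w := hb _ rfl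
  have hdφ := hφ.continuous_fderiv (by norm_num)
  have hφc := hφ.continuous
  -- Rotation in the plane of `b j` and `w`, applied to `⟨b j, u⟩ φ u`. Summing over the basis, with
  -- `∑ ⟨b j, u⟩² = 1` and `∑ ⟨b j, u⟩ b j = u`, yields the tangential derivative of `φ` along `w`.
  -- The index of `w` itself contributes zero, so `⟨w, u⟩ φ u` is counted `d - 1` times.
  have key : ∀ j, ∫ u, (fderiv ℝ φ u (inner ℝ (b j) u ^ 2 • w - (inner ℝ w u * inner ℝ (b j) u) • b j)
      - (if j = ⟨0, hd⟩ then 0 else inner ℝ w u * φ u)) ∂(unifSphere d) = 0 := by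
    intro j
    by_cases hj : j = ⟨0, hd⟩
    · subst hj
      simp [hb0, sq]
    have hjw : inner ℝ (b j) w = 0 := by rw [← hb0]; exact b.orthonormal.2 hj
    have h := integral_fderiv_rotation_eq_zero hd (ψ := fun u => inner ℝ (b j) u * φ u)
      ((innerSL ℝ (b j)).contDiff.mul hφ) (b.orthonormal.1 j) hw hjw
    rw [← h]
    congr 1
    ext u
    have hder : HasFDerivAt (fun u => inner ℝ (b j) u * φ u)
        (inner ℝ (b j) u • fderiv ℝ φ u + φ u • innerSL ℝ (b j)) u :=
      ((innerSL ℝ (b j)).hasFDerivAt).mul (hφ.differentiable (by norm_num) u).hasFDerivAt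
    rw [hder.fderiv, if_neg hj]
    simp only [map_sub, map_smul, add_apply, smul_apply,
      smul_eq_mul, innerSL_apply_apply, hjw, real_inner_self_eq_norm_sq, b.orthonormal.1 j]
    ring
  have hsum : ∫ u, ∑ j, (fderiv ℝ φ u
      (inner ℝ (b j) u ^ 2 • w - (inner ℝ w u * inner ℝ (b j) u) • b j)
      - (if j = ⟨0, hd⟩ then 0 else inner ℝ w u * φ u)) ∂(unifSphere d) = 0 := by
    rw [integral_finsetSum]
    · exact Finset.sum_eq_zero fun j _ => key j
    · intro j _
      refine integrable_unifSphere hd (Continuous.sub ?_ ?_)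
      · exact hdφ.clm_apply (by fun_prop)
      · split_ifs <;> fun_prop
  rw [← integral_const_mul, ← sub_eq_zero, ← integral_sub
    (integrable_unifSphere hd (by fun_prop)) (integrable_unifSphere hd (by fun_prop)),
    ← neg_eq_zero, ← integral_neg, ← hsum]
  refine integral_congr_ae ?_
  filter_upwards [ae_unifSphere] with u hu
  rw [Finset.sum_sub_distrib, ← map_sum, Finset.sum_sub_distrib, ← Finset.sum_smul,
    Finset.sum_ite, Finset.sum_const_zero, Finset.sum_const]
  have h1 : ∑ j, inner ℝ (b j) u ^ 2 = 1 := by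
    have := b.sum_sq_norm_inner_right u
    simpa [hu] using this
  have h2 : ∑ j, (inner ℝ w u * inner ℝ (b j) u) • b j = inner ℝ w u • u := by
    simp only [mul_smul, ← Finset.smul_sum]
    congr 1
    exact b.sum_repr' u
  have h3 : (((Finset.univ.filter fun j : Fin d => ¬ j = ⟨0, hd⟩).card : ℕ) : ℝ) = d - 1 := by
    rw [Finset.filter_not, Finset.card_sdiff_of_subset (by simp)]
    simp [Finset.filter_eq', Nat.cast_sub hd]
  rw [h1, h2, nsmul_eq_mul, h3, real_inner_comm u w]
  simp only [map_sub, map_smul, smul_eq_mul]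
  ring

end Sphere

/-! ### The bias of the gradient estimator -/

lemma integrable_of_ae_mem_isCompact {X : Type*} [TopologicalSpace X] [MeasurableSpace X]
    [OpensMeasurableSpace X] [SecondCountableTopology X]
    {ν : Measure X} [IsFiniteMeasure ν] {K : Set X} (hK : IsCompact K) (h : ∀ᵐ x ∂ν, x ∈ K)
    {g : X → ℝ} (hg : Continuous g) : Integrable g ν := by
  obtain ⟨B, hB⟩ := hK.exists_bound_of_continuousOn hg.continuousOn
  refine Integrable.of_bound hg.aestronglyMeasurable B ?_
  filter_upwards [h] with x hx using hB x hx

section Bias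

variable {d β : ℕ} {M : ℝ} {f : EuclideanSpace ℝ (Fin d) → ℝ}

lemma ae_query (hd : 1 ≤ d) : ∀ᵐ z ∂(unifInterval.prod (unifSphere d)), |z.1| ≤ 1 ∧ ‖z.2‖ = 1 := by
  have := isProbabilityMeasure_unifSphere hd
  filter_upwards [Measure.quasiMeasurePreserving_fst.ae ae_unifInterval,
    Measure.quasiMeasurePreserving_snd.ae ae_unifSphere] with z h1 h2 using ⟨h1, h2⟩

lemma integrable_query (hd : 1 ≤ d) {g : ℝ × EuclideanSpace ℝ (Fin d) → ℝ} (hg : Continuous g) :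
    Integrable g (unifInterval.prod (unifSphere d)) := by
  have := isProbabilityMeasure_unifSphere hd
  refine integrable_of_ae_mem_isCompact (K := Set.Icc (-1) 1 ×ˢ Metric.sphere 0 1)
    (isCompact_Icc.prod (isCompact_sphere _ _)) ?_ hg
  filter_upwards [ae_query hd] with z hz
  exact ⟨abs_le.1 hz.1, by simpa using hz.2⟩

lemma integrable_unifInterval_prod {g : ℝ × ℝ → ℝ} (hg : Continuous g) :
    Integrable g (unifInterval.prod unifInterval) := by
  refine integrable_of_ae_mem_isCompact (K := Set.Icc (-1) 1 ×ˢ Set.Icc (-1) 1)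
    (isCompact_Icc.prod isCompact_Icc) ?_ hg
  filter_upwards [Measure.quasiMeasurePreserving_fst.ae ae_unifInterval,
    Measure.quasiMeasurePreserving_snd.ae ae_unifInterval] with z h1 h2
  exact ⟨abs_le.1 h1, abs_le.1 h2⟩

lemma iteratedDeriv_comp_line {n : ℕ} (hf : ContDiff ℝ n f) (x v : EuclideanSpace ℝ (Fin d))
    (t : ℝ) : iteratedDeriv n (fun t : ℝ => f (x + t • v)) t =
      iteratedFDeriv ℝ n f (x + t • v) fun _ => v := by
  set G : ℝ →L[ℝ] EuclideanSpace ℝ (Fin d) := (ContinuousLinearMap.id ℝ ℝ).smulRight v with hG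
  have h1 : (fun t : ℝ => f (x + t • v)) = (fun y => f (x + y)) ∘ G := by ext t; simp [hG]
  rw [iteratedDeriv_eq_iteratedFDeriv, h1, ContinuousLinearMap.iteratedFDeriv_comp_right G
    (f := fun y => f (x + y)) (hf.comp (contDiff_const.add contDiff_id)) t le_rfl,
    iteratedFDeriv_comp_add_left]
  simp [hG]

lemma deriv_comp_line (hf : Differentiable ℝ f) (x v : EuclideanSpace ℝ (Fin d)) (t : ℝ) :
    HasDerivAt (fun t : ℝ => f (x + t • v)) (fderiv ℝ f (x + t • v) v) t := by
  have h1 : HasDerivAt (fun t : ℝ => x + t • v) v t := by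
    simpa using ((hasDerivAt_id t).smul_const v).const_add x
  exact (hf _).hasFDerivAt.comp_hasDerivAt t h1

lemma SmoothOrderOn.contDiff_one {S : Set (EuclideanSpace ℝ (Fin d))} (hβ : 2 ≤ β)
    (hf : SmoothOrderOn S β M f) : ContDiff ℝ 1 f :=
  hf.1.of_le (by exact_mod_cast (show 1 ≤ β - 1 by omega))

lemma SmoothOrderOn.lipschitz_line (hf : SmoothOrderOn Set.univ β M f)
    (x : EuclideanSpace ℝ (Fin d)) {v : EuclideanSpace ℝ (Fin d)} (hv : ‖v‖ = 1) (t : ℝ) :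
    |iteratedDeriv (β - 1) (fun t : ℝ => f (x + t • v)) t -
      iteratedDeriv (β - 1) (fun t : ℝ => f (x + t • v)) 0| ≤ M ^ β * |t| := by
  have h1 : ContDiff ℝ (β - 1 : ℕ) f := by exact_mod_cast hf.1
  rw [iteratedDeriv_comp_line h1, iteratedDeriv_comp_line h1]
  refine (hf.2 v hv _ (Set.mem_univ _) _ (Set.mem_univ _)).trans (le_of_eq ?_)
  simp [norm_smul, hv]

/-- The remainder of a Taylor expansion of a `β`-smooth function. -/
noncomputable def taylorErr (β : ℕ) (M δ : ℝ) : ℝ := M ^ β * |δ| ^ β / (β - 1).factorial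

lemma abs_integral_kernel_line_sub_le (hβ : 2 ≤ β) (hf : SmoothOrderOn Set.univ β M f)
    (x : EuclideanSpace ℝ (Fin d)) {v : EuclideanSpace ℝ (Fin d)} (hv : ‖v‖ = 1) (δ : ℝ) :
    |∫ r, kernelFun β r * f (x + (δ * r) • v) ∂unifInterval - δ * fderiv ℝ f x v| ≤
      taylorErr β M δ * Real.sqrt (kernelBound β) := by
  have h1 : ContDiff ℝ (β - 1 : ℕ) f := by exact_mod_cast hf.1
  have h := abs_integral_kernelFun_mul_sub_le hβ (g := fun t => f (x + t • v)) (L := M ^ β)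
    (h1.comp (by fun_prop)) (hf.lipschitz_line x hv) δ
  have hd := deriv_comp_line ((hf.contDiff_one hβ).differentiable (by norm_num)) x v 0
  rw [hd.deriv] at h
  simpa [taylorErr] using h

lemma abs_integral_kernel_mul_line_sub_le (hβ : 2 ≤ β) (hf : SmoothOrderOn Set.univ β M f)
    (x : EuclideanSpace ℝ (Fin d)) {v : EuclideanSpace ℝ (Fin d)} (hv : ‖v‖ = 1) (δ : ℝ) :
    |∫ r, kernelFun β r * (r * f (x + (δ * r) • v)) ∂unifInterval - f x| ≤
      taylorErr β M δ * Real.sqrt (kernelBound β) := by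
  have h1 : ContDiff ℝ (β - 1 : ℕ) f := by exact_mod_cast hf.1
  have h := abs_integral_kernelFun_mul_mul_sub_le hβ (g := fun t => f (x + t • v)) (L := M ^ β)
    (h1.comp (by fun_prop)) (hf.lipschitz_line x hv) δ
  simpa [taylorErr] using h

/-- A Taylor expansion in `r` would need mixed derivatives in `u` and `w`, which smoothness does not
control directly. Instead `δ Df(·) w` is replaced by a kernel average of `f` along `w`, the
integrals are swapped so that the expansion in `r` is along `u` alone, and the replacement is undone
at `x`. -/
lemma abs_integral_kernel_fderiv_sub_le (hβ : 2 ≤ β) (hf : SmoothOrderOn Set.univ β M f)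
    (x : EuclideanSpace ℝ (Fin d)) {u w : EuclideanSpace ℝ (Fin d)} (hu : ‖u‖ = 1) (hw : ‖w‖ = 1)
    (δ : ℝ) :
    |∫ r, kernelFun β r * (r * (δ * fderiv ℝ f (x + (δ * r) • u) w)) ∂unifInterval -
      δ * fderiv ℝ f x w| ≤
      taylorErr β M δ * (2 * kernelBound β + Real.sqrt (kernelBound β)) := by
  have hk := continuous_kernelFun β
  have hfc := (hf.contDiff_one hβ).continuous
  have hdf := (hf.contDiff_one hβ).continuous_fderiv (by norm_num)
  have hA := Real.mul_self_sqrt (kernelBound_nonneg β)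
  set A := Real.sqrt (kernelBound β) with hAdef
  have hA0 : 0 ≤ A := Real.sqrt_nonneg _
  set G : ℝ → ℝ := fun r => ∫ r', kernelFun β r' * f (x + (δ * r) • u + (δ * r') • w) ∂unifInterval
    with hG
  set h : ℝ × ℝ → ℝ := fun z =>
    kernelFun β z.1 * (z.1 * (kernelFun β z.2 * f (x + (δ * z.1) • u + (δ * z.2) • w))) with hh
  have hhi : Integrable h (unifInterval.prod unifInterval) :=
    integrable_unifInterval_prod (by rw [hh]; fun_prop)
  have hGh : ∀ r, ∫ r', h (r, r') ∂unifInterval = kernelFun β r * (r * G r) := by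
    intro r
    simp only [hh, hG, integral_const_mul]
  have hGi : Integrable (fun r => kernelFun β r * (r * G r)) unifInterval := by
    have := hhi.integral_prod_left
    simpa only [hGh] using this
  -- `G r` approximates `δ Df(x + δ r u) w` uniformly in `r`; integrating the error against the
  -- kernel costs a second factor `A`.
  have e1 : |∫ r, kernelFun β r * (r * (δ * fderiv ℝ f (x + (δ * r) • u) w)) ∂unifInterval -
      ∫ r, kernelFun β r * (r * G r) ∂unifInterval| ≤ taylorErr β M δ * A * A := by
    rw [← integral_sub (integrable_unifInterval ?_) hGi]
    · simp only [← mul_sub]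
      refine abs_integral_kernelFun_mul_le β fun r hr => ?_
      rw [abs_mul]
      refine (mul_le_of_le_one_left (abs_nonneg _) hr).trans ?_
      rw [abs_sub_comm]
      exact abs_integral_kernel_line_sub_le hβ hf _ hw δ
    · exact hk.mul (continuous_id.mul (continuous_const.mul
        ((hdf.comp (by fun_prop)).clm_apply continuous_const)))
  -- After Fubini, the inner integral against `r k(r)` reproduces the value of `f` at `x + δ r' w`.
  have e2 : |∫ r, kernelFun β r * (r * G r) ∂unifInterval -
      ∫ r', kernelFun β r' * f (x + (δ * r') • w) ∂unifInterval| ≤ taylorErr β M δ * A * A := by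
    have hsw : ∫ r, kernelFun β r * (r * G r) ∂unifInterval = ∫ r', kernelFun β r' *
        ∫ r, kernelFun β r * (r * f ((x + (δ * r') • w) + (δ * r) • u)) ∂unifInterval
          ∂unifInterval := by
      simp only [← hGh]
      rw [integral_integral_swap (f := fun r r' => h (r, r')) hhi]
      congr 1; ext r'
      rw [← integral_const_mul]
      congr 1; ext r
      rw [hh, add_right_comm]
      ring
    have hi : Integrable (fun r' => kernelFun β r' *
        ∫ r, kernelFun β r * (r * f ((x + (δ * r') • w) + (δ * r) • u)) ∂unifInterval)
          unifInterval := by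
      have := hhi.integral_prod_right
      refine this.congr (.of_forall fun r' => ?_)
      simp only
      rw [← integral_const_mul]
      congr 1; ext r
      rw [hh, add_right_comm]
      ring
    rw [hsw, ← integral_sub hi (integrable_unifInterval (by fun_prop))]
    simp only [← mul_sub]
    exact abs_integral_kernelFun_mul_le β fun r' _ =>
      abs_integral_kernel_mul_line_sub_le hβ hf _ hu δ
  have e3 := abs_integral_kernel_line_sub_le hβ hf x hw δ
  rw [← hAdef] at e3
  rw [← hA]
  rw [abs_le] at *
  constructor <;> linarith [e1.1, e1.2, e2.1, e2.2, e3.1, e3.2]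

/-- The gradient estimator has a small bias, whatever the dimension. -/
lemma abs_integral_estimator_sub_le (hd : 1 ≤ d) (hβ : 2 ≤ β) (hf : SmoothOrderOn Set.univ β M f)
    (x : EuclideanSpace ℝ (Fin d)) {w : EuclideanSpace ℝ (Fin d)} (hw : ‖w‖ = 1) (δ : ℝ) :
    |d * ∫ z, kernelFun β z.1 * f (x + (δ * z.1) • z.2) * inner ℝ z.2 w
      ∂(unifInterval.prod (unifSphere d)) - δ * fderiv ℝ f x w| ≤
      taylorErr β M δ * (4 * kernelBound β + 3 * Real.sqrt (kernelBound β)) := by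
  have := isProbabilityMeasure_unifSphere hd
  have hk := continuous_kernelFun β
  have hf1 := hf.contDiff_one hβ
  have hfc := hf1.continuous
  have hdf := hf1.continuous_fderiv (by norm_num)
  have hcd : ∀ v : ℝ × EuclideanSpace ℝ (Fin d) → EuclideanSpace ℝ (Fin d), Continuous v →
      Continuous fun z : ℝ × EuclideanSpace ℝ (Fin d) =>
        fderiv ℝ f (x + (δ * z.1) • z.2) (v z) := fun v hv =>
    (hdf.comp (by fun_prop)).clm_apply hv
  have hcd1 := hcd (fun _ => w) continuous_const
  have hcd2 := hcd (fun z => z.2) continuous_snd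
  set F : ℝ × EuclideanSpace ℝ (Fin d) → ℝ := fun z =>
    inner ℝ z.2 w * (kernelFun β z.1 * f (x + (δ * z.1) • z.2)) +
      (kernelFun β z.1 * (z.1 * (δ * fderiv ℝ f (x + (δ * z.1) • z.2) w)) -
        inner ℝ z.2 w *
          (kernelFun β z.1 * (z.1 * (δ * fderiv ℝ f (x + (δ * z.1) • z.2) z.2)))) with hF
  have hFc : Continuous F := by rw [hF]; fun_prop
  -- Integration by parts on the sphere at each fixed `r` removes the factor `d`.
  have e1 : d * ∫ z, kernelFun β z.1 * f (x + (δ * z.1) • z.2) * inner ℝ z.2 w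
      ∂(unifInterval.prod (unifSphere d)) = ∫ z, F z ∂(unifInterval.prod (unifSphere d)) := by
    rw [integral_prod _ (integrable_query hd (by fun_prop)),
      integral_prod _ (integrable_query hd hFc), ← integral_const_mul]
    congr 1; ext r
    have hφ : ContDiff ℝ 1 fun u : EuclideanSpace ℝ (Fin d) => f (x + (δ * r) • u) :=
      hf1.comp (by fun_prop)
    have hder : ∀ u v : EuclideanSpace ℝ (Fin d),
        fderiv ℝ (fun u : EuclideanSpace ℝ (Fin d) => f (x + (δ * r) • u)) u v =
          δ * r * fderiv ℝ f (x + (δ * r) • u) v := by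
      intro u v
      have h1 : HasFDerivAt (fun u : EuclideanSpace ℝ (Fin d) => x + (δ * r) • u)
          ((δ * r) • ContinuousLinearMap.id ℝ (EuclideanSpace ℝ (Fin d))) u :=
        ((hasFDerivAt_id u).const_smul (δ * r)).const_add x
      have h2 : HasFDerivAt (fun u : EuclideanSpace ℝ (Fin d) => f (x + (δ * r) • u)) _ u :=
        (hf1.differentiable (by norm_num) _).hasFDerivAt.comp u h1
      rw [h2.fderiv]
      simp
    have hibp := integral_inner_mul_unifSphere hd hφ hw
    have e : ∀ u : EuclideanSpace ℝ (Fin d), kernelFun β r * f (x + (δ * r) • u) * inner ℝ u w =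
      kernelFun β r * (inner ℝ u w * f (x + (δ * r) • u)) := fun u => by ring
    simp only [e, integral_const_mul]
    rw [mul_left_comm, hibp, ← integral_const_mul]
    congr 1; ext u
    rw [hder, hder, hF]
    ring
  have hTA := abs_nonneg (taylorErr β M δ)
  -- The order of integration is reversed: for fixed `u` the kernel now acts in `r`.
  rw [e1, integral_prod_symm _ (integrable_query hd hFc)]
  have e2 : δ * fderiv ℝ f x w = ∫ u, δ * fderiv ℝ f x w ∂(unifSphere d) := by simp
  rw [e2, ← integral_sub ((integrable_query hd hFc).integral_prod_right) (integrable_const _)]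
  have e3 : ∀ᵐ u ∂(unifSphere d), ‖∫ r, F (r, u) ∂unifInterval - δ * fderiv ℝ f x w‖ ≤
      taylorErr β M δ * (4 * kernelBound β + 3 * Real.sqrt (kernelBound β)) := by
    filter_upwards [ae_unifSphere] with u hu
    have hc1 : Continuous fun r : ℝ => fderiv ℝ f (x + (δ * r) • u) w :=
      hcd1.comp (Continuous.prodMk_left u)
    have hc2 : Continuous fun r : ℝ => fderiv ℝ f (x + (δ * r) • u) u :=
      hcd2.comp (Continuous.prodMk_left u)
    simp only [hF]
    rw [integral_add (integrable_unifInterval (by fun_prop)) (integrable_unifInterval (by fun_prop)),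
      integral_sub (integrable_unifInterval (by fun_prop)) (integrable_unifInterval (by fun_prop)),
      integral_const_mul, integral_const_mul]
    have a1 := abs_integral_kernel_line_sub_le hβ hf x hu δ
    have a2 := abs_integral_kernel_fderiv_sub_le hβ hf x hu hw δ
    have a3 := abs_integral_kernel_fderiv_sub_le hβ hf x hu hu δ
    have hin : |inner ℝ u w| ≤ 1 := by
      simpa [hu, hw] using abs_real_inner_le_norm u w
    set I1 := ∫ r, kernelFun β r * f (x + (δ * r) • u) ∂unifInterval
    set I2 := ∫ r, kernelFun β r * (r * (δ * fderiv ℝ f (x + (δ * r) • u) w)) ∂unifInterval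
    set I3 := ∫ r, kernelFun β r * (r * (δ * fderiv ℝ f (x + (δ * r) • u) u)) ∂unifInterval
    -- The limits of `I1` and `I3` are both `δ Df(x) u` and cancel. The errors, one with constant
    -- `A` and two with `2 κ + A` (`κ = kernelBound β`, `A = √κ`), add up to `4 κ + 3 A`.
    have hsplit : inner ℝ u w * I1 + (I2 - inner ℝ u w * I3) - δ * fderiv ℝ f x w =
        inner ℝ u w * (I1 - δ * fderiv ℝ f x u) + (I2 - δ * fderiv ℝ f x w) -
          inner ℝ u w * (I3 - δ * fderiv ℝ f x u) := by ring
    rw [hsplit, Real.norm_eq_abs]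
    refine (abs_sub _ _).trans ((add_le_add_left (abs_add_le _ _) _).trans ?_)
    rw [abs_mul, abs_mul]
    have b1 := (mul_le_of_le_one_left (abs_nonneg (I1 - δ * fderiv ℝ f x u)) hin).trans a1
    have b3 := (mul_le_of_le_one_left (abs_nonneg (I3 - δ * fderiv ℝ f x u)) hin).trans a3
    linarith
  have := norm_integral_le_of_norm_le_const e3
  simpa using this

end Bias

/-! ### One step of the stochastic recursion -/

section Noise

variable {Ω : Type*} {m mΩ : MeasurableSpace Ω} {P : Measure Ω}
  {η W : Ω → ℝ} {s B : ℝ}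

lemma integrable_sq_mul_sq (hm : m ≤ mΩ) (hη : MemLp η 2 P) (hW : Measurable[m] W)
    (hWB : ∀ᵐ ω ∂P, |W ω| ≤ B) : Integrable (fun ω => η ω ^ 2 * W ω ^ 2) P := by
  refine hη.integrable_sq.mul_bdd (c := B ^ 2) (((hW.mono hm le_rfl).pow_const 2).aestronglyMeasurable) ?_
  filter_upwards [hWB] with ω hω
  rw [Real.norm_eq_abs, abs_pow]
  gcongr

variable [IsProbabilityMeasure P]

/-- Used with `m` generated by the past and the current query, so that every cross term between
noise and signal vanishes. -/
lemma integral_mul_eq_zero_of_condExp_eq_zero (hm : m ≤ mΩ) (hη : MemLp η 2 P)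
    (hη0 : P[η | m] =ᵐ[P] 0) (hW : Measurable[m] W) (hW2 : MemLp W 2 P) :
    ∫ ω, η ω * W ω ∂P = 0 := by
  have hi : Integrable (η * W) P := hη.integrable_mul hW2
  have h1 := condExp_mul_of_stronglyMeasurable_right (μ := P) hW.stronglyMeasurable hi
    (hη.integrable (by norm_num))
  have h2 : ∫ ω, (P[η * W | m]) ω ∂P = ∫ ω, (η * W) ω ∂P := integral_condExp hm
  rw [show (fun ω => η ω * W ω) = η * W from rfl, ← h2, integral_congr_ae h1]
  refine integral_eq_zero_of_ae ?_
  filter_upwards [hη0] with ω hω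
  simp [hω]

lemma integral_sq_mul_sq_le (hm : m ≤ mΩ) (hη : MemLp η 2 P)
    (hηv : ∀ᵐ ω ∂P, (P[fun ω => η ω ^ 2 | m]) ω ≤ s) (hW : Measurable[m] W)
    (hWB : ∀ᵐ ω ∂P, |W ω| ≤ B) :
    ∫ ω, η ω ^ 2 * W ω ^ 2 ∂P ≤ s * ∫ ω, W ω ^ 2 ∂P := by
  have hi := integrable_sq_mul_sq hm hη hW hWB
  have hWi : Integrable (fun ω => W ω ^ 2) P := by
    refine Integrable.of_bound ((hW.mono hm le_rfl).pow_const 2).aestronglyMeasurable (B ^ 2) ?_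
    filter_upwards [hWB] with ω hω
    rw [Real.norm_eq_abs, abs_pow]
    gcongr
  have h1 := condExp_mul_of_stronglyMeasurable_right (μ := P) (f := fun ω => η ω ^ 2)
    (g := fun ω => W ω ^ 2) (hW.pow_const 2).stronglyMeasurable hi hη.integrable_sq
  have h2 : ∫ ω, (P[(fun ω => η ω ^ 2) * (fun ω => W ω ^ 2) | m]) ω ∂P =
    ∫ ω, η ω ^ 2 * W ω ^ 2 ∂P := integral_condExp hm
  rw [← h2, ← integral_const_mul]
  refine integral_mono_ae integrable_condExp (hWi.const_mul s) ?_
  filter_upwards [h1, hηv] with ω hω hv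
  rw [hω]
  exact mul_le_mul_of_nonneg_right hv (sq_nonneg _)

end Noise

lemma integral_kernelFun_sq_query_le {d : ℕ} (hd : 1 ≤ d) (β : ℕ) :
    ∫ z, kernelFun β z.1 ^ 2 ∂(unifInterval.prod (unifSphere d)) ≤ kernelBound β := by
  have := isProbabilityMeasure_unifSphere hd
  have hk := continuous_kernelFun β
  rw [integral_prod _ (integrable_query hd (by fun_prop))]
  simpa using integral_kernelFun_sq_le β

section Step

variable {Ω : Type*} {mΩ : MeasurableSpace Ω} {d β : ℕ} {P : Measure Ω}
  {ℱ : Filtration ℕ mΩ} {r : ℕ → Ω → ℝ} {u : ℕ → Ω → EuclideanSpace ℝ (Fin d)}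

lemma IsSampling.measurable_query (hs : IsSampling P ℱ r u) (n : ℕ) :
    Measurable[ℱ (n + 1)] fun ω => (r (n + 1) ω, u (n + 1) ω) :=
  (hs.measurable_r n).prodMk (hs.measurable_u n)

lemma IsSampling.measurable_query' (hs : IsSampling P ℱ r u) (n : ℕ) :
    Measurable fun ω => (r (n + 1) ω, u (n + 1) ω) :=
  (hs.measurable_query n).mono (ℱ.le _) le_rfl

lemma IsSampling.sup_comap_le (hs : IsSampling P ℱ r u) (n : ℕ) :
    (ℱ n : MeasurableSpace Ω) ⊔
      MeasurableSpace.comap (fun ω => (r (n + 1) ω, u (n + 1) ω)) inferInstance ≤ mΩ :=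
  sup_le (ℱ.le n) (hs.measurable_query' n).comap_le

lemma IsSampling.ae_query (hs : IsSampling P ℱ r u) (hd : 1 ≤ d) (n : ℕ) :
    ∀ᵐ ω ∂P, |r (n + 1) ω| ≤ 1 ∧ ‖u (n + 1) ω‖ = 1 := by
  have h := _root_.ae_query hd
  rw [← hs.law n] at h
  exact ae_of_ae_map (hs.measurable_query' n).aemeasurable h

variable [IsProbabilityMeasure P]

lemma IsSampling.map_prod (hs : IsSampling P ℱ r u) (n : ℕ) {x : Ω → EuclideanSpace ℝ (Fin d)}
    (hx : Measurable[ℱ n] x) :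
    P.map (fun ω => (x ω, (r (n + 1) ω, u (n + 1) ω))) =
      (P.map x).prod (unifInterval.prod (unifSphere d)) := by
  have h : IndepFun x (fun ω => (r (n + 1) ω, u (n + 1) ω)) P :=
    indep_of_indep_of_le_left (hs.indep n) hx.comap_le
  rw [← hs.law n]
  exact (indepFun_iff_map_prod_eq_prod_map_map (hx.mono (ℱ.le n) le_rfl).aemeasurable
    (hs.measurable_query' n).aemeasurable).1 h

/-- Integrating out the current query. -/
lemma IsSampling.integral_comp (hs : IsSampling P ℱ r u) (hd : 1 ≤ d) (n : ℕ)
    {x : Ω → EuclideanSpace ℝ (Fin d)} (hx : Measurable[ℱ n] x)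
    {h : EuclideanSpace ℝ (Fin d) × (ℝ × EuclideanSpace ℝ (Fin d)) → ℝ} (hh : Measurable h)
    (hi : Integrable (fun ω => h (x ω, (r (n + 1) ω, u (n + 1) ω))) P) :
    Integrable (fun ω => ∫ z, h (x ω, z) ∂(unifInterval.prod (unifSphere d))) P ∧
    ∫ ω, h (x ω, (r (n + 1) ω, u (n + 1) ω)) ∂P =
      ∫ ω, ∫ z, h (x ω, z) ∂(unifInterval.prod (unifSphere d)) ∂P := by
  have := isProbabilityMeasure_unifSphere hd
  have hxm : Measurable x := hx.mono (ℱ.le n) le_rfl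
  have hm : Measurable fun ω => (x ω, (r (n + 1) ω, u (n + 1) ω)) :=
    hxm.prodMk (hs.measurable_query' n)
  have hi' : Integrable h ((P.map x).prod (unifInterval.prod (unifSphere d))) := by
    rw [← hs.map_prod n hx]
    exact (integrable_map_measure hh.aestronglyMeasurable hm.aemeasurable).2 hi
  have hP : IsProbabilityMeasure (P.map x) := Measure.isProbabilityMeasure_map hxm.aemeasurable
  refine ⟨?_, ?_⟩
  · exact (integrable_map_measure hi'.integral_prod_left.aestronglyMeasurable hxm.aemeasurable).1
      hi'.integral_prod_left
  · rw [← integral_map hm.aemeasurable hh.aestronglyMeasurable (f := h), hs.map_prod n hx,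
      integral_prod _ hi', integral_map hxm.aemeasurable hi'.integral_prod_left.aestronglyMeasurable]

/-- One step of a stochastic gradient recursion whose gradient estimator has the signal part `F`
and the noise part `q * η * k(r)`. -/
lemma IsSampling.step (hs : IsSampling P ℱ r u) (hd : 1 ≤ d) (n : ℕ)
    {x : Ω → EuclideanSpace ℝ (Fin d)} (hx : Measurable[ℱ n] x) {xs : EuclideanSpace ℝ (Fin d)}
    (hx2 : Integrable (fun ω => ‖x ω - xs‖ ^ 2) P) {S : Set (EuclideanSpace ℝ (Fin d))}
    (hxS : ∀ ω, x ω ∈ S)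
    {F : EuclideanSpace ℝ (Fin d) × (ℝ × EuclideanSpace ℝ (Fin d)) → ℝ} (hF : Measurable F)
    {f : EuclideanSpace ℝ (Fin d) → ℝ} {ζ A₀ A₁ μ q s γ : ℝ} (hμ : 0 < μ) (hγ : 0 < γ)
    (hA₀ : 0 ≤ A₀) (hA₁ : 0 ≤ A₁)
    (hbias : ∀ y ∈ S, ∀ w, |∫ z, F (y, z) * inner ℝ z.2 w ∂(unifInterval.prod (unifSphere d)) -
      fderiv ℝ f y w| ≤ ζ * ‖w‖)
    (hFsq : ∀ y ∈ S, ∀ t v, |t| ≤ 1 → ‖v‖ = 1 →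
      F (y, (t, v)) ^ 2 ≤ kernelFun β t ^ 2 * (A₀ + A₁ * ‖y - xs‖ ^ 2))
    (hconv : ∀ y ∈ S, μ * ‖y - xs‖ ^ 2 ≤ fderiv ℝ f y (y - xs))
    {η : Ω → ℝ} (hη : MemLp η 2 P)
    (hη0 : P[η | (ℱ n : MeasurableSpace Ω) ⊔
      MeasurableSpace.comap (fun ω => (r (n + 1) ω, u (n + 1) ω)) inferInstance] =ᵐ[P] 0)
    (hηv : ∀ᵐ ω ∂P, (P[fun ω => η ω ^ 2 | (ℱ n : MeasurableSpace Ω) ⊔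
      MeasurableSpace.comap (fun ω => (r (n + 1) ω, u (n + 1) ω)) inferInstance]) ω ≤ s)
    (hs0 : 0 ≤ s) {y : Ω → EuclideanSpace ℝ (Fin d)}
    (hy : ∀ ω, y ω = x ω - (γ * (F (x ω, (r (n + 1) ω, u (n + 1) ω)) +
      q * η ω * kernelFun β (r (n + 1) ω))) • u (n + 1) ω) :
    Integrable (fun ω => ‖y ω - xs‖ ^ 2) P ∧
    ∫ ω, ‖y ω - xs‖ ^ 2 ∂P ≤ (1 - γ * μ) * ∫ ω, ‖x ω - xs‖ ^ 2 ∂P + γ * ζ ^ 2 / μ +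
      γ ^ 2 * kernelBound β * (A₀ + A₁ * ∫ ω, ‖x ω - xs‖ ^ 2 ∂P + q ^ 2 * s) := by
  have := isProbabilityMeasure_unifSphere hd
  set G : MeasurableSpace Ω := (ℱ n : MeasurableSpace Ω) ⊔
      MeasurableSpace.comap (fun ω => (r (n + 1) ω, u (n + 1) ω)) inferInstance with hG
  have hGm : G ≤ mΩ := hs.sup_comap_le n
  have hzG : Measurable[G] fun ω => (r (n + 1) ω, u (n + 1) ω) :=
    (comap_measurable _).mono le_sup_right le_rfl
  have hrG : Measurable[G] (r (n + 1)) := measurable_fst.comp hzG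
  have huG : Measurable[G] (u (n + 1)) := measurable_snd.comp hzG
  have hxG : Measurable[G] x := hx.mono le_sup_left le_rfl
  have hkG : Measurable[G] fun ω => kernelFun β (r (n + 1) ω) :=
    (continuous_kernelFun β).measurable.comp hrG
  have hZG : Measurable[G] fun ω => F (x ω, (r (n + 1) ω, u (n + 1) ω)) :=
    hF.comp (hxG.prodMk hzG)
  have hinG : Measurable[G] fun ω => inner ℝ (u (n + 1) ω) (x ω - xs) :=
    (Measurable.inner huG (hxG.sub_const xs))
  obtain ⟨B, hB0, hB⟩ := exists_kernelFun_bound β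
  have hae := hs.ae_query hd n
  set k : Ω → ℝ := fun ω => kernelFun β (r (n + 1) ω) with hk
  set Z : Ω → ℝ := fun ω => F (x ω, (r (n + 1) ω, u (n + 1) ω)) with hZ
  set p : Ω → ℝ := fun ω => inner ℝ (u (n + 1) ω) (x ω - xs) with hp
  set D : Ω → ℝ := fun ω => ‖x ω - xs‖ ^ 2 with hD
  have hkB : ∀ᵐ ω ∂P, |k ω| ≤ B := by
    filter_upwards [hae] with ω hω using hB _ hω.1
  have hpD : ∀ᵐ ω ∂P, p ω ^ 2 ≤ D ω := by
    filter_upwards [hae] with ω hω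
    have h1 := abs_real_inner_le_norm (u (n + 1) ω) (x ω - xs)
    rw [hω.2, one_mul] at h1
    rw [← sq_abs]
    exact pow_le_pow_left₀ (abs_nonneg _) h1 2
  have hZsq : ∀ᵐ ω ∂P, Z ω ^ 2 ≤ k ω ^ 2 * (A₀ + A₁ * D ω) := by
    filter_upwards [hae] with ω hω using hFsq _ (hxS ω) _ _ hω.1 hω.2
  have hD1 : Integrable (fun ω => A₀ + A₁ * D ω) P := (integrable_const _).add (hx2.const_mul A₁)
  have hkD : Integrable (fun ω => k ω ^ 2 * (A₀ + A₁ * D ω)) P := by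
    refine hD1.bdd_mul (c := B ^ 2) ((hkG.mono hGm le_rfl).pow_const 2).aestronglyMeasurable ?_
    filter_upwards [hkB] with ω hω
    rw [Real.norm_eq_abs, abs_pow]
    gcongr
  have hZ2 : MemLp Z 2 P := by
    rw [memLp_two_iff_integrable_sq (hZG.mono hGm le_rfl).aestronglyMeasurable]
    refine hkD.mono' ((hZG.mono hGm le_rfl).pow_const 2).aestronglyMeasurable ?_
    filter_upwards [hZsq] with ω hω
    rwa [Real.norm_eq_abs, abs_of_nonneg (sq_nonneg _)]
  have hp2 : MemLp p 2 P := by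
    rw [memLp_two_iff_integrable_sq (hinG.mono hGm le_rfl).aestronglyMeasurable]
    refine hx2.mono' ((hinG.mono hGm le_rfl).pow_const 2).aestronglyMeasurable ?_
    filter_upwards [hpD] with ω hω
    rwa [Real.norm_eq_abs, abs_of_nonneg (sq_nonneg _)]
  have hkmul : ∀ {W : Ω → ℝ}, MemLp W 2 P → MemLp (fun ω => k ω * W ω) 2 P := by
    intro W hW
    refine hW.of_le_mul (c := B) ((hkG.mono hGm le_rfl).aestronglyMeasurable.mul hW.1) ?_
    filter_upwards [hkB] with ω hω
    rw [norm_mul]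
    gcongr
    exact hω
  -- the noise terms
  have n1 : ∫ ω, η ω * (k ω * p ω) ∂P = 0 :=
    integral_mul_eq_zero_of_condExp_eq_zero hGm hη hη0 (hkG.mul hinG) (hkmul hp2)
  have n2 : ∫ ω, η ω * (k ω * Z ω) ∂P = 0 :=
    integral_mul_eq_zero_of_condExp_eq_zero hGm hη hη0 (hkG.mul hZG) (hkmul hZ2)
  have i1 : Integrable (fun ω => η ω * (k ω * p ω)) P := hη.integrable_mul (hkmul hp2)
  have i2 : Integrable (fun ω => η ω * (k ω * Z ω)) P := hη.integrable_mul (hkmul hZ2)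
  have i3 : Integrable (fun ω => η ω ^ 2 * k ω ^ 2) P := integrable_sq_mul_sq hGm hη hkG hkB
  have i4 : Integrable (fun ω => Z ω * p ω) P := hZ2.integrable_mul hp2
  have i5 : Integrable (fun ω => Z ω ^ 2) P := hZ2.integrable_sq
  have hkc := continuous_kernelFun β
  have hk2 : ∫ ω, k ω ^ 2 ∂P ≤ kernelBound β := by
    have h1 := (hs.integral_comp hd n hx (h := fun c => kernelFun β c.2.1 ^ 2)
      (by fun_prop) (by
        refine Integrable.of_bound ((hkG.mono hGm le_rfl).pow_const 2).aestronglyMeasurable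
          (B ^ 2) ?_
        filter_upwards [hkB] with ω hω
        rw [Real.norm_eq_abs, abs_pow]
        gcongr)).2
    simp only at h1
    rw [hk, h1]
    simpa using integral_kernelFun_sq_query_le hd β
  have n3 : ∫ ω, η ω ^ 2 * k ω ^ 2 ∂P ≤ s * kernelBound β :=
    (integral_sq_mul_sq_le hGm hη hηv hkG hkB).trans (mul_le_mul_of_nonneg_left hk2 hs0)
  -- The current query is independent of the past, so the kernel is averaged before the iterate; the
  -- same holds for `n5`.
  have n4 : ∫ ω, Z ω ^ 2 ∂P ≤ kernelBound β * (A₀ + A₁ * ∫ ω, D ω ∂P) := by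
    have h1 := hs.integral_comp hd n hx
      (h := fun c => kernelFun β c.2.1 ^ 2 * (A₀ + A₁ * ‖c.1 - xs‖ ^ 2)) (by fun_prop) hkD
    simp only [integral_mul_const] at h1
    calc ∫ ω, Z ω ^ 2 ∂P ≤ ∫ ω, k ω ^ 2 * (A₀ + A₁ * D ω) ∂P := integral_mono_ae i5 hkD hZsq
      _ ≤ ∫ ω, kernelBound β * (A₀ + A₁ * D ω) ∂P := by
        rw [h1.2]
        refine integral_mono h1.1 (hD1.const_mul _) fun ω => ?_
        exact mul_le_mul_of_nonneg_right (integral_kernelFun_sq_query_le hd β)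
          (by positivity)
      _ = _ := by
        rw [integral_const_mul, integral_add (integrable_const _) (hx2.const_mul A₁),
          integral_const_mul]
        simp
  -- Given the past, the mean of the signal term is at least `μ a² - ζ a` with `a = ‖x - xs‖`;
  -- Young's inequality spends half of the strong convexity on the bias.
  have n5 : μ / 2 * ∫ ω, D ω ∂P - ζ ^ 2 / (2 * μ) ≤ ∫ ω, Z ω * p ω ∂P := by
    have h1 := hs.integral_comp hd n hx
      (h := fun c => F c * inner ℝ c.2.2 (c.1 - xs)) (hF.mul (by fun_prop)) i4
    calc μ / 2 * ∫ ω, D ω ∂P - ζ ^ 2 / (2 * μ) = ∫ ω, (μ / 2 * D ω - ζ ^ 2 / (2 * μ)) ∂P := by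
          rw [integral_sub (hx2.const_mul _) (integrable_const _), integral_const_mul]
          simp
      _ ≤ _ := by
        rw [h1.2]
        refine integral_mono ((hx2.const_mul _).sub (integrable_const _)) h1.1 fun ω => ?_
        have h2 := (abs_le.1 (hbias _ (hxS ω) (x ω - xs))).1
        have h3 := hconv _ (hxS ω)
        simp only [hD]
        set a := ‖x ω - xs‖
        have h4 : ζ * a ≤ μ / 2 * a ^ 2 + ζ ^ 2 / (2 * μ) := by
          have h5 : μ / 2 * a ^ 2 + ζ ^ 2 / (2 * μ) - ζ * a = (μ * a - ζ) ^ 2 / (2 * μ) := by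
            field_simp; ring
          have h6 : 0 ≤ (μ * a - ζ) ^ 2 / (2 * μ) := by positivity
          linarith
        linarith
  have hexp : ∀ᵐ ω ∂P, ‖y ω - xs‖ ^ 2 = D ω - 2 * γ * (Z ω * p ω) - 2 * γ * q * (η ω * (k ω * p ω))
      + γ ^ 2 * Z ω ^ 2 + 2 * γ ^ 2 * q * (η ω * (k ω * Z ω)) +
      γ ^ 2 * q ^ 2 * (η ω ^ 2 * k ω ^ 2) := by
    filter_upwards [hae] with ω hω
    rw [hy, sub_right_comm, norm_sub_sq_real, inner_smul_right, norm_smul, hω.2,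
      real_inner_comm (u (n + 1) ω) (x ω - xs), mul_one, Real.norm_eq_abs, sq_abs]
    simp only [hD, hZ, hp, hk]
    ring
  have j1 := hx2.sub (i4.const_mul (2 * γ))
  have j2 := j1.sub (i1.const_mul (2 * γ * q))
  have j3 := j2.add (i5.const_mul (γ ^ 2))
  have j4 := j3.add (i2.const_mul (2 * γ ^ 2 * q))
  have j5 := j4.add (i3.const_mul (γ ^ 2 * q ^ 2))
  refine ⟨j5.congr (hexp.mono fun ω hω => hω.symm), ?_⟩
  have hval : ∫ ω, ‖y ω - xs‖ ^ 2 ∂P = ∫ ω, D ω ∂P - 2 * γ * ∫ ω, Z ω * p ω ∂P +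
      γ ^ 2 * ∫ ω, Z ω ^ 2 ∂P + γ ^ 2 * q ^ 2 * ∫ ω, η ω ^ 2 * k ω ^ 2 ∂P := by
    rw [integral_congr_ae hexp]
    erw [integral_add j4 (i3.const_mul _), integral_add j3 (i2.const_mul _),
      integral_add j2 (i5.const_mul _), integral_sub j1 (i1.const_mul _),
      integral_sub hx2 (i4.const_mul _)]
    simp only [integral_const_mul, n1, n2]
    ring
  rw [hval]
  have g1 : 2 * γ * (μ / 2 * ∫ ω, D ω ∂P - ζ ^ 2 / (2 * μ)) ≤ 2 * γ * ∫ ω, Z ω * p ω ∂P :=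
    mul_le_mul_of_nonneg_left n5 (by positivity)
  have g2 := mul_le_mul_of_nonneg_left n4 (sq_nonneg γ)
  have g3 := mul_le_mul_of_nonneg_left n3 (by positivity : 0 ≤ γ ^ 2 * q ^ 2)
  have g4 : 2 * γ * (μ / 2 * ∫ ω, D ω ∂P - ζ ^ 2 / (2 * μ)) =
      γ * μ * ∫ ω, D ω ∂P - γ * ζ ^ 2 / μ := by
    field_simp
  nlinarith [g1, g2, g3, g4]

end Step

/-! ### Strongly convex and smooth functions -/

section Convexity

variable {d : ℕ} {f : EuclideanSpace ℝ (Fin d) → ℝ} {μ M : ℝ}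
  {K : Set (EuclideanSpace ℝ (Fin d))}

/-- The gradient inequality for strongly convex functions. -/
lemma StrongConvexOn.fderiv_le (hf : StrongConvexOn Set.univ μ f) (hd : Differentiable ℝ f)
    (x y : EuclideanSpace ℝ (Fin d)) :
    fderiv ℝ f x (y - x) + μ / 2 * ‖y - x‖ ^ 2 ≤ f y - f x := by
  have h1 := (deriv_comp_line hd x (y - x) 0).hasDerivWithinAt (s := Set.Ioi 0)
  rw [hasDerivWithinAt_iff_tendsto_slope' (by simp)] at h1
  simp only [zero_smul, add_zero] at h1
  have h2 : Tendsto (fun t : ℝ => f y - f x - (1 - t) * (μ / 2 * ‖y - x‖ ^ 2)) (𝓝[>] 0)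
      (𝓝 (f y - f x - (1 - 0) * (μ / 2 * ‖y - x‖ ^ 2))) := by
    apply Tendsto.mono_left _ nhdsWithin_le_nhds
    exact Continuous.tendsto (by fun_prop) 0
  -- The strong convexity inequality on the segment is divided by `t`, and `t` tends to `0` from the
  -- right.
  have h3 := le_of_tendsto_of_tendsto h1 h2 (by
    filter_upwards [Ioo_mem_nhdsGT (zero_lt_one (α := ℝ))] with t ht
    have h4 := hf.2 (Set.mem_univ x) (Set.mem_univ y) (sub_nonneg.2 ht.2.le) ht.1.le (by ring)
    have h5 : (1 - t) • x + t • y = x + t • (y - x) := by module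
    rw [h5, norm_sub_rev, smul_eq_mul, smul_eq_mul] at h4
    rw [slope_def_field, div_le_iff₀ (by simpa using ht.1)]
    simp only [zero_smul, add_zero, sub_zero]
    nlinarith [h4])
  linarith

/-- Quadratic growth at a constrained minimizer. -/
lemma StrongConvexOn.le_sub_of_isMinOn (hf : StrongConvexOn Set.univ μ f) (hK : Convex ℝ K)
    {xs y : EuclideanSpace ℝ (Fin d)} (hxs : xs ∈ K) (hmin : IsMinOn f K xs) (hy : y ∈ K) :
    μ / 2 * ‖y - xs‖ ^ 2 ≤ f y - f xs := by
  have h2 : Tendsto (fun t : ℝ => (1 - t) * (μ / 2 * ‖y - xs‖ ^ 2)) (𝓝[>] 0)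
      (𝓝 ((1 - 0) * (μ / 2 * ‖y - xs‖ ^ 2))) := by
    apply Tendsto.mono_left _ nhdsWithin_le_nhds
    exact Continuous.tendsto (by fun_prop) 0
  have h3 := le_of_tendsto h2 (b := f y - f xs) (by
    filter_upwards [Ioo_mem_nhdsGT (zero_lt_one (α := ℝ))] with t ht
    have h4 := hf.2 (Set.mem_univ xs) (Set.mem_univ y) (sub_nonneg.2 ht.2.le) ht.1.le (by ring)
    have h5 := isMinOn_iff.1 hmin _ (hK hxs hy (sub_nonneg.2 ht.2.le) ht.1.le (by ring))
    rw [norm_sub_rev, smul_eq_mul, smul_eq_mul] at h4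
    have h6 : t * ((1 - t) * (μ / 2 * ‖y - xs‖ ^ 2)) ≤ t * (f y - f xs) := by
      nlinarith [h4, h5]
    exact le_of_mul_le_mul_left h6 ht.1)
  linarith

/-- The gradient inequality from `y` to `xs` and quadratic growth at `xs` contribute `μ / 2` each.
The gradient need not vanish at `xs`, so constrained minimizers are covered. -/
lemma StrongConvexOn.mul_sq_le_fderiv (hf : StrongConvexOn Set.univ μ f) (hd : Differentiable ℝ f)
    (hK : Convex ℝ K) {xs y : EuclideanSpace ℝ (Fin d)} (hxs : xs ∈ K) (hmin : IsMinOn f K xs)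
    (hy : y ∈ K) : μ * ‖y - xs‖ ^ 2 ≤ fderiv ℝ f y (y - xs) := by
  have h1 := hf.fderiv_le hd y xs
  have h2 := hf.le_sub_of_isMinOn hK hxs hmin hy
  rw [← neg_sub y xs, map_neg, norm_neg] at h1
  linarith

lemma SmoothOrderOn.abs_fderiv_sub_le (hf : SmoothOrderOn K 2 M f)
    {x y : EuclideanSpace ℝ (Fin d)} (hx : x ∈ K) (hy : y ∈ K) (v : EuclideanSpace ℝ (Fin d)) :
    |fderiv ℝ f x v - fderiv ℝ f y v| ≤ M ^ 2 * ‖x - y‖ * ‖v‖ := by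
  rcases eq_or_ne v 0 with rfl | hv
  · simp
  have hv' := norm_pos_iff.2 hv
  have h := hf.2 (‖v‖⁻¹ • v) (by simp [norm_smul, hv'.ne']) x hx y hy
  simp only [Nat.add_one_sub_one, iteratedFDeriv_one_apply, map_smul, smul_eq_mul] at h
  rw [← mul_sub, abs_mul, abs_of_nonneg (by positivity), inv_mul_le_iff₀ hv'] at h
  linarith

lemma SmoothOrderOn.abs_sub_sub_fderiv_le (hf : SmoothOrderOn K 2 M f) (hK : Convex ℝ K)
    {x y : EuclideanSpace ℝ (Fin d)} (hx : x ∈ K) (hy : y ∈ K) :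
    |f y - f x - fderiv ℝ f x (y - x)| ≤ M ^ 2 / 2 * ‖y - x‖ ^ 2 := by
  have hd : Differentiable ℝ f := (hf.contDiff_one le_rfl).differentiable (by norm_num)
  have hline := deriv_comp_line hd x (y - x)
  have h1 : ∀ t, HasDerivAt (fun t : ℝ => f (x + t • (y - x)) - f x - t * fderiv ℝ f x (y - x))
      (fderiv ℝ f (x + t • (y - x)) (y - x) - fderiv ℝ f x (y - x)) t := by
    intro t
    refine (((hline t).sub_const (f x)).sub
      ((hasDerivAt_id t).mul_const (fderiv ℝ f x (y - x)))).congr_deriv ?_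
    simp
  have h2 : ∀ t : ℝ, HasDerivAt (fun t : ℝ => M ^ 2 * ‖y - x‖ ^ 2 * (t ^ 2 / 2))
      (M ^ 2 * ‖y - x‖ ^ 2 * t) t := by
    intro t
    refine (((hasDerivAt_pow 2 t).div_const 2).const_mul (M ^ 2 * ‖y - x‖ ^ 2)).congr_deriv ?_
    simp
  have h3 := image_norm_le_of_norm_deriv_right_le_deriv_boundary (a := (0 : ℝ)) (b := 1)
    (f := fun t : ℝ => f (x + t • (y - x)) - f x - t * fderiv ℝ f x (y - x))
    (fun t _ => (h1 t).continuousAt.continuousWithinAt)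
    (fun t _ => (h1 t).hasDerivWithinAt)
    (B := fun t : ℝ => M ^ 2 * ‖y - x‖ ^ 2 * (t ^ 2 / 2)) (by simp) h2 (by
      intro t ht
      have h4 := hf.abs_fderiv_sub_le (hK.add_smul_sub_mem hx hy ⟨ht.1, ht.2.le⟩) hx (y - x)
      rw [Real.norm_eq_abs]
      refine h4.trans (le_of_eq ?_)
      rw [add_sub_cancel_left, norm_smul, Real.norm_eq_abs, abs_of_nonneg ht.1]
      ring) (Set.right_mem_Icc.2 zero_le_one)
  simp only [one_smul, one_mul, one_pow, add_sub_cancel, Real.norm_eq_abs] at h3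
  linarith

lemma SmoothOrderOn.sub_le_of_isMinOn_univ (hf : SmoothOrderOn K 2 M f) (hK : Convex ℝ K)
    {xs y : EuclideanSpace ℝ (Fin d)} (hxs : xs ∈ K) (hy : y ∈ K) (hmin : IsMinOn f Set.univ xs) :
    |f y - f xs| ≤ M ^ 2 / 2 * ‖y - xs‖ ^ 2 := by
  have h := hf.abs_sub_sub_fderiv_le hK hxs hy
  rwa [IsLocalMin.fderiv_eq_zero (hmin.isLocalMin univ_mem), zero_apply, sub_zero] at h

/-- Integrating quadratic upper bounds at the minimizer. -/
lemma SmoothOrderOn.integral_sub_le {Ω : Type*} {mΩ : MeasurableSpace Ω} {P : Measure Ω}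
    [IsProbabilityMeasure P] (hf : SmoothOrderOn K 2 M f) (hK : Convex ℝ K)
    {xs : EuclideanSpace ℝ (Fin d)} (hxs : xs ∈ K) (hmin : IsMinOn f Set.univ xs)
    {X : Ω → EuclideanSpace ℝ (Fin d)} (hX : Measurable X) (hXK : ∀ ω, X ω ∈ K)
    (hi : Integrable (fun ω => ‖X ω - xs‖ ^ 2) P) :
    Integrable (fun ω => f (X ω)) P ∧
      ∫ ω, f (X ω) ∂P - f xs ≤ M ^ 2 / 2 * ∫ ω, ‖X ω - xs‖ ^ 2 ∂P := by
  have hfc := (hf.contDiff_one le_rfl).continuous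
  have h1 : Integrable (fun ω => f (X ω) - f xs) P :=
    (hi.const_mul (M ^ 2 / 2)).mono' ((hfc.measurable.comp hX).sub_const _).aestronglyMeasurable
      (.of_forall fun ω => hf.sub_le_of_isMinOn_univ hK hxs (hXK ω) hmin)
  have h2 : Integrable (fun ω => f (X ω)) P := by
    refine (h1.add (integrable_const (f xs))).congr (.of_forall fun ω => ?_)
    simp
  refine ⟨h2, ?_⟩
  have h3 : ∫ ω, f (X ω) ∂P - f xs = ∫ ω, (f (X ω) - f xs) ∂P := by
    rw [integral_sub h2 (integrable_const _)]; simp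
  rw [h3, ← integral_const_mul]
  exact integral_mono h1 (hi.const_mul _) fun ω =>
    (le_abs_self _).trans (hf.sub_le_of_isMinOn_univ hK hxs (hXK ω) hmin)

end Convexity

/-! ### The scalar recursion -/

lemma recursion_bound {a : ℕ → ℝ} {n₀ p q : ℝ} (hn₀ : 1 ≤ n₀) (hq : 0 ≤ q)
    (h : ∀ n : ℕ, a (n + 1) ≤ (1 - 2 / (n + 1 + n₀)) * a n + p / (n + 1 + n₀) +
      q / (n + 1 + n₀) ^ 2) (n : ℕ) :
    (n + n₀) * (n + n₀ - 1) * a n ≤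
      n₀ * (n₀ - 1) * a 0 + p / 2 * ((n + n₀) * (n + n₀ - 1)) + q * n -
        p / 2 * (n₀ * (n₀ - 1)) := by
  induction n with
  | zero => simp
  | succ n ih =>
    push_cast
    set m : ℝ := n + 1 + n₀ with hm
    have hn : (0 : ℝ) ≤ n := n.cast_nonneg
    have hm1 : 2 ≤ m := by linarith
    have h1 := mul_le_mul_of_nonneg_left (h n) (by nlinarith : 0 ≤ m * (m - 1))
    -- Contraction by `1 - 2 / m` turns the weight `m (m - 1)` into the preceding weight `(m - 1)(m
    -- - 2)`, and `p (m - 1)` is the increment of `p / 2 * m (m - 1)`.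
    have h2 : m * (m - 1) * ((1 - 2 / m) * a n + p / m + q / m ^ 2) =
        (m - 1) * (m - 2) * a n + p * (m - 1) + q * ((m - 1) / m) := by
      field_simp
    have h3 : q * ((m - 1) / m) ≤ q * 1 :=
      mul_le_mul_of_nonneg_left (by rw [div_le_one (by linarith)]; linarith) hq
    have h4 : (n : ℝ) + n₀ = m - 1 := by rw [hm]; ring
    rw [h4] at ih
    nlinarith [h1, h2, h3, ih]

/-! ### Euclidean projections -/

section Projection

variable {d : ℕ} {K : Set (EuclideanSpace ℝ (Fin d))}

lemma isNearest_projOn (hK : IsCompact K) (hne : K.Nonempty) (z : EuclideanSpace ℝ (Fin d)) :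
    IsNearest K z (projOn K z) := by
  have h : ∃ p, IsNearest K z p := by
    obtain ⟨p, hp, hmin⟩ := hK.exists_isMinOn hne
      (f := fun q => ‖z - q‖) (by fun_prop)
    exact ⟨p, hp, fun q hq => isMinOn_iff.1 hmin q hq⟩
  rw [projOn, dif_pos h]
  exact h.choose_spec

lemma IsNearest.inner_le_zero (hK : Convex ℝ K) {z p : EuclideanSpace ℝ (Fin d)}
    (h : IsNearest K z p) {w : EuclideanSpace ℝ (Fin d)} (hw : w ∈ K) :
    inner ℝ (z - p) (w - p) ≤ 0 := by
  have : Nonempty K := ⟨⟨p, h.1⟩⟩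
  refine (norm_eq_iInf_iff_real_inner_le_zero hK h.1).1 (le_antisymm ?_ ?_) w hw
  · exact le_ciInf fun q => h.2 q q.2
  · exact ciInf_le (f := fun w : K => ‖z - w‖)
      ⟨0, Set.forall_mem_range.2 fun _ => norm_nonneg _⟩ ⟨p, h.1⟩

/-- Adding the two variational inequalities gives `‖p - p'‖² ≤ ⟨z - z', p - p'⟩`, and Cauchy–Schwarz
concludes. -/
lemma IsNearest.norm_sub_le (hK : Convex ℝ K) {z z' p p' : EuclideanSpace ℝ (Fin d)}
    (h : IsNearest K z p) (h' : IsNearest K z' p') : ‖p - p'‖ ≤ ‖z - z'‖ := by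
  have h1 := h.inner_le_zero hK h'.1
  have h2 := h'.inner_le_zero hK h.1
  have h3 : inner ℝ (z - z') (p - p') - inner ℝ (p - p') (p - p') =
      -(inner ℝ (z - p) (p' - p)) - inner ℝ (z' - p') (p - p') := by
    rw [← inner_neg_right, neg_sub, ← inner_sub_left, ← inner_sub_left]
    congr 1
    abel
  have h4 := real_inner_le_norm (z - z') (p - p')
  rw [real_inner_self_eq_norm_sq] at h3
  have h5 : ‖p - p'‖ * ‖p - p'‖ ≤ ‖z - z'‖ * ‖p - p'‖ := by nlinarith
  rcases eq_or_lt_of_le (norm_nonneg (p - p')) with h6 | h6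
  · rw [← h6]; exact norm_nonneg _
  · exact le_of_mul_le_mul_right h5 h6

lemma continuous_projOn (hK : IsCompact K) (hc : Convex ℝ K) (hne : K.Nonempty) :
    Continuous (projOn K) := by
  refine (LipschitzWith.of_dist_le_mul (K := 1) fun z z' => ?_).continuous
  rw [dist_eq_norm, dist_eq_norm, NNReal.coe_one, one_mul]
  exact (isNearest_projOn hK hne z).norm_sub_le hc (isNearest_projOn hK hne z')

lemma norm_projOn_sub_le (hK : IsCompact K) (hc : Convex ℝ K) {y : EuclideanSpace ℝ (Fin d)}
    (hy : y ∈ K) (z : EuclideanSpace ℝ (Fin d)) : ‖projOn K z - y‖ ≤ ‖z - y‖ :=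
  (isNearest_projOn hK ⟨y, hy⟩ z).norm_sub_le hc ⟨hy, fun q _ => by simp⟩

end Projection

/-! ### The one-point estimator -/

/-- A bound for the bias of the gradient estimators with smoothing radius `δ`. -/
noncomputable def biasBound (β : ℕ) (M δ : ℝ) : ℝ :=
  taylorErr β M δ / |δ| * (4 * kernelBound β + 3 * Real.sqrt (kernelBound β))

section OnePoint

variable {d β : ℕ} {M : ℝ} {f : EuclideanSpace ℝ (Fin d) → ℝ}

lemma abs_integral_onePoint_sub_le (hd : 1 ≤ d) (hβ : 2 ≤ β) (hf : SmoothOrderOn Set.univ β M f)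
    (x w : EuclideanSpace ℝ (Fin d)) {δ : ℝ} (hδ : δ ≠ 0) :
    |∫ z, d / δ * f (x + (δ * z.1) • z.2) * kernelFun β z.1 * inner ℝ z.2 w
      ∂(unifInterval.prod (unifSphere d)) - fderiv ℝ f x w| ≤ biasBound β M δ * ‖w‖ := by
  rcases eq_or_ne w 0 with rfl | hw
  · simp
  have hw' := norm_pos_iff.2 hw
  have h := abs_integral_estimator_sub_le hd hβ hf x (w := ‖w‖⁻¹ • w)
    (by simp [norm_smul, hw'.ne']) δ
  set J := ∫ z, kernelFun β z.1 * f (x + (δ * z.1) • z.2) * inner ℝ z.2 w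
      ∂(unifInterval.prod (unifSphere d)) with hJ
  have h1 : ∫ z, kernelFun β z.1 * f (x + (δ * z.1) • z.2) * inner ℝ z.2 (‖w‖⁻¹ • w)
      ∂(unifInterval.prod (unifSphere d)) = ‖w‖⁻¹ * J := by
    rw [hJ, ← integral_const_mul]
    congr 1; ext z
    rw [inner_smul_right]; ring
  have h2 : ∫ z, d / δ * f (x + (δ * z.1) • z.2) * kernelFun β z.1 * inner ℝ z.2 w
      ∂(unifInterval.prod (unifSphere d)) = d / δ * J := by
    rw [hJ, ← integral_const_mul]
    congr 1; ext z
    ring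
  rw [h1, map_smul, smul_eq_mul] at h
  rw [h2, biasBound]
  have h3 : d / δ * J - fderiv ℝ f x w =
      ‖w‖ / δ * (d * (‖w‖⁻¹ * J) - δ * (‖w‖⁻¹ * fderiv ℝ f x w)) := by
    field_simp
  rw [h3, abs_mul, abs_div, abs_norm]
  refine (mul_le_mul_of_nonneg_left h (by positivity)).trans (le_of_eq ?_)
  ring

end OnePoint

section OnePointBound

variable {Ω : Type*} {mΩ : MeasurableSpace Ω} {d β : ℕ} {P : Measure Ω}
  {ℱ : Filtration ℕ mΩ} {r : ℕ → Ω → ℝ} {u : ℕ → Ω → EuclideanSpace ℝ (Fin d)}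
  {f : EuclideanSpace ℝ (Fin d) → ℝ} {K : Set (EuclideanSpace ℝ (Fin d))} {ε : ℕ → Ω → ℝ}
  {γ : ℕ → ℝ} {δ μ M σ C : ℝ} {x₀ xs : EuclideanSpace ℝ (Fin d)}

lemma onePoint_mem (hK : IsCompact K) (hx₀ : x₀ ∈ K) (δ : ℕ → ℝ) (n : ℕ) (ω : Ω) :
    onePoint K f (kernelFun β) γ δ x₀ (fun n => r n ω) (fun n => u n ω) (fun n => ε n ω) n ∈ K := by
  cases n with
  | zero => exact hx₀
  | succ n => exact (isNearest_projOn hK ⟨x₀, hx₀⟩ _).1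

lemma measurable_onePoint (hs : IsSampling P ℱ r u) (hε : IsNoise P ℱ r u σ ε) (hf : Continuous f)
    (hK : IsCompact K) (hc : Convex ℝ K) (hx₀ : x₀ ∈ K) (δ : ℕ → ℝ) (n : ℕ) :
    Measurable[ℱ n] fun ω => onePoint K f (kernelFun β) γ δ x₀ (fun n => r n ω) (fun n => u n ω)
      (fun n => ε n ω) n := by
  induction n with
  | zero => exact measurable_const
  | succ n ih =>
    have hx := ih.mono (ℱ.mono n.le_succ) le_rfl
    have hr := hs.measurable_r n
    have hu := hs.measurable_u n
    have he := hε.measurable n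
    have hk := (continuous_kernelFun β).measurable
    have hp := (continuous_projOn hK hc ⟨x₀, hx₀⟩).measurable
    have hfm := hf.measurable
    simp only [onePoint]
    refine hp.comp (hx.sub (Measurable.fun_smul ?_ hu))
    refine Measurable.mul (Measurable.mul measurable_const (Measurable.add ?_ he)) (hk.comp hr)
    exact hfm.comp (hx.add ((hr.const_mul _).fun_smul hu))

variable [IsProbabilityMeasure P]

/-- The general step applies before projection, and projection does not increase the distance to `xs
∈ K`. Queries stay within `δ` of `K`, so the signal is bounded through `C` and no term grows with
the distance (`A₁ = 0`). -/
lemma onePoint_step (hs : IsSampling P ℱ r u) (hε : IsNoise P ℱ r u σ ε) (hd : 1 ≤ d)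
    (hβ : 2 ≤ β) (hf : SmoothOrderOn Set.univ β M f) (hfc : StrongConvexOn Set.univ μ f)
    (hμ : 0 < μ) (hK : IsCompact K) (hc : Convex ℝ K) (hδ : 0 < δ) (hγ : ∀ n, 0 < γ n)
    (hC : ∀ y ∈ Metric.cthickening δ K, |f y| ≤ C) (hxs : xs ∈ K) (hmin : IsMinOn f K xs)
    (hx₀ : x₀ ∈ K) {x : ℕ → Ω → EuclideanSpace ℝ (Fin d)}
    (hx : ∀ n ω, x n ω = onePoint K f (kernelFun β) γ (fun _ => δ) x₀ (fun n => r n ω)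
      (fun n => u n ω) (fun n => ε n ω) n) (n : ℕ)
    (hi : Integrable (fun ω => ‖x n ω - xs‖ ^ 2) P) :
    Integrable (fun ω => ‖x (n + 1) ω - xs‖ ^ 2) P ∧
    ∫ ω, ‖x (n + 1) ω - xs‖ ^ 2 ∂P ≤ (1 - γ (n + 1) * μ) * ∫ ω, ‖x n ω - xs‖ ^ 2 ∂P +
      γ (n + 1) * biasBound β M δ ^ 2 / μ +
      γ (n + 1) ^ 2 * (kernelBound β * (d / δ) ^ 2 * (C ^ 2 + σ ^ 2)) := by
  have hf1 := hf.contDiff_one hβ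
  have hmeas : ∀ n, Measurable[ℱ n] (x n) := fun n => by
    rw [funext (hx n)]
    exact measurable_onePoint hs hε hf1.continuous hK hc hx₀ _ n
  have hmem : ∀ n ω, x n ω ∈ K := fun n ω => by rw [hx]; exact onePoint_mem hK hx₀ _ n ω
  have hk := (continuous_kernelFun β).measurable
  have hfm := hf1.continuous.measurable
  set F : EuclideanSpace ℝ (Fin d) × (ℝ × EuclideanSpace ℝ (Fin d)) → ℝ := fun c =>
    d / δ * f (c.1 + (δ * c.2.1) • c.2.2) * kernelFun β c.2.1 with hF
  set y : Ω → EuclideanSpace ℝ (Fin d) := fun ω =>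
    x n ω - (γ (n + 1) * (F (x n ω, (r (n + 1) ω, u (n + 1) ω)) +
      d / δ * ε (n + 1) ω * kernelFun β (r (n + 1) ω))) • u (n + 1) ω with hy
  have hxy : ∀ ω, x (n + 1) ω = projOn K (y ω) := by
    intro ω
    rw [hx, onePoint, ← hx]
    simp only [hy, hF]
    congr 3
    ring
  have hstep := hs.step hd n (hmeas n) hi (hmem n) (F := F) (by rw [hF]; fun_prop)
    (f := f) (ζ := biasBound β M δ) (A₀ := (d / δ) ^ 2 * C ^ 2) (A₁ := 0) (μ := μ) (q := d / δ)
    (s := σ ^ 2) (γ := γ (n + 1)) (β := β) hμ (hγ _) (by positivity) le_rfl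
    (fun y _ w => abs_integral_onePoint_sub_le hd hβ hf y w hδ.ne')
    (fun y hy t v ht hv => by
      have h1 : |f (y + (δ * t) • v)| ≤ C := by
        refine hC _ (Metric.mem_cthickening_of_dist_le _ y _ _ hy ?_)
        rw [dist_eq_norm, add_sub_cancel_left, norm_smul, hv, mul_one, Real.norm_eq_abs, abs_mul,
          abs_of_pos hδ]
        exact mul_le_of_le_one_right hδ.le ht
      have h2 := pow_le_pow_left₀ (abs_nonneg _) h1 2
      rw [sq_abs] at h2
      simp only [hF]
      calc (d / δ * f (y + (δ * t) • v) * kernelFun β t) ^ 2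
          = kernelFun β t ^ 2 * ((d / δ) ^ 2 * f (y + (δ * t) • v) ^ 2) := by ring
        _ ≤ kernelFun β t ^ 2 * ((d / δ) ^ 2 * C ^ 2) := by gcongr
        _ = _ := by ring)
    (fun y hy => hfc.mul_sq_le_fderiv (hf1.differentiable (by norm_num)) hc hxs hmin hy)
    (hε.memLp n) (hε.centred n) (hε.variance n) (sq_nonneg σ) (y := y) (fun ω => rfl)
  have hle : ∀ ω, ‖x (n + 1) ω - xs‖ ^ 2 ≤ ‖y ω - xs‖ ^ 2 := fun ω => by
    rw [hxy]
    exact pow_le_pow_left₀ (norm_nonneg _) (norm_projOn_sub_le hK hc hxs _) 2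
  have hi' : Integrable (fun ω => ‖x (n + 1) ω - xs‖ ^ 2) P := by
    refine hstep.1.mono' ?_ (.of_forall fun ω => ?_)
    · have := (hmeas (n + 1)).mono (ℱ.le _) le_rfl
      exact ((this.sub_const xs).norm.pow_const 2).aestronglyMeasurable
    · rw [Real.norm_eq_abs, abs_of_nonneg (by positivity)]; exact hle ω
  refine ⟨hi', (integral_mono hi' hstep.1 hle).trans (hstep.2.trans (le_of_eq ?_))⟩
  ring

/-- The error of the one-point algorithm with the step sizes `2 / (μ (n + 1))`. -/
lemma onePoint_bound (hs : IsSampling P ℱ r u) (hε : IsNoise P ℱ r u σ ε) (hd : 1 ≤ d)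
    (hβ : 2 ≤ β) (hf : SmoothOrderOn Set.univ β M f) (hfc : StrongConvexOn Set.univ μ f)
    (hμ : 0 < μ) (hK : IsCompact K) (hc : Convex ℝ K) (hδ : 0 < δ)
    (hγ : ∀ n, γ n = 2 / (μ * (n + 1)))
    (hC : ∀ y ∈ Metric.cthickening δ K, |f y| ≤ C) (hxs : xs ∈ K) (hmin : IsMinOn f K xs)
    (hx₀ : x₀ ∈ K) {x : ℕ → Ω → EuclideanSpace ℝ (Fin d)}
    (hx : ∀ n ω, x n ω = onePoint K f (kernelFun β) γ (fun _ => δ) x₀ (fun n => r n ω)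
      (fun n => u n ω) (fun n => ε n ω) n) {N : ℕ} (hN : 1 ≤ N) :
    Integrable (fun ω => ‖x N ω - xs‖ ^ 2) P ∧
    ∫ ω, ‖x N ω - xs‖ ^ 2 ∂P ≤ biasBound β M δ ^ 2 / μ ^ 2 +
      4 * (kernelBound β * (d / δ) ^ 2 * (C ^ 2 + σ ^ 2)) / (μ ^ 2 * (N + 1)) := by
  have hstep := onePoint_step hs hε hd hβ hf hfc hμ hK hc hδ
    (γ := γ) (fun n => by rw [hγ]; positivity) hC hxs hmin hx₀ hx
  have hi : ∀ n, Integrable (fun ω => ‖x n ω - xs‖ ^ 2) P := by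
    intro n
    induction n with
    | zero => simp [hx, onePoint]
    | succ n ih => exact (hstep n ih).1
  refine ⟨hi N, ?_⟩
  set V := kernelBound β * (d / δ) ^ 2 * (C ^ 2 + σ ^ 2) with hV
  have hV0 : 0 ≤ V := mul_nonneg (mul_nonneg (kernelBound_nonneg β) (by positivity)) (by positivity)
  set ζ := biasBound β M δ with hζ
  -- With `n₀ = 1` the initial weight `n₀ (n₀ - 1)` is zero, so the starting point is forgotten
  -- altogether.
  have hrec := recursion_bound (a := fun n => ∫ ω, ‖x n ω - xs‖ ^ 2 ∂P) (n₀ := 1)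
    (p := 2 * ζ ^ 2 / μ ^ 2) (q := 4 * V / μ ^ 2) le_rfl (by positivity) (fun n => by
      refine (hstep n (hi n)).2.trans (le_of_eq ?_)
      rw [hγ]
      push_cast
      have : (n : ℝ) + 1 + 1 ≠ 0 := by positivity
      field_simp
      ring) N
  have hN0 : (0 : ℝ) < N := by exact_mod_cast hN
  simp only [sub_self, mul_zero, zero_mul, add_sub_cancel_right, zero_add, sub_zero] at hrec
  have hpos : (0 : ℝ) < (N + 1) * N := by positivity
  refine le_of_mul_le_mul_left (hrec.trans (le_of_eq ?_)) hpos
  field_simp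

end OnePointBound

/-! ### The constrained case -/

section Numerics

/-- Induction through `(1 + 1 / (n + 1))^(n + 1) ≤ e`. It lets the `(β - 1)!` of the Taylor
remainder absorb the `β / e` in the radius. -/
lemma pow_le_exp_mul_factorial (n : ℕ) : ((n : ℝ) + 1) ^ n ≤ Real.exp 1 ^ n * n.factorial := by
  induction n with
  | zero => simp
  | succ n ih =>
    have h1 : (1 + 1 / ((n : ℝ) + 1)) ^ (n + 1) ≤ Real.exp 1 := by
      have h2 := Real.add_one_le_exp (1 / ((n : ℝ) + 1))
      calc (1 + 1 / ((n : ℝ) + 1)) ^ (n + 1) ≤ Real.exp (1 / ((n : ℝ) + 1)) ^ (n + 1) :=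
            pow_le_pow_left₀ (by positivity) (by linarith) _
        _ = Real.exp 1 := by
            rw [← Real.exp_nat_mul]; congr 1; push_cast; field_simp
    rw [Nat.factorial_succ]
    push_cast
    calc ((n : ℝ) + 1 + 1) ^ (n + 1)
        = (1 + 1 / ((n : ℝ) + 1)) ^ (n + 1) * (((n : ℝ) + 1) ^ n * ((n : ℝ) + 1)) := by
          rw [← pow_succ, ← mul_pow]; congr 1; field_simp
      _ ≤ Real.exp 1 * ((Real.exp 1 ^ n * n.factorial) * ((n : ℝ) + 1)) := by gcongr
      _ = _ := by ring

lemma pow_five_le (n : ℕ) : 144 * ((n : ℝ) + 2) ^ 5 ≤ 448 * 25 ^ (n + 1) := by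
  induction n with
  | zero => norm_num
  | succ n ih =>
    have h1 : ((n : ℝ) + 1 + 2) ^ 5 ≤ (3 / 2 * ((n : ℝ) + 2)) ^ 5 :=
      pow_le_pow_left₀ (by positivity) (by have : (0 : ℝ) ≤ n := n.cast_nonneg
                                           linarith) 5
    push_cast
    rw [mul_pow] at h1
    rw [pow_succ 25]
    have : (0 : ℝ) ≤ ((n : ℝ) + 2) ^ 5 := by positivity
    norm_num at h1
    linarith

variable {β : ℕ}

/-- The constant `13 / 8` is attained at `β = 2`. -/
lemma kernelBound_le (hβ : 2 ≤ β) : kernelBound β ≤ 13 / 8 * (β : ℝ) ^ 3 := by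
  have h : (2 : ℝ) ≤ β := by exact_mod_cast hβ
  rw [kernelBound]
  nlinarith [mul_nonneg (by positivity : (0 : ℝ) ≤ β)
    (mul_nonneg (by linarith : (0 : ℝ) ≤ β - 2) (by linarith : (0 : ℝ) ≤ 23 / 4 * β + 5 / 2))]

lemma one_le_kernelBound (hβ : 2 ≤ β) : 1 ≤ kernelBound β := by
  have h : (2 : ℝ) ≤ β := by exact_mod_cast hβ
  rw [kernelBound]
  nlinarith [mul_nonneg (by positivity : (0 : ℝ) ≤ β) (by positivity : (0 : ℝ) ≤ β)]

/-- The constant in the variance term. -/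
lemma variance_constant_le (hβ : 2 ≤ β) :
    4 * kernelBound β / ((β : ℝ) / (5 * Real.exp 1)) ^ 2 ≤ 192 * Real.exp 1 ^ 2 * β := by
  have h := kernelBound_le hβ
  have hb : (0 : ℝ) < β := by exact_mod_cast (show 0 < β by omega)
  have he := Real.exp_pos 1
  rw [div_pow, div_div_eq_mul_div, div_le_iff₀ (by positivity)]
  calc 4 * kernelBound β * (5 * Real.exp 1) ^ 2 ≤ 4 * (13 / 8 * (β : ℝ) ^ 3) * (5 * Real.exp 1) ^ 2
        := by gcongr
    _ = 162.5 * (Real.exp 1 ^ 2 * β ^ 3) := by ring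
    _ ≤ 192 * (Real.exp 1 ^ 2 * β ^ 3) := by gcongr; norm_num
    _ = _ := by ring

/-- The constant in the bias term. -/
lemma bias_constant_le (hβ : 2 ≤ β) :
    (((β : ℝ) / (5 * Real.exp 1)) ^ 2) ^ (β - 1) / ((β - 1).factorial : ℝ) ^ 2 *
      (4 * kernelBound β + 3 * Real.sqrt (kernelBound β)) ^ 2 ≤ 64 * Real.exp 1 ^ 2 * β := by
  have hk := kernelBound_le hβ
  have h1 := one_le_kernelBound hβ
  have hs : Real.sqrt (kernelBound β) ≤ kernelBound β := by
    rw [Real.sqrt_le_left (by linarith)]; nlinarith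
  have he := Real.exp_pos 1
  have he7 : 7 ≤ Real.exp 1 ^ 2 := by nlinarith [Real.exp_one_gt_d9]
  obtain ⟨n, rfl⟩ : ∃ n, β = n + 2 := ⟨β - 2, by omega⟩
  rw [show n + 2 - 1 = n + 1 by omega]
  set b : ℝ := ((n + 2 : ℕ) : ℝ) with hb
  have hbn : b = n + 2 := by rw [hb]; push_cast; ring
  have hb0 : 0 < b := by rw [hbn]; positivity
  have hf : (0 : ℝ) < ((n + 1).factorial : ℝ) := by exact_mod_cast (n + 1).factorial_pos
  have h2 : b ^ (n + 1) ≤ Real.exp 1 ^ (n + 1) * (n + 1).factorial := by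
    have := pow_le_exp_mul_factorial (n + 1)
    push_cast at this
    rw [hbn]
    convert this using 2
    ring
  -- The factorial cancels `(b / e)^(n + 1)`. The `5` in the radius leaves `25^(-(n + 1))`, enough
  -- to beat the polynomial growth of the kernel constants.
  have h3 : ((b / (5 * Real.exp 1)) ^ 2) ^ (n + 1) / ((n + 1).factorial : ℝ) ^ 2 ≤
      1 / 25 ^ (n + 1) := by
    have h4 : ((b / (5 * Real.exp 1)) ^ 2) ^ (n + 1) / ((n + 1).factorial : ℝ) ^ 2 =
        (b ^ (n + 1) / (Real.exp 1 ^ (n + 1) * (n + 1).factorial)) ^ 2 * (1 / 25 ^ (n + 1)) := by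
      rw [← pow_mul, mul_comm 2, pow_mul, div_pow, mul_pow, show (25 : ℝ) = 5 ^ 2 by norm_num,
        ← pow_mul 5, mul_comm 2, pow_mul 5]
      field_simp
    rw [h4]
    refine mul_le_of_le_one_left (by positivity) ?_
    refine pow_le_one₀ (by positivity) ?_
    rw [div_le_one (by positivity)]
    exact h2
  have h5 : (4 * kernelBound (n + 2) + 3 * Real.sqrt (kernelBound (n + 2))) ^ 2 ≤
      (12 * b ^ 3) ^ 2 := by
    refine pow_le_pow_left₀ (by positivity) ?_ 2
    have : 0 < b ^ 3 := by positivity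
    linarith
  have h6 := pow_five_le n
  rw [← hbn] at h6
  -- `448 = 64 * 7` and `7 ≤ e²`, which produces the target `64 e² b`.
  calc _ ≤ 1 / 25 ^ (n + 1) * (12 * b ^ 3) ^ 2 := by gcongr
    _ = (144 * b ^ 5) * b / 25 ^ (n + 1) := by ring
    _ ≤ (448 * 25 ^ (n + 1)) * b / 25 ^ (n + 1) := by gcongr
    _ = 64 * 7 * b := by field_simp; norm_num
    _ ≤ 64 * Real.exp 1 ^ 2 * b := by gcongr

end Numerics

/-! ### Tuning the radius in the constrained case -/

/-- The smoothing radius of the one-point algorithm. -/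
noncomputable def onePointRadius (d β : ℕ) (M : ℝ) (N : ℕ) : ℝ :=
  β / (5 * Real.exp 1) / M * ((d : ℝ) ^ 2 / (N + 1)) ^ (1 / (2 * (β : ℝ)))

section Radius

variable {d β : ℕ} {M : ℝ}

lemma onePointRadius_pos (hd : 1 ≤ d) (hβ : 2 ≤ β) (hM : 0 < M) (N : ℕ) :
    0 < onePointRadius d β M N := by
  have hb : (0 : ℝ) < β := by exact_mod_cast (show 0 < β by omega)
  have hd' : (0 : ℝ) < d := by exact_mod_cast hd
  rw [onePointRadius]
  positivity

lemma tendsto_onePointRadius (hβ : 2 ≤ β) :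
    Tendsto (onePointRadius d β M) atTop (𝓝 0) := by
  have hb : (0 : ℝ) < β := by exact_mod_cast (show 0 < β by omega)
  have h1 : Tendsto (fun N : ℕ => (d : ℝ) ^ 2 / ((N : ℝ) + 1)) atTop (𝓝 0) :=
    tendsto_const_nhds.div_atTop
      (tendsto_atTop_add_const_right _ _ tendsto_natCast_atTop_atTop)
  have h2 := (h1.rpow_const (p := 1 / (2 * (β : ℝ))) (Or.inr (by positivity))).const_mul
    (β / (5 * Real.exp 1) / M)
  rw [Real.zero_rpow (by positivity), mul_zero] at h2
  exact h2

lemma onePointRadius_sq (hβ : 2 ≤ β) (N : ℕ) :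
    onePointRadius d β M N ^ 2 =
      (β / (5 * Real.exp 1)) ^ 2 / M ^ 2 * ((d : ℝ) ^ 2 / (N + 1)) ^ (1 / (β : ℝ)) := by
  have hb : (0 : ℝ) < β := by exact_mod_cast (show 0 < β by omega)
  rw [onePointRadius, mul_pow, div_pow, ← Real.rpow_natCast (_ ^ (1 / (2 * (β : ℝ)))) 2,
    ← Real.rpow_mul (by positivity)]
  congr 2
  push_cast
  field_simp

lemma biasBound_sq_eq (hβ : 2 ≤ β) {δ : ℝ} (hδ : 0 < δ) : biasBound β M δ ^ 2 =
    (M ^ 2) ^ β * (δ ^ 2) ^ (β - 1) / ((β - 1).factorial : ℝ) ^ 2 *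
      (4 * kernelBound β + 3 * Real.sqrt (kernelBound β)) ^ 2 := by
  obtain ⟨n, rfl⟩ : ∃ n, β = n + 1 := ⟨β - 1, by omega⟩
  rw [biasBound, taylorErr, abs_of_pos hδ, Nat.add_sub_cancel, pow_succ δ]
  field_simp
  ring

lemma biasBound_onePointRadius_sq_le (hd : 1 ≤ d) (hβ : 2 ≤ β) (hM : 0 < M) (N : ℕ) :
    biasBound β M (onePointRadius d β M N) ^ 2 ≤
      64 * Real.exp 1 ^ 2 * β * M ^ 2 * ((d : ℝ) ^ 2 / (N + 1)) ^ (((β : ℝ) - 1) / β) := by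
  have hb : (0 : ℝ) < β := by exact_mod_cast (show 0 < β by omega)
  have h := bias_constant_le hβ
  have hT : (((d : ℝ) ^ 2 / (N + 1)) ^ (1 / (β : ℝ))) ^ (β - 1) =
      ((d : ℝ) ^ 2 / (N + 1)) ^ (((β : ℝ) - 1) / β) := by
    rw [← Real.rpow_natCast, ← Real.rpow_mul (by positivity), Nat.cast_sub (by omega)]
    congr 1
    push_cast
    field_simp
  rw [biasBound_sq_eq hβ (onePointRadius_pos hd hβ hM N), onePointRadius_sq hβ, mul_pow, hT, div_pow]
  set T := ((d : ℝ) ^ 2 / (N + 1)) ^ (((β : ℝ) - 1) / β)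
  have hT0 : 0 ≤ T := by positivity
  have hM2 : (M ^ 2) ^ β = M ^ 2 * (M ^ 2) ^ (β - 1) := by
    rw [← pow_succ']; congr 1; omega
  calc _ = ((β / (5 * Real.exp 1)) ^ 2) ^ (β - 1) / ((β - 1).factorial : ℝ) ^ 2 *
      (4 * kernelBound β + 3 * Real.sqrt (kernelBound β)) ^ 2 * (M ^ 2 * T) := by
        rw [hM2]
        field_simp
    _ ≤ 64 * Real.exp 1 ^ 2 * β * (M ^ 2 * T) := by gcongr
    _ = _ := by ring

lemma variance_onePointRadius_le (hd : 1 ≤ d) (hβ : 2 ≤ β) (hM : 0 < M) (N : ℕ) :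
    4 * kernelBound β * (d / onePointRadius d β M N) ^ 2 / (N + 1) ≤
      192 * Real.exp 1 ^ 2 * β * M ^ 2 * ((d : ℝ) ^ 2 / (N + 1)) ^ (((β : ℝ) - 1) / β) := by
  have hb : (0 : ℝ) < β := by exact_mod_cast (show 0 < β by omega)
  have hd' : (0 : ℝ) < d := by exact_mod_cast hd
  have h := variance_constant_le hβ
  set τ := (d : ℝ) ^ 2 / (N + 1) with hτ
  have hτ0 : 0 < τ := by positivity
  have hT : τ ^ (((β : ℝ) - 1) / β) = τ / τ ^ (1 / (β : ℝ)) := by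
    rw [sub_div, div_self hb.ne', Real.rpow_sub hτ0, Real.rpow_one]
  have hT0 : 0 < τ ^ (1 / (β : ℝ)) := by positivity
  rw [div_pow, onePointRadius_sq hβ, ← hτ, hT]
  calc _ = 4 * kernelBound β / (β / (5 * Real.exp 1)) ^ 2 * (M ^ 2 * (τ / τ ^ (1 / (β : ℝ)))) := by
        generalize τ ^ (1 / (β : ℝ)) = q at *
        rw [hτ]
        field_simp
    _ ≤ 192 * Real.exp 1 ^ 2 * β * (M ^ 2 * (τ / τ ^ (1 / (β : ℝ)))) := by gcongr
    _ = _ := by ring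

end Radius

section Constrained

lemma exists_onePoint_parameters (d β : ℕ) (hd : 1 ≤ d) (hβ : 2 ≤ β) (μ Mβ : ℝ) (hμ : 0 < μ)
    (hMβ : 0 < Mβ) :
    ∃ (γ : ℕ → ℕ → ℝ) (δ : ℕ → ℝ), (∀ N n, 0 < γ N n) ∧ (∀ N, 0 < δ N) ∧
        Tendsto δ atTop (𝓝 0) ∧
        ∀ (σ : ℝ) (K : Set (EuclideanSpace ℝ (Fin d))) (f : EuclideanSpace ℝ (Fin d) → ℝ),
          0 ≤ σ → IsCompact K → Convex ℝ K →
          SmoothOrderOn Set.univ β Mβ f → StrongConvexOn Set.univ μ f →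
        ∃ N₀ : ℕ, ∀ N ≥ N₀, ∀ (C : ℝ) (xs x₀ : EuclideanSpace ℝ (Fin d)),
          (∀ y ∈ Metric.cthickening (δ N) K, |f y| ≤ C) →
          xs ∈ K → IsMinOn f K xs → x₀ ∈ K →
        ∀ {Ω : Type*} {mΩ : MeasurableSpace Ω} (P : Measure Ω) [IsProbabilityMeasure P]
          (ℱ : Filtration ℕ mΩ) (r : ℕ → Ω → ℝ) (u : ℕ → Ω → EuclideanSpace ℝ (Fin d))
          (ε : ℕ → Ω → ℝ),
          IsSampling P ℱ r u → IsNoise P ℱ r u σ ε →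
        ∀ X : Ω → EuclideanSpace ℝ (Fin d),
          (∀ ω, X ω = onePoint K f (kernelFun β) (γ N) (fun _ => δ N) x₀ (fun n => r n ω)
            (fun n => u n ω) (fun n => ε n ω) N) →
          Integrable (fun ω => ‖X ω - xs‖ ^ 2) P ∧
          ∫ ω, ‖X ω - xs‖ ^ 2 ∂P ≤
            16 * (β : ℝ) * ((d : ℝ) ^ 2 / N) ^ (((β : ℝ) - 1) / β) *
              (2 * Real.exp 1 * Mβ / μ) ^ 2 * (3 * C ^ 2 + 3 * σ ^ 2 + 1) ∧
          (∀ M₂ : ℝ, 0 ≤ M₂ → SmoothOrderOn K 2 M₂ f → IsMinOn f Set.univ xs →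
            Integrable (fun ω => f (X ω)) P ∧
            ∫ ω, f (X ω) ∂P - f xs ≤ M₂ ^ 2 / 2 * ∫ ω, ‖X ω - xs‖ ^ 2 ∂P ∧
            ∫ ω, f (X ω) ∂P - f xs ≤
              16 * (β : ℝ) * ((d : ℝ) ^ 2 / N) ^ (((β : ℝ) - 1) / β) *
                (2 * Real.exp 1 * Mβ * M₂ / μ) ^ 2 * (3 * C ^ 2 + 3 * σ ^ 2 + 1)) := by
  refine ⟨fun _ n => 2 / (μ * (n + 1)), onePointRadius d β Mβ, fun _ n => by positivity,
    onePointRadius_pos hd hβ hMβ, tendsto_onePointRadius hβ, ?_⟩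
  intro σ K f hσ hK hc hf hfc
  -- The bound is non-asymptotic: `N ≥ 1` suffices.
  refine ⟨1, fun N hN C xs x₀ hC hxs hmin hx₀ Ω mΩ P _ ℱ r u ε hs hε X hX => ?_⟩
  have hb : (2 : ℝ) ≤ β := by exact_mod_cast hβ
  have hN0 : (0 : ℝ) < N := by exact_mod_cast hN
  set x : ℕ → Ω → EuclideanSpace ℝ (Fin d) := fun n ω =>
    onePoint K f (kernelFun β) (fun n => 2 / (μ * (n + 1))) (fun _ => onePointRadius d β Mβ N) x₀
      (fun n => r n ω) (fun n => u n ω) (fun n => ε n ω) n with hx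
  have hXx : X = x N := funext hX
  have hδ := onePointRadius_pos hd hβ hMβ N
  obtain ⟨hi, hbd⟩ := onePoint_bound hs hε hd hβ hf hfc hμ hK hc hδ (fun _ => rfl) hC hxs hmin hx₀
    (x := x) (fun _ _ => rfl) hN
  rw [← hXx] at hi hbd
  set T := ((d : ℝ) ^ 2 / N) ^ (((β : ℝ) - 1) / β) with hT
  have hT0 : 0 ≤ T := by positivity
  have hTT : ((d : ℝ) ^ 2 / (N + 1)) ^ (((β : ℝ) - 1) / β) ≤ T := by
    refine Real.rpow_le_rpow (by positivity) ?_ (div_nonneg (by linarith) (by positivity))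
    gcongr
    linarith
  have hbias := biasBound_onePointRadius_sq_le hd hβ hMβ N
  have hvar := variance_onePointRadius_le hd hβ hMβ N
  have hmain : ∫ ω, ‖X ω - xs‖ ^ 2 ∂P ≤ 16 * (β : ℝ) * T *
      (2 * Real.exp 1 * Mβ / μ) ^ 2 * (3 * C ^ 2 + 3 * σ ^ 2 + 1) := by
    calc _ ≤ _ := hbd
      _ = biasBound β Mβ (onePointRadius d β Mβ N) ^ 2 / μ ^ 2 +
          4 * kernelBound β * (d / onePointRadius d β Mβ N) ^ 2 / (N + 1) *
            (C ^ 2 + σ ^ 2) / μ ^ 2 := by field_simp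
      _ ≤ 64 * Real.exp 1 ^ 2 * β * Mβ ^ 2 * T / μ ^ 2 +
          192 * Real.exp 1 ^ 2 * β * Mβ ^ 2 * T * (C ^ 2 + σ ^ 2) / μ ^ 2 := by
        have h1 := hbias.trans (mul_le_mul_of_nonneg_left hTT (by positivity))
        have h2 := hvar.trans (mul_le_mul_of_nonneg_left hTT (by positivity))
        gcongr
      -- `16 * (2e)² = 64 e²` matches the bias constant, and `3 * 64 = 192` the variance constant.
      _ = _ := by field_simp; ring
  refine ⟨hi, hmain, fun M₂ hM₂ hf2 hmin' => ?_⟩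
  have hXm : Measurable X := by
    rw [hXx]
    exact (measurable_onePoint hs hε (hf.contDiff_one hβ).continuous hK hc hx₀ _ N).mono (ℱ.le N)
      le_rfl
  obtain ⟨h1, h2⟩ := hf2.integral_sub_le hc hxs hmin' hXm
    (fun ω => by rw [hXx]; exact onePoint_mem hK hx₀ _ N ω) hi
  refine ⟨h1, h2, h2.trans ?_⟩
  have h3 : 0 ≤ ∫ ω, ‖X ω - xs‖ ^ 2 ∂P := integral_nonneg fun ω => sq_nonneg _
  calc M₂ ^ 2 / 2 * ∫ ω, ‖X ω - xs‖ ^ 2 ∂P ≤ M₂ ^ 2 * ∫ ω, ‖X ω - xs‖ ^ 2 ∂P := by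
        gcongr; linarith [sq_nonneg M₂]
    _ ≤ M₂ ^ 2 * _ := mul_le_mul_of_nonneg_left hmain (sq_nonneg _)
    _ = _ := by ring

end Constrained

/-! ### The unconstrained case -/

section TwoPoint

variable {d β : ℕ} {M M₂ : ℝ} {f : EuclideanSpace ℝ (Fin d) → ℝ}

/-- The two-point signal is the average of the one-point signals with radii `δ` and `-δ`, and the
bias bound is even in `δ`. -/
lemma abs_integral_twoPoint_sub_le (hd : 1 ≤ d) (hβ : 2 ≤ β) (hf : SmoothOrderOn Set.univ β M f)
    (x w : EuclideanSpace ℝ (Fin d)) {δ : ℝ} (hδ : δ ≠ 0) :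
    |∫ z, d / (2 * δ) * (f (x + (δ * z.1) • z.2) - f (x - (δ * z.1) • z.2)) * kernelFun β z.1 *
      inner ℝ z.2 w ∂(unifInterval.prod (unifSphere d)) - fderiv ℝ f x w| ≤
      biasBound β M δ * ‖w‖ := by
  have h1 := abs_integral_onePoint_sub_le hd hβ hf x w hδ
  have h2 := abs_integral_onePoint_sub_le hd hβ hf x w (neg_ne_zero.2 hδ)
  have hb : biasBound β M (-δ) = biasBound β M δ := by simp [biasBound, taylorErr]
  rw [hb] at h2
  have hk := continuous_kernelFun β
  have hfc := (hf.contDiff_one hβ).continuous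
  have h3 : ∫ z, d / (2 * δ) * (f (x + (δ * z.1) • z.2) - f (x - (δ * z.1) • z.2)) *
      kernelFun β z.1 * inner ℝ z.2 w ∂(unifInterval.prod (unifSphere d)) =
      (∫ z, d / δ * f (x + (δ * z.1) • z.2) * kernelFun β z.1 * inner ℝ z.2 w
        ∂(unifInterval.prod (unifSphere d)) +
      ∫ z, d / -δ * f (x + (-δ * z.1) • z.2) * kernelFun β z.1 * inner ℝ z.2 w
        ∂(unifInterval.prod (unifSphere d))) / 2 := by
    rw [← integral_add (integrable_query hd (by fun_prop)) (integrable_query hd (by fun_prop)),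
      ← integral_div]
    congr 1; ext z
    rw [neg_mul, neg_smul, ← sub_eq_add_neg]
    field_simp
    ring
  rw [h3]
  rw [abs_le] at *
  constructor <;> linarith [h1.1, h1.2, h2.1, h2.2]

/-- The value `f x` cancels in the difference. What remains is `2 Df(x) h`, controlled by the
distance to `xs` because the gradient vanishes there, plus a second-order remainder; then `(a + b)²
≤ 2a² + 2b²`. -/
lemma SmoothOrderOn.sq_symm_difference_le (hf : SmoothOrderOn Set.univ 2 M₂ f)
    {xs : EuclideanSpace ℝ (Fin d)} (hmin : IsMinOn f Set.univ xs) {δ : ℝ}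
    (x h : EuclideanSpace ℝ (Fin d)) (hh : ‖h‖ ≤ δ) :
    (f (x + h) - f (x - h)) ^ 2 ≤ 8 * M₂ ^ 4 * δ ^ 2 * ‖x - xs‖ ^ 2 + 2 * M₂ ^ 4 * δ ^ 4 := by
  have h1 := hf.abs_sub_sub_fderiv_le convex_univ (Set.mem_univ x) (Set.mem_univ (x + h))
  have h2 := hf.abs_sub_sub_fderiv_le convex_univ (Set.mem_univ x) (Set.mem_univ (x - h))
  have h3 := hf.abs_fderiv_sub_le (Set.mem_univ x) (Set.mem_univ xs) h
  rw [IsLocalMin.fderiv_eq_zero (hmin.isLocalMin univ_mem), zero_apply, sub_zero] at h3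
  rw [add_sub_cancel_left] at h1
  rw [sub_sub_cancel_left, map_neg, norm_neg] at h2
  have h4 : M₂ ^ 2 / 2 * ‖h‖ ^ 2 ≤ M₂ ^ 2 / 2 * δ ^ 2 := by gcongr
  have h5 : M₂ ^ 2 * ‖x - xs‖ * ‖h‖ ≤ M₂ ^ 2 * ‖x - xs‖ * δ := by gcongr
  have h6 : |f (x + h) - f (x - h)| ≤ 2 * (M₂ ^ 2 * ‖x - xs‖ * δ) + M₂ ^ 2 * δ ^ 2 := by
    rw [abs_le] at *
    constructor <;> linarith [h1.1, h1.2, h2.1, h2.2, h3.1, h3.2]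
  have h7 := pow_le_pow_left₀ (abs_nonneg _) h6 2
  rw [sq_abs] at h7
  refine h7.trans ?_
  nlinarith [sq_nonneg (2 * (M₂ ^ 2 * ‖x - xs‖ * δ) - M₂ ^ 2 * δ ^ 2)]

variable {Ω : Type*} {mΩ : MeasurableSpace Ω} {P : Measure Ω}
  {ℱ : Filtration ℕ mΩ} {r : ℕ → Ω → ℝ} {u : ℕ → Ω → EuclideanSpace ℝ (Fin d)}
  {εp εm : ℕ → Ω → ℝ} {γ : ℕ → ℝ} {δ μ σ : ℝ} {x₀ xs : EuclideanSpace ℝ (Fin d)}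

lemma measurable_twoPoint (hs : IsSampling P ℱ r u) (hp : IsNoise P ℱ r u σ εp)
    (hm : IsNoise P ℱ r u σ εm) (hf : Continuous f) (δ : ℕ → ℝ) (n : ℕ) :
    Measurable[ℱ n] fun ω => twoPoint f (kernelFun β) γ δ x₀ (fun n => r n ω) (fun n => u n ω)
      (fun n => εp n ω) (fun n => εm n ω) n := by
  induction n with
  | zero => exact measurable_const
  | succ n ih =>
    have hx := ih.mono (ℱ.mono n.le_succ) le_rfl
    have hr := hs.measurable_r n
    have hu := hs.measurable_u n
    have hep := hp.measurable n
    have hem := hm.measurable n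
    have hk := (continuous_kernelFun β).measurable
    have hfm := hf.measurable
    simp only [twoPoint]
    have hh := (hr.const_mul (δ (n + 1))).fun_smul hu
    refine hx.sub (Measurable.fun_smul ?_ hu)
    exact Measurable.mul (Measurable.mul measurable_const
      (((hfm.comp (hx.add hh)).add hep).sub ((hfm.comp (hx.sub hh)).add hem))) (hk.comp hr)

/-- The two noises may be correlated, hence `(a - b)² ≤ 2a² + 2b²` and the factor `4` instead of
`2`. -/
lemma condExp_sub_sq_le (hp : IsNoise P ℱ r u σ εp) (hm : IsNoise P ℱ r u σ εm) (n : ℕ) :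
    ∀ᵐ ω ∂P, (P[fun ω => (εp (n + 1) ω - εm (n + 1) ω) ^ 2 | (ℱ n : MeasurableSpace Ω) ⊔
      MeasurableSpace.comap (fun ω => (r (n + 1) ω, u (n + 1) ω)) inferInstance]) ω
        ≤ 4 * σ ^ 2 := by
  have ip := (hp.memLp n).integrable_sq
  have im := (hm.memLp n).integrable_sq
  set G : MeasurableSpace Ω := (ℱ n : MeasurableSpace Ω) ⊔
      MeasurableSpace.comap (fun ω => (r (n + 1) ω, u (n + 1) ω)) inferInstance
  have h1 := condExp_mono (m := G) ((hp.memLp n).sub (hm.memLp n)).integrable_sq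
    ((ip.add im).smul (2 : ℝ)) (.of_forall fun ω => by
      simp only [Pi.sub_apply, Pi.smul_apply, Pi.add_apply, smul_eq_mul]
      nlinarith [sq_nonneg (εp (n + 1) ω + εm (n + 1) ω)])
  have h2 := condExp_smul (μ := P) (2 : ℝ) ((fun ω => εp (n + 1) ω ^ 2) +
    fun ω => εm (n + 1) ω ^ 2) G
  have h3 := condExp_add ip im G
  filter_upwards [h1, h2, h3, hp.variance n, hm.variance n] with ω a1 a2 a3 a4 a5
  refine a1.trans ?_
  rw [a2, Pi.smul_apply, a3, Pi.add_apply, smul_eq_mul]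
  linarith

variable [IsProbabilityMeasure P]

lemma condExp_sub_eq_zero (hp : IsNoise P ℱ r u σ εp) (hm : IsNoise P ℱ r u σ εm) (n : ℕ) :
    P[fun ω => εp (n + 1) ω - εm (n + 1) ω | (ℱ n : MeasurableSpace Ω) ⊔
      MeasurableSpace.comap (fun ω => (r (n + 1) ω, u (n + 1) ω)) inferInstance] =ᵐ[P] 0 := by
  have h := condExp_sub ((hp.memLp n).integrable (by norm_num))
    ((hm.memLp n).integrable (by norm_num)) ((ℱ n : MeasurableSpace Ω) ⊔
      MeasurableSpace.comap (fun ω => (r (n + 1) ω, u (n + 1) ω)) inferInstance)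
  refine h.trans ?_
  filter_upwards [hp.centred n, hm.centred n] with ω h1 h2
  simp [h1, h2]

lemma twoPoint_step (hs : IsSampling P ℱ r u) (hp : IsNoise P ℱ r u σ εp)
    (hm : IsNoise P ℱ r u σ εm) (hd : 1 ≤ d) (hβ : 2 ≤ β) (hf : SmoothOrderOn Set.univ β M f)
    (hf2 : SmoothOrderOn Set.univ 2 M₂ f) (hfc : StrongConvexOn Set.univ μ f)
    (hμ : 0 < μ) (hδ : 0 < δ) (hγ : ∀ n, 0 < γ n) (hmin : IsMinOn f Set.univ xs)
    {x : ℕ → Ω → EuclideanSpace ℝ (Fin d)}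
    (hx : ∀ n ω, x n ω = twoPoint f (kernelFun β) γ (fun _ => δ) x₀ (fun n => r n ω)
      (fun n => u n ω) (fun n => εp n ω) (fun n => εm n ω) n) (n : ℕ)
    (hi : Integrable (fun ω => ‖x n ω - xs‖ ^ 2) P) :
    Integrable (fun ω => ‖x (n + 1) ω - xs‖ ^ 2) P ∧
    ∫ ω, ‖x (n + 1) ω - xs‖ ^ 2 ∂P ≤ (1 - γ (n + 1) * μ) * ∫ ω, ‖x n ω - xs‖ ^ 2 ∂P +
      γ (n + 1) * biasBound β M δ ^ 2 / μ +
      γ (n + 1) ^ 2 * kernelBound β * (d ^ 2 * M₂ ^ 4 * δ ^ 2 / 2 +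
        2 * d ^ 2 * M₂ ^ 4 * ∫ ω, ‖x n ω - xs‖ ^ 2 ∂P + d ^ 2 * σ ^ 2 / δ ^ 2) := by
  have hf1 := hf.contDiff_one hβ
  have hmeas : ∀ n, Measurable[ℱ n] (x n) := fun n => by
    rw [funext (hx n)]
    exact measurable_twoPoint hs hp hm hf1.continuous _ n
  have hk := (continuous_kernelFun β).measurable
  have hfm := hf1.continuous.measurable
  set F : EuclideanSpace ℝ (Fin d) × (ℝ × EuclideanSpace ℝ (Fin d)) → ℝ := fun c =>
    d / (2 * δ) * (f (c.1 + (δ * c.2.1) • c.2.2) - f (c.1 - (δ * c.2.1) • c.2.2)) *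
      kernelFun β c.2.1 with hF
  have hstep := hs.step hd n (hmeas n) hi (fun _ => Set.mem_univ _) (F := F)
    (by rw [hF]; fun_prop)
    (f := f) (ζ := biasBound β M δ) (A₀ := d ^ 2 * M₂ ^ 4 * δ ^ 2 / 2)
    (A₁ := 2 * d ^ 2 * M₂ ^ 4) (μ := μ) (q := d / (2 * δ))
    (s := 4 * σ ^ 2) (γ := γ (n + 1)) (β := β) hμ (hγ _) (by positivity) (by positivity)
    (fun y _ w => abs_integral_twoPoint_sub_le hd hβ hf y w hδ.ne')
    (fun y hy t v ht hv => by
      have h1 := hf2.sq_symm_difference_le hmin (δ := δ) y ((δ * t) • v) (by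
        rw [norm_smul, hv, mul_one, Real.norm_eq_abs, abs_mul, abs_of_pos hδ]
        exact mul_le_of_le_one_right hδ.le ht)
      simp only [hF]
      calc (d / (2 * δ) * (f (y + (δ * t) • v) - f (y - (δ * t) • v)) * kernelFun β t) ^ 2
          = kernelFun β t ^ 2 *
            ((d / (2 * δ)) ^ 2 * (f (y + (δ * t) • v) - f (y - (δ * t) • v)) ^ 2) := by ring
        _ ≤ kernelFun β t ^ 2 * ((d / (2 * δ)) ^ 2 *
            (8 * M₂ ^ 4 * δ ^ 2 * ‖y - xs‖ ^ 2 + 2 * M₂ ^ 4 * δ ^ 4)) := by gcongr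
        _ = _ := by field_simp; ring)
    (fun y hy => hfc.mul_sq_le_fderiv (hf1.differentiable (by norm_num)) convex_univ
      (Set.mem_univ xs) hmin hy)
    (η := fun ω => εp (n + 1) ω - εm (n + 1) ω)
    ((hp.memLp n).sub (hm.memLp n)) (condExp_sub_eq_zero hp hm n) (condExp_sub_sq_le hp hm n)
    (by positivity) (y := x (n + 1)) (fun ω => by
      rw [hx, twoPoint, ← hx]
      simp only [hF]
      congr 2
      ring)
  refine ⟨hstep.1, hstep.2.trans (le_of_eq ?_)⟩
  field_simp
  ring

/-- The offset in the step sizes of the two-point algorithm. -/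
noncomputable def twoPointOffset (d β : ℕ) (μ M₂ : ℝ) : ℝ :=
  1 + 16 * kernelBound β * d ^ 2 * M₂ ^ 4 / μ ^ 2

lemma one_le_twoPointOffset : 1 ≤ twoPointOffset d β μ M₂ := by
  have := kernelBound_nonneg β
  rw [twoPointOffset]
  have : 0 ≤ 16 * kernelBound β * d ^ 2 * M₂ ^ 4 / μ ^ 2 := by positivity
  linarith

/-- The error of the two-point algorithm with the step sizes `4 / (μ (n + n₀))`. -/
lemma twoPoint_bound (hs : IsSampling P ℱ r u) (hp : IsNoise P ℱ r u σ εp)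
    (hm : IsNoise P ℱ r u σ εm) (hd : 1 ≤ d) (hβ : 2 ≤ β) (hf : SmoothOrderOn Set.univ β M f)
    (hf2 : SmoothOrderOn Set.univ 2 M₂ f) (hfc : StrongConvexOn Set.univ μ f)
    (hμ : 0 < μ) (hδ : 0 < δ) (hγ : ∀ n, γ n = 4 / (μ * (n + twoPointOffset d β μ M₂)))
    (hmin : IsMinOn f Set.univ xs)
    {x : ℕ → Ω → EuclideanSpace ℝ (Fin d)}
    (hx : ∀ n ω, x n ω = twoPoint f (kernelFun β) γ (fun _ => δ) x₀ (fun n => r n ω)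
      (fun n => u n ω) (fun n => εp n ω) (fun n => εm n ω) n) {N : ℕ} (hN : 1 ≤ N) :
    Integrable (fun ω => ‖x N ω - xs‖ ^ 2) P ∧
    ∫ ω, ‖x N ω - xs‖ ^ 2 ∂P ≤ twoPointOffset d β μ M₂ ^ 2 * ‖x₀ - xs‖ ^ 2 / N ^ 2 +
      2 * biasBound β M δ ^ 2 / μ ^ 2 + 16 * (kernelBound β *
        (d ^ 2 * M₂ ^ 4 * δ ^ 2 / 2 + d ^ 2 * σ ^ 2 / δ ^ 2)) / (μ ^ 2 * N) := by
  have hn₀ := one_le_twoPointOffset (d := d) (β := β) (μ := μ) (M₂ := M₂)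
  have hκ := kernelBound_nonneg β
  have hn₀def : twoPointOffset d β μ M₂ - 1 = 16 * kernelBound β * d ^ 2 * M₂ ^ 4 / μ ^ 2 := by
    rw [twoPointOffset]; ring
  set n₀ := twoPointOffset d β μ M₂
  have hγ0 : ∀ n, 0 < γ n := fun n => by rw [hγ]; positivity
  have hstep := twoPoint_step hs hp hm hd hβ hf hf2 hfc hμ hδ hγ0 hmin hx
  have hi : ∀ n, Integrable (fun ω => ‖x n ω - xs‖ ^ 2) P := by
    intro n
    induction n with
    | zero => simp [hx, twoPoint]
    | succ n ih => exact (hstep n ih).1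
  refine ⟨hi N, ?_⟩
  set W := kernelBound β * (d ^ 2 * M₂ ^ 4 * δ ^ 2 / 2 + d ^ 2 * σ ^ 2 / δ ^ 2) with hW
  have hW0 : 0 ≤ W := by positivity
  set ζ := biasBound β M δ with hζ
  have hrec := recursion_bound (a := fun n => ∫ ω, ‖x n ω - xs‖ ^ 2 ∂P) (n₀ := n₀)
    (p := 4 * ζ ^ 2 / μ ^ 2) (q := 16 * W / μ ^ 2) hn₀ (by positivity) (fun n => by
      refine (hstep n (hi n)).2.trans ?_
      have ha : 0 ≤ ∫ ω, ‖x n ω - xs‖ ^ 2 ∂P := integral_nonneg fun ω => sq_nonneg _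
      set a := ∫ ω, ‖x n ω - xs‖ ^ 2 ∂P
      set m : ℝ := n + 1 + n₀ with hmdef
      have hm1 : n₀ - 1 ≤ m := by have : (0 : ℝ) ≤ n := n.cast_nonneg
                                  linarith
      have hm0 : 0 < m := by positivity
      have hγm : γ (n + 1) = 4 / (μ * m) := by rw [hγ]; push_cast; rfl
      -- The offset is designed for this: the growing part of the variance equals `2 (n₀ - 1) / m² *
      -- a`. It uses half of the contraction `4 / m` and leaves the `2 / m` that the recursion
      -- needs.
      have hkey : γ (n + 1) ^ 2 * kernelBound β * (2 * d ^ 2 * M₂ ^ 4 * a) ≤ 2 / m * a := by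
        have : γ (n + 1) ^ 2 * kernelBound β * (2 * d ^ 2 * M₂ ^ 4 * a) =
            2 / m * a * ((n₀ - 1) / m) := by
          rw [hγm, hn₀def]; field_simp; ring
        rw [this]
        exact mul_le_of_le_one_right (by positivity) ((div_le_one hm0).2 hm1)
      have e1 : γ (n + 1) * μ = 4 / m := by rw [hγm]; field_simp
      have e2 : γ (n + 1) * ζ ^ 2 / μ = 4 * ζ ^ 2 / μ ^ 2 / m := by rw [hγm]; field_simp
      have e3 : γ (n + 1) ^ 2 * W = 16 * W / μ ^ 2 / m ^ 2 := by rw [hγm]; field_simp; ring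
      have e4 : γ (n + 1) ^ 2 * kernelBound β * (d ^ 2 * M₂ ^ 4 * δ ^ 2 / 2 +
        2 * d ^ 2 * M₂ ^ 4 * a + d ^ 2 * σ ^ 2 / δ ^ 2) = γ (n + 1) ^ 2 * W +
          γ (n + 1) ^ 2 * kernelBound β * (2 * d ^ 2 * M₂ ^ 4 * a) := by rw [hW]; ring
      rw [e4, e1, e2, e3]
      have e5 : (4 : ℝ) / m = 2 / m + 2 / m := by ring
      rw [e5]
      linarith [hkey]) N
  have hN0 : (0 : ℝ) < N := by exact_mod_cast hN
  have h0 : ∫ ω, ‖x 0 ω - xs‖ ^ 2 ∂P = ‖x₀ - xs‖ ^ 2 := by simp [hx, twoPoint]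
  have haN : 0 ≤ ∫ ω, ‖x N ω - xs‖ ^ 2 ∂P := integral_nonneg fun ω => sq_nonneg _
  simp only [h0] at hrec
  set a := ∫ ω, ‖x N ω - xs‖ ^ 2 ∂P
  set p := 4 * ζ ^ 2 / μ ^ 2 with hpdef
  have hp0 : 0 ≤ p := by positivity
  set R : ℝ := (N + n₀) * (N + n₀ - 1) with hR
  have hRN : (N : ℝ) ^ 2 ≤ R := by
    rw [hR, sq]
    exact mul_le_mul (by linarith) (by linarith) hN0.le (by linarith)
  have hn1 : 0 ≤ n₀ * (n₀ - 1) := mul_nonneg (by linarith) (by linarith)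
  have h1 : R * (a - p / 2) ≤ n₀ ^ 2 * ‖x₀ - xs‖ ^ 2 + 16 * W / μ ^ 2 * N := by
    have h2 : n₀ * (n₀ - 1) * ‖x₀ - xs‖ ^ 2 ≤ n₀ ^ 2 * ‖x₀ - xs‖ ^ 2 := by
      gcongr
      rw [sq]
      exact mul_le_mul_of_nonneg_left (by linarith) (by linarith)
    have h3 : 0 ≤ p / 2 * (n₀ * (n₀ - 1)) := mul_nonneg (by positivity) hn1
    have h5 : R * (a - p / 2) = R * a - p / 2 * R := by ring
    linarith
  have h4 : a - p / 2 ≤ (n₀ ^ 2 * ‖x₀ - xs‖ ^ 2 + 16 * W / μ ^ 2 * N) / N ^ 2 := by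
    have hN2 : (0 : ℝ) < (N : ℝ) ^ 2 := by positivity
    -- Replacing `R` by the smaller `N²` is legitimate only when the factor is positive; otherwise
    -- the bound is trivial.
    rcases le_or_gt (a - p / 2) 0 with h5 | h5
    · exact h5.trans (by positivity)
    · rw [le_div_iff₀ hN2, mul_comm]
      exact (mul_le_mul_of_nonneg_right hRN h5.le).trans h1
  have h6 : (n₀ ^ 2 * ‖x₀ - xs‖ ^ 2 + 16 * W / μ ^ 2 * N) / N ^ 2 =
      n₀ ^ 2 * ‖x₀ - xs‖ ^ 2 / N ^ 2 + 16 * W / (μ ^ 2 * N) := by field_simp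
  have h7 : p / 2 = 2 * ζ ^ 2 / μ ^ 2 := by rw [hpdef]; ring
  linarith

end TwoPoint

/-! ### Rate and parameters in the unconstrained case -/

/-- The smoothing radius of the two-point algorithm. -/
noncomputable def twoPointRadius (β N : ℕ) : ℝ := ((N : ℝ) + 1) ^ (-(1 / (2 * (β : ℝ))))

/-- The constant in the rate of the two-point algorithm. -/
noncomputable def twoPointConst (d β : ℕ) (μ M M₂ σ D : ℝ) : ℝ :=
  2 * twoPointOffset d β μ M₂ ^ 2 * D ^ 2 +
    2 * ((M ^ 2) ^ β / ((β - 1).factorial : ℝ) ^ 2 *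
      (4 * kernelBound β + 3 * Real.sqrt (kernelBound β)) ^ 2) / μ ^ 2 +
    32 * (kernelBound β * (d ^ 2 * M₂ ^ 4 / 2 + d ^ 2 * σ ^ 2)) / μ ^ 2

section Unconstrained

variable {d β : ℕ} {μ M M₂ σ D : ℝ}

lemma twoPointRadius_pos (N : ℕ) : 0 < twoPointRadius β N := by
  rw [twoPointRadius]; positivity

lemma twoPointRadius_sq (hβ : 2 ≤ β) (N : ℕ) :
    twoPointRadius β N ^ 2 = ((N : ℝ) + 1) ^ (-(1 / (β : ℝ))) := by
  have hb : (0 : ℝ) < β := by exact_mod_cast (show 0 < β by omega)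
  rw [twoPointRadius, ← Real.rpow_natCast, ← Real.rpow_mul (by positivity)]
  congr 1
  push_cast
  field_simp

/-- With `t = N + 1` and `δ² = t^(-1/β)`, both `δ^(2(β-1))` and `t⁻¹ / δ²` equal `ρ = t^(-(β-1)/β)`,
while the initial error decays faster. The factors `2` come from `1 / N ≤ 2 / t`. -/
lemma twoPoint_rate (hβ : 2 ≤ β) {N : ℕ} (hN : 1 ≤ N) {a : ℝ} (ha : 0 ≤ a) (haD : a ≤ D) :
    twoPointOffset d β μ M₂ ^ 2 * a ^ 2 / N ^ 2 +
      2 * biasBound β M (twoPointRadius β N) ^ 2 / μ ^ 2 + 16 * (kernelBound β *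
        (d ^ 2 * M₂ ^ 4 * twoPointRadius β N ^ 2 / 2 + d ^ 2 * σ ^ 2 / twoPointRadius β N ^ 2)) /
          (μ ^ 2 * N) ≤
      twoPointConst d β μ M M₂ σ D * (1 / (N : ℝ)) ^ (((β : ℝ) - 1) / β) := by
  have hb : (2 : ℝ) ≤ β := by exact_mod_cast hβ
  have hb0 : (0 : ℝ) < β := by linarith
  have hN1 : (1 : ℝ) ≤ N := by exact_mod_cast hN
  have hκ := kernelBound_nonneg β
  set t : ℝ := (N : ℝ) + 1 with ht
  have ht0 : 0 < t := by positivity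
  have ht1 : 1 ≤ t := by linarith
  set ρ : ℝ := t ^ (-(((β : ℝ) - 1) / β)) with hρ
  have hρ0 : 0 < ρ := by positivity
  have hρN : ρ ≤ (1 / (N : ℝ)) ^ (((β : ℝ) - 1) / β) := by
    rw [hρ, Real.rpow_neg ht0.le, ← Real.inv_rpow ht0.le]
    refine Real.rpow_le_rpow (by positivity) ?_ (div_nonneg (by linarith) hb0.le)
    rw [one_div]
    exact inv_anti₀ (by positivity) (by linarith)
  have hNt : 1 / (N : ℝ) ≤ 2 * t⁻¹ := by
    rw [div_le_iff₀ (by positivity), ← div_eq_mul_inv, div_mul_eq_mul_div, le_div_iff₀ ht0]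
    linarith
  have htρ : t⁻¹ ≤ ρ := by
    rw [← Real.rpow_neg_one, hρ]
    refine Real.rpow_le_rpow_of_exponent_le ht1 (neg_le_neg ?_)
    rw [div_le_one hb0]
    linarith
  have hδ := twoPointRadius_sq hβ N
  rw [← ht] at hδ
  have hδ0 := twoPointRadius_pos (β := β) N
  set δ := twoPointRadius β N
  have hδ1 : δ ^ 2 ≤ 1 := by
    rw [hδ]
    exact Real.rpow_le_one_of_one_le_of_nonpos ht1 (by rw [Left.neg_nonpos_iff]; positivity)
  have hδt : t⁻¹ / δ ^ 2 = ρ := by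
    rw [hδ, ← Real.rpow_neg_one, ← Real.rpow_sub ht0, hρ]
    congr 1
    field_simp
    ring
  have hbias : biasBound β M δ ^ 2 = (M ^ 2) ^ β / ((β - 1).factorial : ℝ) ^ 2 *
      (4 * kernelBound β + 3 * Real.sqrt (kernelBound β)) ^ 2 * ρ := by
    have h1 : (δ ^ 2) ^ (β - 1) = ρ := by
      rw [hδ, ← Real.rpow_natCast, ← Real.rpow_mul ht0.le, Nat.cast_sub (by omega), hρ]
      congr 1
      push_cast
      field_simp
    rw [biasBound_sq_eq hβ hδ0, h1]
    ring
  have t1 : twoPointOffset d β μ M₂ ^ 2 * a ^ 2 / N ^ 2 ≤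
      2 * twoPointOffset d β μ M₂ ^ 2 * D ^ 2 * ρ := by
    have h1 : 1 / (N : ℝ) ^ 2 ≤ 2 * ρ := by
      have h2 : 1 / (N : ℝ) ^ 2 ≤ 1 / N := by
        refine one_div_le_one_div_of_le (by positivity) ?_
        nlinarith
      linarith
    calc _ = twoPointOffset d β μ M₂ ^ 2 * a ^ 2 * (1 / (N : ℝ) ^ 2) := by ring
      _ ≤ twoPointOffset d β μ M₂ ^ 2 * D ^ 2 * (2 * ρ) := by gcongr
      _ = _ := by ring
  have t2 : 16 * (kernelBound β * (d ^ 2 * M₂ ^ 4 * δ ^ 2 / 2 + d ^ 2 * σ ^ 2 / δ ^ 2)) /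
      (μ ^ 2 * N) ≤ 32 * (kernelBound β * (d ^ 2 * M₂ ^ 4 / 2 + d ^ 2 * σ ^ 2)) / μ ^ 2 * ρ := by
    have h1 : d ^ 2 * M₂ ^ 4 * δ ^ 2 / 2 + d ^ 2 * σ ^ 2 / δ ^ 2 ≤
        (d ^ 2 * M₂ ^ 4 / 2 + d ^ 2 * σ ^ 2) * (1 / δ ^ 2) := by
      have h2 : 1 ≤ 1 / δ ^ 2 := by rw [le_div_iff₀ (by positivity)]; linarith
      have h3 : (d : ℝ) ^ 2 * M₂ ^ 4 * δ ^ 2 / 2 ≤ d ^ 2 * M₂ ^ 4 / 2 * (1 / δ ^ 2) := by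
        calc (d : ℝ) ^ 2 * M₂ ^ 4 * δ ^ 2 / 2 = d ^ 2 * M₂ ^ 4 / 2 * δ ^ 2 := by ring
          _ ≤ _ := by gcongr; exact hδ1.trans h2
      calc _ ≤ d ^ 2 * M₂ ^ 4 / 2 * (1 / δ ^ 2) + d ^ 2 * σ ^ 2 / δ ^ 2 := by gcongr
        _ = _ := by ring
    calc _ = 16 * (kernelBound β * (d ^ 2 * M₂ ^ 4 * δ ^ 2 / 2 + d ^ 2 * σ ^ 2 / δ ^ 2)) /
          μ ^ 2 * (1 / N) := by field_simp
      _ ≤ 16 * (kernelBound β * ((d ^ 2 * M₂ ^ 4 / 2 + d ^ 2 * σ ^ 2) * (1 / δ ^ 2))) /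
          μ ^ 2 * (2 * t⁻¹) := by gcongr
      _ = 32 * (kernelBound β * (d ^ 2 * M₂ ^ 4 / 2 + d ^ 2 * σ ^ 2)) / μ ^ 2 * (t⁻¹ / δ ^ 2) := by
        ring
      _ = _ := by rw [hδt]
  have hC : 0 ≤ twoPointConst d β μ M M₂ σ D := by rw [twoPointConst]; positivity
  calc _ ≤ twoPointConst d β μ M M₂ σ D * ρ := by
        rw [twoPointConst, add_mul, add_mul]
        refine add_le_add (add_le_add t1 (le_of_eq ?_)) t2
        rw [hbias]
        ring
    _ ≤ _ := mul_le_mul_of_nonneg_left hρN hC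

lemma exists_twoPoint_parameters (d β : ℕ) (hd : 1 ≤ d) (hβ : 2 ≤ β) (μ Mβ : ℝ) (hμ : 0 < μ)
    (hMβ : 0 < Mβ) (M₂ : ℝ) :
      ∃ γ δ : ℕ → ℕ → ℝ, (∀ N n, 0 < γ N n ∧ 0 < δ N n) ∧
        ∀ σ D : ℝ, 0 ≤ σ → ∃ N₀ : ℕ, ∀ N ≥ N₀,
        ∀ (f : EuclideanSpace ℝ (Fin d) → ℝ) (xs x₀ : EuclideanSpace ℝ (Fin d)),
          SmoothOrderOn Set.univ β Mβ f → SmoothOrderOn Set.univ 2 M₂ f →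
          StrongConvexOn Set.univ μ f → IsMinOn f Set.univ xs → ‖x₀ - xs‖ ≤ D →
        ∀ {Ω : Type*} {mΩ : MeasurableSpace Ω} (P : Measure Ω) [IsProbabilityMeasure P]
          (ℱ : Filtration ℕ mΩ) (r : ℕ → Ω → ℝ) (u : ℕ → Ω → EuclideanSpace ℝ (Fin d))
          (εp εm : ℕ → Ω → ℝ),
          IsSampling P ℱ r u → IsNoise P ℱ r u σ εp → IsNoise P ℱ r u σ εm →
        ∀ X : Ω → EuclideanSpace ℝ (Fin d),
          (∀ ω, X ω = twoPoint f (kernelFun β) (γ N) (δ N) x₀ (fun n => r n ω) (fun n => u n ω)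
            (fun n => εp n ω) (fun n => εm n ω) N) →
          Integrable (fun ω => ‖X ω - xs‖ ^ 2) P ∧
          ∫ ω, ‖X ω - xs‖ ^ 2 ∂P ≤
            16 * Mβ ^ 2 / μ ^ 2 * (2 * σ ^ 2 + 16) *
                ((d : ℝ) ^ 2 * Real.log (N + 1) / N) ^ (((β : ℝ) - 1) / β) +
              48 * (β : ℝ) ^ 3 * M₂ ^ 4 / (μ ^ 2 * Mβ ^ 2) *
                ((d : ℝ) ^ 2 * Real.log (N + 1) / N) ^ (((β : ℝ) + 1) / β) ∧
          Integrable (fun ω => f (X ω)) P ∧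
          ∫ ω, f (X ω) ∂P - f xs ≤ M₂ ^ 2 / 2 * ∫ ω, ‖X ω - xs‖ ^ 2 ∂P := by
  have hb : (2 : ℝ) ≤ β := by exact_mod_cast hβ
  have hb0 : (0 : ℝ) < β := by linarith
  have hn₀ := one_le_twoPointOffset (d := d) (β := β) (μ := μ) (M₂ := M₂)
  refine ⟨fun _ n => 4 / (μ * (n + twoPointOffset d β μ M₂)), fun N _ => twoPointRadius β N,
    fun N n => ⟨by positivity, twoPointRadius_pos N⟩, ?_⟩
  intro σ D hσ
  have hexp : 0 < ((β : ℝ) - 1) / β := div_pos (by linarith) hb0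
  have hlog : Tendsto (fun N : ℕ => Real.log ((N : ℝ) + 1) ^ (((β : ℝ) - 1) / β)) atTop atTop :=
    (tendsto_rpow_atTop hexp).comp (Real.tendsto_log_atTop.comp
      (tendsto_atTop_add_const_right _ _ tendsto_natCast_atTop_atTop))
  -- `256 = 16 * 16` is the part of the claimed coefficient that is free of `σ`. The power of the
  -- logarithm eventually exceeds the ratio of the true constant to it, uniformly in `f`, `xs` and
  -- `x₀`.
  obtain ⟨N₁, hN₁⟩ := eventually_atTop.1 (hlog.eventually_ge_atTop
    (twoPointConst d β μ Mβ M₂ σ D / (256 * Mβ ^ 2 / μ ^ 2)))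
  refine ⟨max N₁ 1, fun N hN f xs x₀ hf hf2 hfc hmin hD Ω mΩ P _ ℱ r u εp εm hs hp hm X hX => ?_⟩
  have hN1 : 1 ≤ N := (le_max_right _ _).trans hN
  have hN0 : (0 : ℝ) < N := by exact_mod_cast hN1
  have hlogN := hN₁ N ((le_max_left _ _).trans hN)
  set x : ℕ → Ω → EuclideanSpace ℝ (Fin d) := fun n ω =>
    twoPoint f (kernelFun β) (fun n => 4 / (μ * (n + twoPointOffset d β μ M₂)))
      (fun _ => twoPointRadius β N) x₀ (fun n => r n ω) (fun n => u n ω) (fun n => εp n ω)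
      (fun n => εm n ω) n with hx
  have hXx : X = x N := funext hX
  obtain ⟨hi, hbd⟩ := twoPoint_bound hs hp hm hd hβ hf hf2 hfc hμ (twoPointRadius_pos N)
    (fun _ => rfl) hmin (x := x) (x₀ := x₀) (fun _ _ => rfl) hN1
  rw [← hXx] at hi hbd
  have hrate := hbd.trans (twoPoint_rate (d := d) (μ := μ) (M := Mβ) (M₂ := M₂) (σ := σ) hβ hN1
    (norm_nonneg _) hD)
  have hXm : Measurable X := by
    rw [hXx]
    exact (measurable_twoPoint hs hp hm (hf.contDiff_one hβ).continuous _ N).mono (ℱ.le N) le_rfl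
  obtain ⟨h1, h2⟩ := hf2.integral_sub_le convex_univ (Set.mem_univ xs) hmin hXm
    (fun _ => Set.mem_univ _) hi
  refine ⟨hi, hrate.trans ?_, h1, h2⟩
  have hl0 : 0 ≤ Real.log ((N : ℝ) + 1) := Real.log_nonneg (by linarith)
  have hd1 : (1 : ℝ) ≤ (d : ℝ) ^ 2 := one_le_pow₀ (by exact_mod_cast hd)
  have hsec : 0 ≤ 48 * (β : ℝ) ^ 3 * M₂ ^ 4 / (μ ^ 2 * Mβ ^ 2) *
      ((d : ℝ) ^ 2 * Real.log (N + 1) / N) ^ (((β : ℝ) + 1) / β) := by positivity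
  -- The first term of the claimed bound suffices; the second is nonnegative and is dropped.
  refine le_add_of_le_of_nonneg ?_ hsec
  rw [div_le_iff₀ (by positivity)] at hlogN
  calc _ ≤ Real.log ((N : ℝ) + 1) ^ (((β : ℝ) - 1) / β) * (256 * Mβ ^ 2 / μ ^ 2) *
        (1 / (N : ℝ)) ^ (((β : ℝ) - 1) / β) := by gcongr
    _ = 256 * Mβ ^ 2 / μ ^ 2 * (Real.log ((N : ℝ) + 1) * (1 / N)) ^ (((β : ℝ) - 1) / β) := by
        rw [Real.mul_rpow hl0 (by positivity)]; ring
    _ ≤ 256 * Mβ ^ 2 / μ ^ 2 *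
        ((d : ℝ) ^ 2 * Real.log (N + 1) / N) ^ (((β : ℝ) - 1) / β) := by
        gcongr
        rw [mul_one_div]
        gcongr
        exact le_mul_of_one_le_left hl0 hd1
    _ ≤ _ := by
        gcongr
        have : 0 ≤ 16 * Mβ ^ 2 / μ ^ 2 * (2 * σ ^ 2) := by positivity
        calc 256 * Mβ ^ 2 / μ ^ 2 = 16 * Mβ ^ 2 / μ ^ 2 * 16 := by ring
          _ ≤ _ := by linarith

end Unconstrained

theorem mainTheorem7 (d β : ℕ) (hd : 1 ≤ d) (hβ : 2 ≤ β) (μ Mβ : ℝ) (hμ : 0 < μ) (hMβ : 0 < Mβ) :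
    -- unconstrained optimization, two-point algorithm
    (∀ M₂ : ℝ, 0 < M₂ →
      ∃ γ δ : ℕ → ℕ → ℝ, (∀ N n, 0 < γ N n ∧ 0 < δ N n) ∧
        ∀ σ D : ℝ, 0 ≤ σ → ∃ N₀ : ℕ, ∀ N ≥ N₀,
        ∀ (f : EuclideanSpace ℝ (Fin d) → ℝ) (xs x₀ : EuclideanSpace ℝ (Fin d)),
          SmoothOrderOn Set.univ β Mβ f → SmoothOrderOn Set.univ 2 M₂ f →
          StrongConvexOn Set.univ μ f → IsMinOn f Set.univ xs → ‖x₀ - xs‖ ≤ D →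
        ∀ {Ω : Type*} {mΩ : MeasurableSpace Ω} (P : Measure Ω) [IsProbabilityMeasure P]
          (ℱ : Filtration ℕ mΩ) (r : ℕ → Ω → ℝ) (u : ℕ → Ω → EuclideanSpace ℝ (Fin d))
          (εp εm : ℕ → Ω → ℝ),
          IsSampling P ℱ r u → IsNoise P ℱ r u σ εp → IsNoise P ℱ r u σ εm →
        ∀ X : Ω → EuclideanSpace ℝ (Fin d),
          (∀ ω, X ω = twoPoint f (kernelFun β) (γ N) (δ N) x₀ (fun n => r n ω) (fun n => u n ω)
            (fun n => εp n ω) (fun n => εm n ω) N) →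
          Integrable (fun ω => ‖X ω - xs‖ ^ 2) P ∧
          ∫ ω, ‖X ω - xs‖ ^ 2 ∂P ≤
            16 * Mβ ^ 2 / μ ^ 2 * (2 * σ ^ 2 + 16) *
                ((d : ℝ) ^ 2 * Real.log (N + 1) / N) ^ (((β : ℝ) - 1) / β) +
              48 * (β : ℝ) ^ 3 * M₂ ^ 4 / (μ ^ 2 * Mβ ^ 2) *
                ((d : ℝ) ^ 2 * Real.log (N + 1) / N) ^ (((β : ℝ) + 1) / β) ∧
          Integrable (fun ω => f (X ω)) P ∧
          ∫ ω, f (X ω) ∂P - f xs ≤ M₂ ^ 2 / 2 * ∫ ω, ‖X ω - xs‖ ^ 2 ∂P) ∧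
    -- constrained optimization, one-point algorithm
    (∃ (γ : ℕ → ℕ → ℝ) (δ : ℕ → ℝ), (∀ N n, 0 < γ N n) ∧ (∀ N, 0 < δ N) ∧
        Tendsto δ atTop (𝓝 0) ∧
        ∀ (σ : ℝ) (K : Set (EuclideanSpace ℝ (Fin d))) (f : EuclideanSpace ℝ (Fin d) → ℝ),
          0 ≤ σ → IsCompact K → Convex ℝ K →
          SmoothOrderOn Set.univ β Mβ f → StrongConvexOn Set.univ μ f →
        ∃ N₀ : ℕ, ∀ N ≥ N₀, ∀ (C : ℝ) (xs x₀ : EuclideanSpace ℝ (Fin d)),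
          (∀ y ∈ Metric.cthickening (δ N) K, |f y| ≤ C) →
          xs ∈ K → IsMinOn f K xs → x₀ ∈ K →
        ∀ {Ω : Type*} {mΩ : MeasurableSpace Ω} (P : Measure Ω) [IsProbabilityMeasure P]
          (ℱ : Filtration ℕ mΩ) (r : ℕ → Ω → ℝ) (u : ℕ → Ω → EuclideanSpace ℝ (Fin d))
          (ε : ℕ → Ω → ℝ),
          IsSampling P ℱ r u → IsNoise P ℱ r u σ ε →
        ∀ X : Ω → EuclideanSpace ℝ (Fin d),
          (∀ ω, X ω = onePoint K f (kernelFun β) (γ N) (fun _ => δ N) x₀ (fun n => r n ω)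
            (fun n => u n ω) (fun n => ε n ω) N) →
          Integrable (fun ω => ‖X ω - xs‖ ^ 2) P ∧
          ∫ ω, ‖X ω - xs‖ ^ 2 ∂P ≤
            16 * (β : ℝ) * ((d : ℝ) ^ 2 / N) ^ (((β : ℝ) - 1) / β) *
              (2 * Real.exp 1 * Mβ / μ) ^ 2 * (3 * C ^ 2 + 3 * σ ^ 2 + 1) ∧
          (∀ M₂ : ℝ, 0 ≤ M₂ → SmoothOrderOn K 2 M₂ f → IsMinOn f Set.univ xs →
            Integrable (fun ω => f (X ω)) P ∧
            ∫ ω, f (X ω) ∂P - f xs ≤ M₂ ^ 2 / 2 * ∫ ω, ‖X ω - xs‖ ^ 2 ∂P ∧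
            ∫ ω, f (X ω) ∂P - f xs ≤
              16 * (β : ℝ) * ((d : ℝ) ^ 2 / N) ^ (((β : ℝ) - 1) / β) *
                (2 * Real.exp 1 * Mβ * M₂ / μ) ^ 2 * (3 * C ^ 2 + 3 * σ ^ 2 + 1))) := by
  exact ⟨fun M₂ _ => exists_twoPoint_parameters d β hd hβ μ Mβ hμ hMβ M₂,
    exists_onePoint_parameters d β hd hβ μ Mβ hμ hMβ⟩
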